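/- Let $d\in\mathbb N$, $r>0$, and let $\mathcal X\subset[0,r]^d$ be nonempty and compact (for example a finite set, or a compact convex set). Let $f$ be a centred Gaussian process on $\mathcal X$ with continuous sample paths and covariance function $k$, $k(\bm x,\bm x)\le 1$ for all $\bm x\in\mathcal X$. Querying $\bm x_t$ gives $y_t=f(\bm x_t)+\varepsilon_t$ with i.i.d. noise $\varepsilon_t\sim\mathcal N(0,\sigma_{\rm noise}^2)$, $\sigma_{\rm noise}>0$, independent of $f$. For a finite data set $\mathcal D$ let $\mu(\cdot;\mathcal D)$ and $\sigma(\cdot;\mathcal D)$ be the posterior mean and standard deviation of $f$, and $p(f\mid\mathcal D)$ its posterior law. Write $f^*=\max_{\mathcal X}f$, $\mathcal D_t=\{(\bm x_i,y_i)\}_{i=1}^t$, and let $\gamma_T=\sup_{\bm x_1,\dots,\bm x_T\in\mathcal X}I(\bm y_T;\bm f_T)$ be the maximum information gain, where $I$ is Shannon mutual information, $\bm f_T=(f(\bm x_i))_{i\le T}$ and $\bm y_T=(f(\bm x_i)+\varepsilon_i)_{i\le T}$. Let $\mathcal A$ be a (possibly randomized) sequential algorithm, which in round $t$ maps a data set of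 size $t-1$ and a fresh random seed to a point of $\mathcal X$. Assume that there are constants $\zeta_t,\xi_t\in\mathbb R$ with $\sum_{t=1}^T\zeta_t=\tilde O(T)$ and $\sum_{t=1}^T\xi_t=O(1)$, and for every $t\ge1$ random variables $u_t(\mathcal D)$, $v_t(\mathcal D)$ (which may depend on $f$ and on the seed) such that for every data set $\mathcal D$ of size $t-1$, with $f\sim p(f\mid\mathcal D)$, an independent seed and $\bm x_t=\mathcal A(\mathcal D)$, $$\mathbb E[f^*-f(\bm x_t)\mid\mathcal D]\le\mathbb E[u_t(\mathcal D)\,\sigma(\bm x_t;\mathcal D)+v_t(\mathcal D)\mid\mathcal D],\qquad \mathbb E[u_t(\mathcal D)^2\mid\mathcal D]\le\zeta_t,\qquad \mathbb E[v_t(\mathcal D)\mid\mathcal D]\le\xi_t .$$ Randomized kriging believer with base algorithm $\mathcal A$: at the beginning of round $t$ the observations with indices in $N_{t-1}\subset\{1,\dots,t-1\}$ are available. The sets $N_t$ are increasing in $t$, and which observations arrive may depend on the queries made, on the available observations and on exogenous randomness independent of $(f,\varepsilon)$; the number $t-1-|N_{t-1}|$ of pending queries (at most $Q$ with $Q+1$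 parallel workers) is arbitrary. Draw $g_t\sim p(f\mid\{(\bm x_i,y_i)\}_{i\in N_{t-1}})$ and independent $\varepsilon_i^{(t)}\sim\mathcal N(0,\sigma_{\rm noise}^2)$, put $y_i^{(t)}=y_i$ for $i\in N_{t-1}$ and $y_i^{(t)}=g_t(\bm x_i)+\varepsilon_i^{(t)}$ for the other $i\le t-1$, and query $\bm x_t=\mathcal A(\{(\bm x_i,y_i^{(t)})\}_{i=1}^{t-1})$. Let $\hat{\bm x}_T$ be a measurable selection, as a function of $\mathcal D_T$, from $\mathop{\rm argmax}_{\bm x\in\mathcal X}\mu(\bm x;\mathcal D_T)$. Then for every $T\ge1$ the simple regret $f^*-f(\hat{\bm x}_T)$ is integrable, and the Bayesian simple regret satisfies $$\mathrm{BSR}_T=\mathbb E[f^*-f(\hat{\bm x}_T)]\le\frac{B_T}{T},\qquad B_T=\sqrt{C_1\gamma_T\sum_{t=1}^T\zeta_t}+\sum_{t=1}^T\xi_t,\qquad C_1=\frac{2}{\log(1+\sigma_{\rm noise}^{-2})}.$$ The bound does not depend on $Q$. Moreover, if $k$ is not identically zero on the diagonal, then $B_T=\tilde O(\sqrt{T\gamma_T})$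 as $T\to\infty$. Here $\tilde O$ hides powers of $\log T$. -/

import Mathlib

open MeasureTheory ProbabilityTheory Filter Asymptotics
open scoped NNReal ENNReal

noncomputable section

/-! ### Sample paths, data sets and the Gaussian process model -/

/-- The space of continuous sample paths carries its Borel sigma-algebra (for compact `X` the
topology is that of uniform convergence). -/
instance ContinuousMap.instBorelMeasurableSpace {X : Type*} [TopologicalSpace X] :
    MeasurableSpace C(X, ℝ) := borel _

instance ContinuousMap.instBorelSpaceReal {X : Type*} [TopologicalSpace X] :
    BorelSpace C(X, ℝ) := ⟨rfl⟩

/-- A data set with `n` input-output pairs. -/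
abbrev Dataset (X : Type*) (n : ℕ) : Type _ := Fin n → X × ℝ

/-- `P` is the law of a centred Gaussian process with covariance function `k` on the space of
continuous paths. -/
structure IsCenteredGP {X : Type*} [TopologicalSpace X] (P : Measure C(X, ℝ))
    (k : X → X → ℝ) : Prop where
  isGaussianProcess : IsGaussianProcess (fun (x : X) (φ : C(X, ℝ)) => φ x) P
  mean_eq_zero : ∀ x, ∫ φ, φ x ∂P = 0
  cov_eq : ∀ x x', covariance (fun φ : C(X, ℝ) => φ x) (fun φ : C(X, ℝ) => φ x') P = k x x'

/-- The posterior law of the path given the data `D`, for observations corrupted by independent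
`N(0, σ²)` noise: the prior reweighted by the normalised Gaussian likelihood
`∏ i, exp (-(yᵢ - φ xᵢ)² / (2 σ²))` (Bayes' formula). -/
def gpPosterior {X ι : Type*} [TopologicalSpace X] [Fintype ι] (P : Measure C(X, ℝ)) (σ : ℝ≥0)
    (D : ι → X × ℝ) : Measure C(X, ℝ) :=
  P.tilted fun φ => -(∑ i, ((D i).2 - φ (D i).1) ^ 2) / (2 * (σ : ℝ) ^ 2)

/-- The regularised kernel matrix `K + σ² I`. -/
def gramMatrix {X : Type*} (k : X → X → ℝ) (σ : ℝ≥0) {n : ℕ} (D : Dataset X n) :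
    Matrix (Fin n) (Fin n) ℝ :=
  Matrix.of (fun i j => k (D i).1 (D j).1) + (σ : ℝ) ^ 2 • (1 : Matrix (Fin n) (Fin n) ℝ)

/-- The posterior mean `μ(x; D) = k(x)ᵀ (K + σ² I)⁻¹ y`. -/
def posteriorMean {X : Type*} (k : X → X → ℝ) (σ : ℝ≥0) {n : ℕ} (D : Dataset X n) (x : X) : ℝ :=
  (fun i => k x (D i).1) ⬝ᵥ Matrix.mulVec (gramMatrix k σ D)⁻¹ (fun i => (D i).2)

/-- The posterior variance `σ²(x; D) = k(x, x) - k(x)ᵀ (K + σ² I)⁻¹ k(x)`. -/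
def posteriorVar {X : Type*} (k : X → X → ℝ) (σ : ℝ≥0) {n : ℕ} (D : Dataset X n) (x : X) : ℝ :=
  k x x - (fun i => k x (D i).1) ⬝ᵥ Matrix.mulVec (gramMatrix k σ D)⁻¹ (fun i => k x (D i).1)

/-- The posterior standard deviation `σ(x; D)`. -/
def posteriorStd {X : Type*} (k : X → X → ℝ) (σ : ℝ≥0) {n : ℕ} (D : Dataset X n) (x : X) : ℝ :=
  Real.sqrt (posteriorVar k σ D x)

/-- The maximum of a path (attained when `X` is compact and nonempty). -/
def pathMax {X : Type*} [TopologicalSpace X] (φ : C(X, ℝ)) : ℝ := ⨆ x, φ x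

/-! ### Maximum information gain -/

/-- Shannon mutual information of the two coordinates of a joint law (natural logarithm). -/
def mutualInfo {α β : Type*} [MeasurableSpace α] [MeasurableSpace β] (ρ : Measure (α × β)) : ℝ≥0∞ :=
  InformationTheory.klDiv ρ (ρ.fst.prod ρ.snd)

/-- The joint law of the noisy observations `(f (xᵢ) + εᵢ)ᵢ` and the noiseless values `(f (xᵢ))ᵢ`
at fixed inputs. -/
def observationLaw {X : Type*} [TopologicalSpace X] (P : Measure C(X, ℝ)) (σ : ℝ≥0) {T : ℕ}
    (x : Fin T → X) : Measure ((Fin T → ℝ) × (Fin T → ℝ)) :=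
  (P.prod (Measure.pi fun _ : Fin T => gaussianReal 0 (σ ^ 2))).map
    fun p => (fun i => p.1 (x i) + p.2 i, fun i => p.1 (x i))

/-- The maximum information gain `γ_T`. -/
def maxInfoGain {X : Type*} [TopologicalSpace X] (P : Measure C(X, ℝ)) (σ : ℝ≥0) (T : ℕ) : ℝ :=
  (⨆ x : Fin T → X, mutualInfo (observationLaw P σ x)).toReal

/-! ### The condition on the base algorithm -/

/-- `a = Õ(b)`: big-O up to a power of `log T`. -/
def IsSoftBigO (a b : ℕ → ℝ) : Prop :=
  ∃ p : ℕ, a =O[atTop] fun T : ℕ => b T * Real.log T ^ p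

/-- The condition on a (randomised) sequential algorithm with constants `ζ`, `ξ`. Rounds are counted
from `0`: in round `t` the algorithm maps a data set `D` of size `t` and a random seed of law `ν` to
the query `A t D s`. For every data set `D`, expectations given `D` are taken over an
objective function drawn from the posterior given `D` and an independent seed. The random
variables `u t D`, `v t D` may depend on both. -/
def RegretCondition {X S : Type*} [TopologicalSpace X] [MeasurableSpace X] [MeasurableSpace S]
    (P : Measure C(X, ℝ)) (k : X → X → ℝ) (σ : ℝ≥0) (ν : Measure S)
    (A : ∀ t : ℕ, Dataset X t → S → X) (ζ ξ : ℕ → ℝ) : Prop :=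
  (∀ t : ℕ, ∃ u v : Dataset X t → C(X, ℝ) × S → ℝ,
    Measurable (fun q : Dataset X t × (C(X, ℝ) × S) => u q.1 q.2) ∧
    Measurable (fun q : Dataset X t × (C(X, ℝ) × S) => v q.1 q.2) ∧
    ∀ D : Dataset X t,
      (∫ q, (pathMax q.1 - q.1 (A t D q.2)) ∂((gpPosterior P σ D).prod ν) ≤
        ∫ q, (u D q * posteriorStd k σ D (A t D q.2) + v D q) ∂((gpPosterior P σ D).prod ν)) ∧
      Integrable (fun q => u D q ^ 2) ((gpPosterior P σ D).prod ν) ∧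
      Integrable (v D) ((gpPosterior P σ D).prod ν) ∧
      ∫ q, u D q ^ 2 ∂((gpPosterior P σ D).prod ν) ≤ ζ t ∧
      ∫ q, v D q ∂((gpPosterior P σ D).prod ν) ≤ ξ t) ∧
  IsSoftBigO (fun T => ∑ t ∈ Finset.range T, ζ t) (fun T => (T : ℝ)) ∧
  (fun T : ℕ => ∑ t ∈ Finset.range T, ξ t) =O[atTop] fun _ => (1 : ℝ)

/-- `B_T = √(C₁ γ_T ∑ ζ_t) + ∑ ξ_t` with `C₁ = 2 / log (1 + σ⁻²)`. -/
def regretBound {X : Type*} [TopologicalSpace X] (P : Measure C(X, ℝ)) (σ : ℝ≥0)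
    (ζ ξ : ℕ → ℝ) (T : ℕ) : ℝ :=
  Real.sqrt (2 / Real.log (1 + ((σ : ℝ) ^ 2)⁻¹) * maxInfoGain P σ T * ∑ t ∈ Finset.range T, ζ t)
    + ∑ t ∈ Finset.range T, ξ t

/-! ### Randomised kriging believer -/

/-- The random objects of a parallel run on a sample space `Ω`; rounds and queries are numbered
from `0`. -/
structure ParallelRun (Ω X S W : Type*) [TopologicalSpace X] where
  /-- the objective function -/
  f : Ω → C(X, ℝ)
  /-- the observation noise of each query -/
  ε : ℕ → Ω → ℝ
  /-- exogenous randomness of the workers (e.g. of evaluation times) -/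
  w : Ω → W
  /-- the path sampled from the posterior in each round -/
  g : ℕ → Ω → C(X, ℝ)
  /-- `η t ω i` is the noise used in round `t` for imputing the observation of query `i` -/
  η : ℕ → Ω → ℕ → ℝ
  /-- the seed of the base algorithm in each round -/
  s : ℕ → Ω → S
  /-- the queries -/
  x : ℕ → Ω → X
  /-- the queries whose observations are available at the beginning of each round -/
  N : ℕ → Ω → Finset ℕ

namespace ParallelRun

variable {Ω X S W : Type*} [TopologicalSpace X] (R : ParallelRun Ω X S W)

/-- The real observation of query `i`. -/
def y (i : ℕ) (ω : Ω) : ℝ := R.f ω (R.x i ω) + R.ε i ω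

/-- The complete real data of the first `n` queries. -/
def data (n : ℕ) (ω : Ω) : Dataset X n := fun i => (R.x i ω, R.y i ω)

/-- The real data available at the beginning of round `t`. -/
def availableData (t : ℕ) (ω : Ω) : (R.N t ω) → X × ℝ := fun i => (R.x i ω, R.y i ω)

/-- The data set presented to the base algorithm in round `t`: each missing observation is replaced
by a noisy value of the sampled path. -/
def imputedData (t : ℕ) (ω : Ω) : Dataset X t := fun i =>
  (R.x i ω, if (i : ℕ) ∈ R.N t ω then R.y i ω else R.g t ω (R.x i ω) + R.η t ω i)

/-- The randomness drawn in round `t`. -/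
def draw (t : ℕ) (ω : Ω) : C(X, ℝ) × ((ℕ → ℝ) × S) := (R.g t ω, (R.η t ω, R.s t ω))

/-- All randomness other than that drawn from round `t` on. -/
def past (t : ℕ) (ω : Ω) :
    (C(X, ℝ) × ((ℕ → ℝ) × W)) × (Fin t → C(X, ℝ) × ((ℕ → ℝ) × S)) :=
  ((R.f ω, (fun i => R.ε i ω, R.w ω)), fun i => R.draw i ω)

end ParallelRun

/-- The law of a sequence of independent `N(0, σ²)` variables. -/
def noiseLaw (σ : ℝ≥0) : Measure (ℕ → ℝ) := Measure.infinitePi fun _ : ℕ => gaussianReal 0 (σ ^ 2)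

/-- `R` is a run of randomised kriging believer with base algorithm `A` (with seeds of law `ν`),
prior `P` and noise level `σ`. -/
structure IsRandomizedKrigingBeliever {Ω X S W : Type*} [TopologicalSpace X] [MeasurableSpace X]
    [MeasurableSpace Ω] [MeasurableSpace S] [MeasurableSpace W]
    (P : Measure C(X, ℝ)) (σ : ℝ≥0) (ν : Measure S) (A : ∀ t : ℕ, Dataset X t → S → X)
    (μΩ : Measure Ω) (R : ParallelRun Ω X S W) : Prop where
  measurable_f : Measurable R.f
  measurable_ε : ∀ i, Measurable (R.ε i)
  measurable_w : Measurable R.w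
  measurable_g : ∀ t, Measurable (R.g t)
  measurable_η : ∀ t, Measurable (R.η t)
  measurable_s : ∀ t, Measurable (R.s t)
  /-- The objective function is a draw from the prior, the noise is i.i.d. `N(0, σ²)`, and they are
  independent of each other and of the exogenous randomness of the workers. -/
  law_base : μΩ.map (fun ω => (R.f ω, (fun i => R.ε i ω, R.w ω))) =
    P.prod ((noiseLaw σ).prod (μΩ.map R.w))
  /-- Given all randomness so far, the sampled path is a draw from the posterior given the available
  data, the imputation noise is i.i.d. `N(0, σ²)`, the seed has law `ν`, and these are
  independent. -/
  law_draw : ∀ (t : ℕ) (B : Set ((C(X, ℝ) × ((ℕ → ℝ) × W)) × (Fin t → C(X, ℝ) × ((ℕ → ℝ) × S))))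
    (C : Set (C(X, ℝ) × ((ℕ → ℝ) × S))), MeasurableSet B → MeasurableSet C →
    μΩ (R.past t ⁻¹' B ∩ R.draw t ⁻¹' C) =
      ∫⁻ ω in R.past t ⁻¹' B,
        ((gpPosterior P σ (R.availableData t ω)).prod ((noiseLaw σ).prod ν)) C ∂μΩ
  /-- The query is the choice of the base algorithm on the imputed data. -/
  query_eq : ∀ t ω, R.x t ω = A t (R.imputedData t ω) (R.s t ω)
  /-- Only earlier queries can have been observed. -/
  available_subset : ∀ t ω, R.N t ω ⊆ Finset.range t
  /-- Observations that have been obtained stay available. -/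
  available_mono : ∀ t ω, R.N t ω ⊆ R.N (t + 1) ω
  /-- Which observations arrive during round `t` is a function of the exogenous randomness of the
  workers, the queries made so far and the observations available so far; it does not look at
  outcomes that have not been observed. -/
  available_eq : ∀ t : ℕ, ∃ sched : W × ((Fin (t + 1) → X) × (Fin (t + 1) → ℝ)) → Finset ℕ,
    Measurable sched ∧ ∀ ω, R.N (t + 1) ω =
      sched (R.w ω, (fun i => R.x i ω, fun i => if (i : ℕ) ∈ R.N t ω then R.y i ω else 0))

/-- `ρ` is a measurable choice, from each data set, of a maximiser of the posterior mean. -/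
structure IsMeanMaximizer {X : Type*} [MeasurableSpace X] (k : X → X → ℝ) (σ : ℝ≥0)
    (ρ : ∀ T : ℕ, Dataset X T → X) : Prop where
  measurable : ∀ T, Measurable (ρ T)
  le_mean : ∀ (T : ℕ) (D : Dataset X T) (x : X),
    posteriorMean k σ D x ≤ posteriorMean k σ D (ρ T D)

/-- The simple regret `f* - f(x̂_T)` after `T` queries, with the recommendation
`x̂_T = ρ T D_T` computed from the complete real data. -/
def simpleRegret {Ω X S W : Type*} [TopologicalSpace X] (R : ParallelRun Ω X S W)
    (ρ : ∀ T : ℕ, Dataset X T → X) (T : ℕ) (ω : Ω) : ℝ :=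
  pathMax (R.f ω) - R.f ω (ρ T (R.data T ω))

/-- The Bayesian simple regret. -/
def bayesSimpleRegret {Ω X S W : Type*} [TopologicalSpace X] [MeasurableSpace Ω] (μΩ : Measure Ω)
    (R : ParallelRun Ω X S W) (ρ : ∀ T : ℕ, Dataset X T → X) (T : ℕ) : ℝ :=
  ∫ ω, simpleRegret R ρ T ω ∂μΩ

end

/-!
The proof compares every round with an idealised one in which no observation is pending.

*Resampling the world.* Let `D` be the complete data of the first `t` queries, available or not, and
let `D'` be the data set in which the pending values are imputed from a posterior path `g`. Given
what is observable at the beginning of the round, the objective function and the pending noise have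
the posterior law and fresh noise law (`HiddenLaw`), which is also how `g` and the imputed noise are
drawn. Hence `(D', g)` has the law of `(D, f)`, with an independent seed (`lintegral_imputedData`),
and given `D` the path is a draw from the posterior (`lintegral_data_path`). The invariant
`HiddenLaw` is propagated by Bayes' formula (`lintegral_bayes`): revealing noisy values of a
posterior path is the same as drawing these values, and then a path from the updated posterior. The
schedule may depend on everything observable, because it sees the revealed values only.

*One round.* Under the posterior given a data set, a maximiser of the posterior mean has expected
regret at most that of the query of the base algorithm, which the hypothesis on the algorithm bounds
by the mean of `u σ + v`. With the inequality of arithmetic and geometric means, weighted by `l`, it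
is at most `(l ζ + E σ² / l) / 2 + ξ` (`posterior_regret_le`). That the formula for `posteriorMean`
is the expectation under the posterior (`integral_gpPosterior`) comes from the independence of the
linear prediction error and the noisy values, which are jointly Gaussian and uncorrelated.

*All rounds.* The posterior variance does not depend on the observed values, so resampling does not
affect it, and the variances at the queries of a run add up to at most `C₁ γ_T`
(`sum_posteriorVar_le`). This uses the closed form of the mutual information as a log-determinant
(`mutualInfo_observationLaw`), computed from Gaussian densities, and its chain rule
(`toReal_mutualInfo`), which is the Schur complement formula. As more data improve the
recommendation on average (`integral_simpleRegret_anti`), the regret at the horizon is at most the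
average over the rounds; optimising the weight `l` turns the sum into the square root
(`le_sqrt_mul_of_forall_weight`).

Integrability of the regret is Fernique's theorem for the law of the path in the Banach space
`C(X, ℝ)`, which is Gaussian there since each continuous functional is a limit of combinations of
evaluations (`IsCenteredGP.isGaussian`). For the order of the bound, repeating one query with
positive prior variance keeps `γ_T` away from zero (`log_le_maxInfoGain`), so the bounded sum of the
`ξ` is absorbed (`isSoftBigO_regretBound`).
-/

set_option linter.unusedSectionVars false

/-! ### Path space -/

section PathSpace

variable {X : Type*} [MetricSpace X] [CompactSpace X]

lemma measurable_path_eval [MeasurableSpace X] [BorelSpace X] :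
    Measurable fun p : C(X, ℝ) × X => p.1 p.2 :=
  (ContinuousEval.continuous_eval (F := C(X, ℝ))).measurable

lemma measurable_path_apply (x : X) : Measurable fun φ : C(X, ℝ) => φ x :=
  (continuous_eval_const x).measurable

lemma abs_pathMax_sub_le [Nonempty X] (φ ψ : C(X, ℝ)) : |pathMax φ - pathMax ψ| ≤ ‖φ - ψ‖ := by
  have key : ∀ φ ψ : C(X, ℝ), pathMax φ ≤ pathMax ψ + ‖φ - ψ‖ := by
    intro φ ψ
    refine ciSup_le fun x => ?_
    have h1 : ψ x ≤ pathMax ψ := le_ciSup (isCompact_range ψ.continuous).bddAbove x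
    have h2 : φ x - ψ x ≤ ‖φ - ψ‖ := (le_abs_self _).trans ((φ - ψ).norm_coe_le_norm x)
    linarith
  have h1 := key φ ψ
  have h2 := key ψ φ
  rw [norm_sub_rev] at h2
  rw [abs_le]
  constructor <;> linarith

lemma continuous_pathMax [Nonempty X] : Continuous (pathMax : C(X, ℝ) → ℝ) := by
  refine (LipschitzWith.of_dist_le_mul (K := 1) fun φ ψ => ?_).continuous
  rw [Real.dist_eq, dist_eq_norm]
  simpa using abs_pathMax_sub_le φ ψ

lemma abs_pathMax_le [Nonempty X] (φ : C(X, ℝ)) : |pathMax φ| ≤ ‖φ‖ := by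
  have h := abs_pathMax_sub_le φ 0
  have h0 : pathMax (0 : C(X, ℝ)) = 0 := by simp [pathMax]
  simpa [h0] using h

/-- Interpolation along a partition of unity: every path is a uniform limit of finite combinations
of fixed continuous functions weighted by values of the path, with the nodes and functions
independent of the path. -/
lemma exists_interpolation (ε : ℝ) (hε : 0 < ε) :
    ∃ (t : Finset X) (ψ : t → C(X, ℝ)), ∀ (φ : C(X, ℝ)) (δ : ℝ),
      (∀ x y, dist x y < ε → |φ x - φ y| ≤ δ) → 0 ≤ δ → ‖φ - ∑ i : t, φ i • ψ i‖ ≤ δ := by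
  obtain ⟨t, -, ht⟩ := isCompact_univ.elim_nhds_subcover (fun x : X => Metric.ball x ε)
    (fun x _ => Metric.ball_mem_nhds x hε)
  obtain ⟨p, hp⟩ := PartitionOfUnity.exists_isSubordinate (isClosed_univ (X := X))
    (fun i : t => Metric.ball (i : X) ε) (fun i => Metric.isOpen_ball)
    (fun x hx => by
      obtain ⟨i, hi, hxi⟩ := Set.mem_iUnion₂.1 (ht hx)
      exact Set.mem_iUnion.2 ⟨⟨i, hi⟩, hxi⟩)
  refine ⟨t, fun i => p i, fun φ δ hφ hδ => ?_⟩
  rw [ContinuousMap.norm_le _ hδ]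
  intro x
  have hsum : ∑ i : t, p i x = 1 := by
    have := p.sum_eq_one (Set.mem_univ x)
    rwa [finsum_eq_sum_of_fintype] at this
  have hval : (φ - ∑ i : t, φ i • (p i : C(X, ℝ))) x = ∑ i : t, (φ x - φ i) * p i x := by
    simp only [ContinuousMap.sub_apply, ContinuousMap.sum_apply, ContinuousMap.smul_apply,
      smul_eq_mul, sub_mul, Finset.sum_sub_distrib, ← Finset.mul_sum, hsum, mul_one]
  rw [hval, Real.norm_eq_abs]
  calc |∑ i : t, (φ x - φ i) * p i x| ≤ ∑ i : t, |(φ x - φ i) * p i x| :=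
        Finset.abs_sum_le_sum_abs _ _
    _ ≤ ∑ i : t, δ * p i x := by
        refine Finset.sum_le_sum fun i _ => ?_
        rw [abs_mul, abs_of_nonneg (p.nonneg i x)]
        by_cases hx : p i x = 0
        · simp [hx]
        · have : x ∈ Metric.ball (i : X) ε := hp i (subset_tsupport _ hx)
          exact mul_le_mul_of_nonneg_right (hφ _ _ this) (p.nonneg i x)
    _ = δ := by rw [← Finset.mul_sum, hsum, mul_one]

end PathSpace

/-! ### Gaussianity of the path measure -/

/-- A pointwise limit of centred Gaussian variables is a centred Gaussian variable. -/
lemma exists_map_eq_gaussianReal_of_tendsto {Ω : Type*} [MeasurableSpace Ω] {μ : Measure Ω}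
    [IsProbabilityMeasure μ] {Y : ℕ → Ω → ℝ} {Z : Ω → ℝ} (hY : ∀ n, Measurable (Y n))
    (hZ : Measurable Z) (hlim : ∀ ω, Tendsto (fun n => Y n ω) atTop (nhds (Z ω)))
    (hG : ∀ n, ∃ v : ℝ≥0, μ.map (Y n) = gaussianReal 0 v) :
    ∃ v : ℝ≥0, μ.map Z = gaussianReal 0 v := by
  choose v hv using hG
  have : IsProbabilityMeasure (μ.map Z) := Measure.isProbabilityMeasure_map hZ.aemeasurable
  -- characteristic functions converge pointwise
  have hchar : ∀ s : ℝ, Tendsto (fun n => charFun (μ.map (Y n)) s) atTop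
      (nhds (charFun (μ.map Z) s)) := by
    intro s
    simp_rw [charFun_apply_real]
    have e1 : ∀ n, ∫ x, Complex.exp (s * x * Complex.I) ∂(μ.map (Y n))
        = ∫ ω, Complex.exp (s * Y n ω * Complex.I) ∂μ := fun n =>
      integral_map (hY n).aemeasurable (by fun_prop)
    have e2 : ∫ x, Complex.exp (s * x * Complex.I) ∂(μ.map Z)
        = ∫ ω, Complex.exp (s * Z ω * Complex.I) ∂μ :=
      integral_map hZ.aemeasurable (by fun_prop)
    simp_rw [e1, e2]
    refine tendsto_integral_of_dominated_convergence (fun _ => 1) (fun n => ?_)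
      (integrable_const _) (fun n => ?_) ?_
    · have := hY n
      exact Measurable.aestronglyMeasurable (by fun_prop)
    · refine ae_of_all _ fun ω => ?_
      rw [← Complex.ofReal_mul, Complex.norm_exp_ofReal_mul_I]
    · refine ae_of_all _ fun ω => ?_
      have hc : Continuous fun r : ℝ => Complex.exp (s * r * Complex.I) := by fun_prop
      exact (hc.tendsto _).comp (hlim ω)
  have hgauss : ∀ n (s : ℝ), charFun (μ.map (Y n)) s = Real.exp (-(v n * s ^ 2 / 2)) := by
    intro n s
    rw [hv, charFun_gaussianReal]
    push_cast
    congr 1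
    ring
  -- the limit does not vanish near zero, so the variances converge
  have hcont : Continuous fun s : ℝ => ‖charFun (μ.map Z) s‖ := continuous_charFun.norm
  have h0 : ‖charFun (μ.map Z) 0‖ = 1 := by simp
  obtain ⟨s, hs0, hs⟩ : ∃ s : ℝ, s ≠ 0 ∧ 0 < ‖charFun (μ.map Z) s‖ := by
    have hev : ∀ᶠ s in nhds (0 : ℝ), 0 < ‖charFun (μ.map Z) s‖ :=
      hcont.continuousAt.eventually (lt_mem_nhds (show 0 < ‖charFun (μ.map Z) 0‖ by rw [h0]; exact one_pos))
    obtain ⟨ε, hε, hball⟩ := Metric.eventually_nhds_iff.1 hev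
    refine ⟨ε / 2, by positivity, hball ?_⟩
    rw [Real.dist_eq, sub_zero, abs_of_pos (by positivity)]
    linarith
  have hnorm : Tendsto (fun n => Real.exp (-(v n * s ^ 2 / 2))) atTop
      (nhds ‖charFun (μ.map Z) s‖) := by
    have := (hchar s).norm
    simp_rw [hgauss] at this
    refine this.congr fun n => ?_
    rw [Complex.norm_real, Real.norm_eq_abs, abs_of_pos (Real.exp_pos _)]
  have hvlim : Tendsto (fun n => (v n : ℝ)) atTop
      (nhds (-(2 / s ^ 2) * Real.log ‖charFun (μ.map Z) s‖)) := by
    have := ((Real.continuousAt_log hs.ne').tendsto.comp hnorm).const_mul (-(2 / s ^ 2))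
    refine this.congr fun n => ?_
    simp only [Function.comp, Real.log_exp]
    field_simp
  set w : ℝ := -(2 / s ^ 2) * Real.log ‖charFun (μ.map Z) s‖
  have hw : 0 ≤ w := ge_of_tendsto' hvlim fun n => (v n).2
  lift w to ℝ≥0 using hw with w'
  refine ⟨w', Measure.ext_of_charFun ?_⟩
  ext r
  refine tendsto_nhds_unique (hchar r) ?_
  simp_rw [hgauss]
  rw [charFun_gaussianReal]
  have h1 : Tendsto (fun n => ((Real.exp (-(v n * r ^ 2 / 2)) : ℝ) : ℂ)) atTop
      (nhds ((Real.exp (-(w' * r ^ 2 / 2)) : ℝ) : ℂ)) := by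
    refine (Complex.continuous_ofReal.tendsto _).comp ((Real.continuous_exp.tendsto _).comp ?_)
    exact ((hvlim.mul_const _).div_const _).neg
  convert h1 using 2
  push_cast
  congr 1
  ring

namespace IsCenteredGP

variable {X : Type*} [MetricSpace X] [CompactSpace X] {P : Measure C(X, ℝ)}
  {k : X → X → ℝ}

lemma memLp_eval (hP : IsCenteredGP P k) (x : X) : MemLp (fun φ : C(X, ℝ) => φ x) 2 P :=
  (hP.isGaussianProcess.hasGaussianLaw_eval x).memLp_two

lemma integrable_eval (hP : IsCenteredGP P k) (x : X) : Integrable (fun φ : C(X, ℝ) => φ x) P :=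
  (hP.isGaussianProcess.hasGaussianLaw_eval x).integrable

/-- A centred Gaussian process with continuous paths defines a Gaussian measure on the Banach space
of paths: a continuous functional is a pointwise limit of finite combinations of evaluations. -/
lemma isGaussian [IsProbabilityMeasure P] (hP : IsCenteredGP P k) : IsGaussian P := by
  refine isGaussian_of_map_eq_gaussianReal fun L => ?_
  have hpos : ∀ n : ℕ, (0 : ℝ) < 1 / (n + 1) := fun n => by positivity
  choose t ψ hψ using fun n : ℕ => exists_interpolation (X := X) (1 / ((n : ℝ) + 1)) (hpos n)
  suffices h : ∃ v : ℝ≥0, P.map L = gaussianReal 0 v from ⟨0, h⟩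
  refine exists_map_eq_gaussianReal_of_tendsto (μ := P) (Z := L)
    (Y := fun n φ => ∑ i : t n, φ (i : X) * L (ψ n i))
    (fun n => Finset.measurable_sum _ fun i _ => (measurable_path_apply _).mul_const _)
    L.continuous.measurable (fun φ => ?_) (fun n => ?_)
  · have hconv : Tendsto (fun n => ∑ i : t n, φ (i : X) • ψ n i) atTop (nhds φ) := by
      rw [Metric.tendsto_atTop]
      intro δ hδ
      have huc : UniformContinuous φ := CompactSpace.uniformContinuous_of_continuous φ.continuous
      obtain ⟨ε, hε, hφ⟩ := Metric.uniformContinuous_iff.1 huc (δ / 2) (by positivity)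
      obtain ⟨N, hN⟩ := exists_nat_one_div_lt hε
      refine ⟨N, fun n hn => ?_⟩
      rw [dist_comm, dist_eq_norm]
      refine (hψ n φ (δ / 2) (fun x y hxy => ?_) (by positivity)).trans_lt (by linarith)
      have hle : 1 / ((n : ℝ) + 1) ≤ 1 / ((N : ℝ) + 1) := by
        have : (N : ℝ) ≤ n := by exact_mod_cast hn
        gcongr
      have := hφ (hxy.trans_le (hle.trans hN.le))
      rw [Real.dist_eq] at this
      exact this.le
    have := (L.continuous.tendsto φ).comp hconv
    refine this.congr fun n => ?_
    simp [map_sum]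
  · have hG : HasGaussianLaw (fun φ : C(X, ℝ) => ∑ i : t n, φ (i : X) * L (ψ n i)) P := by
      have h := ((hP.isGaussianProcess.comp_right (fun i : t n => (i : X))).smul
        (fun i => L (ψ n i))).hasGaussianLaw_fun_sum (I := Finset.univ)
      simpa [mul_comm, Function.comp_def] using h
    have hmean : ∫ φ : C(X, ℝ), ∑ i : t n, φ (i : X) * L (ψ n i) ∂P = 0 := by
      rw [integral_finsetSum _ fun (i : t n) _ => (hP.integrable_eval (i : X)).mul_const _]
      simp [integral_mul_const, hP.mean_eq_zero]
    exact ⟨_, by rw [hG.map_eq_gaussianReal, hmean]⟩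

/-- Fernique's theorem for the path measure. -/
lemma integrable_norm [IsProbabilityMeasure P] (hP : IsCenteredGP P k) :
    Integrable (fun φ : C(X, ℝ) => ‖φ‖) P :=
  have := hP.isGaussian
  (IsGaussian.integrable_id (μ := P)).norm

lemma cov_symm (hP : IsCenteredGP P k) (x x' : X) : k x x' = k x' x := by
  rw [← hP.cov_eq, ← hP.cov_eq, covariance_comm]

lemma integral_mul (hP : IsCenteredGP P k) [IsProbabilityMeasure P] (x x' : X) :
    ∫ φ : C(X, ℝ), φ x * φ x' ∂P = k x x' := by
  rw [← hP.cov_eq, covariance_eq_sub (hP.memLp_eval x) (hP.memLp_eval x')]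
  simp [hP.mean_eq_zero]

lemma self_nonneg (hP : IsCenteredGP P k) [IsProbabilityMeasure P] (x : X) : 0 ≤ k x x := by
  rw [← hP.integral_mul]
  exact integral_nonneg fun φ => mul_self_nonneg _

lemma measurable_kernel [MeasurableSpace X] [BorelSpace X] [IsProbabilityMeasure P]
    (hP : IsCenteredGP P k) : Measurable fun p : X × X => k p.1 p.2 := by
  have h : StronglyMeasurable
      (Function.uncurry fun (p : X × X) (φ : C(X, ℝ)) => φ p.1 * φ p.2) := by
    refine Measurable.stronglyMeasurable (Measurable.mul ?_ ?_)
    · exact measurable_path_eval.comp (measurable_snd.prodMk (measurable_fst.comp measurable_fst))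
    · exact measurable_path_eval.comp (measurable_snd.prodMk (measurable_snd.comp measurable_fst))
  have := h.integral_prod_right (ν := P)
  simp_rw [hP.integral_mul] at this
  exact this.measurable

end IsCenteredGP

/-! ### Gaussian noise: independence of coordinates and translation -/

lemma gaussianReal_eq_withDensity (c : ℝ) {v : ℝ≥0} (hv : v ≠ 0) :
    gaussianReal c v =
      (gaussianReal 0 v).withDensity fun z => ENNReal.ofReal (Real.exp ((c * z - c ^ 2 / 2) / v)) := by
  have hv' : (v : ℝ) ≠ 0 := by exact_mod_cast hv
  rw [gaussianReal_of_var_ne_zero _ hv, gaussianReal_of_var_ne_zero _ hv,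
    ← withDensity_mul _ (measurable_gaussianPDF _ _) (by fun_prop)]
  congr 1
  ext z
  simp only [gaussianPDF, gaussianPDFReal, Pi.mul_apply]
  rw [← ENNReal.ofReal_mul (by positivity), mul_assoc _ (Real.exp _), ← Real.exp_add]
  congr 3
  field_simp
  ring

/-- Reweighting finitely many coordinates of an infinite product measure by densities. -/
lemma infinitePi_withDensity_prod {ι : Type*} {E : ι → Type*} [∀ i, MeasurableSpace (E i)]
    (μ : ∀ i, Measure (E i)) [∀ i, IsProbabilityMeasure (μ i)] (J : Finset ι)
    (f : ∀ i, E i → ℝ≥0∞) (hf : ∀ i, Measurable (f i)) (ν : ∀ i, Measure (E i))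
    [∀ i, IsProbabilityMeasure (ν i)] (hJ : ∀ i ∈ J, ν i = (μ i).withDensity (f i))
    (hJ' : ∀ i ∉ J, ν i = μ i) :
    (Measure.infinitePi μ).withDensity (fun η => ∏ i ∈ J, f i (η i)) = Measure.infinitePi ν := by
  classical
  refine Measure.eq_infinitePi _ fun s t ht => ?_
  have hm : MeasurableSet (Set.pi (s : Set ι) t) :=
    MeasurableSet.pi s.countable_toSet fun i _ => ht i
  let g : ∀ i, E i → ℝ≥0∞ := fun i =>
    (if i ∈ J then f i else 1) * (if i ∈ s then (t i).indicator 1 else 1)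
  have hg : ∀ i, Measurable (g i) := by
    intro i
    refine Measurable.mul ?_ ?_
    · split_ifs
      exacts [hf i, measurable_one]
    · split_ifs
      exacts [measurable_one.indicator (ht i), measurable_one]
  have hind : iIndepFun (fun i (η : ∀ i, E i) => g i (η i)) (Measure.infinitePi μ) :=
    iIndepFun_infinitePi hg
  rw [withDensity_apply _ hm, ← lintegral_indicator hm]
  have e1 : ∀ η : ∀ i, E i, (Set.pi (s : Set ι) t).indicator (fun η => ∏ i ∈ J, f i (η i)) η
      = ∏ i ∈ J ∪ s, g i (η i) := by
    intro η
    have h1 : ∏ i ∈ J ∪ s, (if i ∈ J then f i else 1) (η i) = ∏ i ∈ J, f i (η i) := by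
      rw [← Finset.prod_subset (Finset.subset_union_left (s₁ := J) (s₂ := s))]
      · exact Finset.prod_congr rfl fun i hi => by rw [if_pos hi]
      · intro i _ hi
        rw [if_neg hi]
        rfl
    have h2 : ∏ i ∈ J ∪ s, (if i ∈ s then (t i).indicator (1 : E i → ℝ≥0∞) else 1) (η i)
        = ∏ i ∈ s, (t i).indicator 1 (η i) := by
      rw [← Finset.prod_subset (Finset.subset_union_right (s₁ := J) (s₂ := s))]
      · exact Finset.prod_congr rfl fun i hi => by rw [if_pos hi]
      · intro i _ hi
        rw [if_neg hi]
        rfl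
    simp only [g, Pi.mul_apply, Finset.prod_mul_distrib, h1, h2]
    by_cases hη : η ∈ Set.pi (s : Set ι) t
    · rw [Set.indicator_of_mem hη, Finset.prod_congr rfl fun i hi =>
        Set.indicator_of_mem (hη i (Finset.mem_coe.2 hi)) 1]
      simp
    · rw [Set.indicator_of_notMem hη]
      obtain ⟨i, hi, hit⟩ : ∃ i ∈ s, η i ∉ t i := by
        simpa [Set.mem_pi] using hη
      rw [Finset.prod_eq_zero hi (Set.indicator_of_notMem hit _), mul_zero]
  rw [lintegral_congr e1, lintegral_prod_eq_prod_lintegral_of_indepFun _ _ hind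
    fun i => (hg i).comp (measurable_pi_apply i)]
  have e2 : ∀ i, ∫⁻ η : ∀ i, E i, g i (η i) ∂(Measure.infinitePi μ)
      = if i ∈ s then ν i (t i) else 1 := by
    intro i
    rw [← lintegral_map (hg i) (measurable_pi_apply i),
      (measurePreserving_eval_infinitePi μ i).map_eq]
    have h3 : ∫⁻ z, g i z ∂(μ i)
        = ∫⁻ z, (if i ∈ s then (t i).indicator (1 : E i → ℝ≥0∞) else 1) z ∂(ν i) := by
      have hmeas : Measurable (if i ∈ s then (t i).indicator (1 : E i → ℝ≥0∞) else 1) := by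
        split_ifs
        exacts [measurable_one.indicator (ht i), measurable_one]
      by_cases hi : i ∈ J
      · rw [hJ i hi, lintegral_withDensity_eq_lintegral_mul _ (hf i) hmeas]
        simp only [g, if_pos hi]
      · rw [hJ' i hi]
        simp only [g, if_neg hi, one_mul]
    rw [h3]
    split_ifs with hi
    · rw [lintegral_indicator_one (ht i)]
    · simp
  rw [Finset.prod_congr rfl fun i _ => e2 i,
    ← Finset.prod_subset (Finset.subset_union_right (s₁ := J) (s₂ := s))]
  · exact Finset.prod_congr rfl fun i hi => by rw [if_pos hi]
  · intro i _ hi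
    rw [if_neg hi]

instance (σ : ℝ≥0) : IsProbabilityMeasure (noiseLaw σ) := by
  unfold noiseLaw
  infer_instance

/-- Translating finitely many coordinates of the noise amounts to reweighting it. -/
lemma lintegral_noiseLaw_translate {σ : ℝ≥0} (hσ : 0 < σ) (J : Finset ℕ) (c : ℕ → ℝ)
    {Φ : (ℕ → ℝ) → ℝ≥0∞} (hΦ : Measurable Φ) :
    ∫⁻ η, Φ (fun i => if i ∈ J then c i + η i else η i) ∂(noiseLaw σ)
      = ∫⁻ η, ENNReal.ofReal (Real.exp (∑ i ∈ J, (c i * η i - c i ^ 2 / 2) / (σ : ℝ) ^ 2)) * Φ η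
          ∂(noiseLaw σ) := by
  have hv : σ ^ 2 ≠ 0 := by positivity
  have hmeas : ∀ i, Measurable fun z : ℝ => if i ∈ J then c i + z else z := by
    intro i
    split_ifs <;> fun_prop
  have h1 : (noiseLaw σ).map (fun η i => if i ∈ J then c i + η i else η i)
      = Measure.infinitePi fun i => gaussianReal (if i ∈ J then c i else 0) (σ ^ 2) := by
    unfold noiseLaw
    rw [Measure.infinitePi_map_pi (f := fun i (z : ℝ) => if i ∈ J then c i + z else z) _ hmeas]
    congr 1
    ext1 i
    split_ifs
    · rw [gaussianReal_map_const_add, zero_add]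
    · exact Measure.map_id
  have h2 := infinitePi_withDensity_prod (fun _ : ℕ => gaussianReal 0 (σ ^ 2)) J
    (fun i z => ENNReal.ofReal (Real.exp ((c i * z - c i ^ 2 / 2) / (σ ^ 2 : ℝ≥0))))
    (fun i => by fun_prop) (fun i => gaussianReal (if i ∈ J then c i else 0) (σ ^ 2))
    (fun i hi => by rw [if_pos hi]; exact gaussianReal_eq_withDensity _ hv)
    (fun i hi => by rw [if_neg hi])
  have hm : Measurable fun (η : ℕ → ℝ) i => if i ∈ J then c i + η i else η i :=
    measurable_pi_lambda _ fun i => (hmeas i).comp (measurable_pi_apply i)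
  rw [← lintegral_map hΦ hm, h1, ← h2, lintegral_withDensity_eq_lintegral_mul _ _ hΦ]
  · simp only [Pi.mul_apply]
    congr with η
    rw [Real.exp_sum, ENNReal.ofReal_prod_of_nonneg fun i _ => (Real.exp_pos _).le]
    simp only [NNReal.coe_pow]
  · fun_prop

/-- Erase the coordinates with index in `N`. -/
def eraseOn (N : Finset ℕ) (z : ℕ → ℝ) : ℕ → ℝ := fun i => if i ∈ N then 0 else z i

/-- Keep only the coordinates with index in `N`. -/
def keepOn (N : Finset ℕ) (z : ℕ → ℝ) : ℕ → ℝ := fun i => if i ∈ N then z i else 0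

lemma measurable_ite_mem {α β : Type*} [MeasurableSpace α] [MeasurableSpace β] {N : α → Finset ℕ}
    (hN : Measurable N) (i : ℕ) {f g : α → β} (hf : Measurable f) (hg : Measurable g) :
    Measurable fun a => if i ∈ N a then f a else g a :=
  Measurable.ite (hN (measurableSet_mem_finset i)) hf hg

lemma measurable_eraseOn : Measurable fun p : Finset ℕ × (ℕ → ℝ) => eraseOn p.1 p.2 :=
  measurable_pi_lambda _ fun i => measurable_ite_mem measurable_fst i measurable_const
    ((measurable_pi_apply i).comp measurable_snd)

lemma measurable_keepOn : Measurable fun p : Finset ℕ × (ℕ → ℝ) => keepOn p.1 p.2 :=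
  measurable_pi_lambda _ fun i => measurable_ite_mem measurable_fst i
    ((measurable_pi_apply i).comp measurable_snd) measurable_const

lemma measurable_eraseOn_right (N : Finset ℕ) : Measurable (eraseOn N) :=
  measurable_eraseOn.comp (measurable_const.prodMk measurable_id)

lemma measurable_keepOn_right (N : Finset ℕ) : Measurable (keepOn N) :=
  measurable_keepOn.comp (measurable_const.prodMk measurable_id)

lemma indepFun_keepOn_eraseOn (σ : ℝ≥0) (N : Finset ℕ) :
    IndepFun (keepOn N) (eraseOn N) (noiseLaw σ) := by
  have hind : iIndepFun (fun (i : ℕ) (η : ℕ → ℝ) => η i) (noiseLaw σ) :=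
    iIndepFun_infinitePi (X := fun _ z => z) fun _ => measurable_id
  have h := indep_iSup_of_disjoint (fun i => (measurable_pi_apply i).comap_le)
    ((iIndepFun_iff_iIndep _ _ _).1 hind) (S := (N : Set ℕ)) (T := (N : Set ℕ)ᶜ)
    disjoint_compl_right
  refine indep_of_indep_of_le h ?_ ?_ <;>
    simp only [MeasurableSpace.pi, MeasurableSpace.comap_iSup, MeasurableSpace.comap_comp] <;>
    refine iSup_le fun i => ?_ <;> by_cases hi : i ∈ N
  · have e : ((fun z : ℕ → ℝ => z i) ∘ keepOn N) = fun z => z i := by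
      ext z
      simp [keepOn, hi]
    rw [e]
    exact le_biSup (fun i => MeasurableSpace.comap (fun z : ℕ → ℝ => z i) _) (Finset.mem_coe.2 hi)
  · have e : ((fun z : ℕ → ℝ => z i) ∘ keepOn N) = fun _ => 0 := by
      ext z
      simp [keepOn, hi]
    rw [e, MeasurableSpace.comap_const]
    exact bot_le
  · have e : ((fun z : ℕ → ℝ => z i) ∘ eraseOn N) = fun _ => 0 := by
      ext z
      simp [eraseOn, hi]
    rw [e, MeasurableSpace.comap_const]
    exact bot_le
  · have e : ((fun z : ℕ → ℝ => z i) ∘ eraseOn N) = fun z => z i := by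
      ext z
      simp [eraseOn, hi]
    have hi' : i ∈ (N : Set ℕ)ᶜ := by simpa using hi
    rw [e]
    exact le_biSup (fun i => MeasurableSpace.comap (fun z : ℕ → ℝ => z i) _) hi'

/-- The kept and the erased part of the noise may be drawn independently. -/
lemma lintegral_noiseLaw_split (σ : ℝ≥0) (N : Finset ℕ) {K : (ℕ → ℝ) × (ℕ → ℝ) → ℝ≥0∞}
    (hK : Measurable K) :
    ∫⁻ η, K (keepOn N η, eraseOn N η) ∂(noiseLaw σ)
      = ∫⁻ η, ∫⁻ η', K (keepOn N η, eraseOn N η') ∂(noiseLaw σ) ∂(noiseLaw σ) := by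
  have hk := measurable_keepOn_right N
  have he := measurable_eraseOn_right N
  have h := (indepFun_iff_map_prod_eq_prod_map_map hk.aemeasurable he.aemeasurable).1
    (indepFun_keepOn_eraseOn σ N)
  have : IsProbabilityMeasure ((noiseLaw σ).map (eraseOn N)) :=
    Measure.isProbabilityMeasure_map he.aemeasurable
  rw [← lintegral_map hK (hk.prodMk he), h, lintegral_prod _ hK.aemeasurable,
    lintegral_map hK.lintegral_prod_right' hk]
  congr with η
  exact lintegral_map (hK.comp measurable_prodMk_left) he

/-! ### Posterior laws and Bayes' formula -/

lemma measurable_tilted {α β : Type*} [MeasurableSpace α] [MeasurableSpace β] (μ : Measure β)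
    [SFinite μ] {f : α → β → ℝ} (hf : Measurable (Function.uncurry f)) :
    Measurable fun a => μ.tilted (f a) := by
  refine Measure.measurable_of_measurable_coe _ fun s hs => ?_
  simp_rw [tilted_apply _ _ s]
  have h1 : Measurable fun a => ∫ b, Real.exp (f a b) ∂μ :=
    (StronglyMeasurable.integral_prod_right (f := fun a b => Real.exp (f a b))
      (Measurable.stronglyMeasurable (Real.measurable_exp.comp hf))).measurable
  refine Measurable.lintegral_prod_right'
    (f := fun p : α × β => ENNReal.ofReal (Real.exp (f p.1 p.2) / ∫ b, Real.exp (f p.1 b) ∂μ)) ?_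
  exact ((Real.measurable_exp.comp hf).div (h1.comp measurable_fst)).ennreal_ofReal

lemma tilted_add_const {β : Type*} [MeasurableSpace β] {μ : Measure β} [IsProbabilityMeasure μ]
    {f : β → ℝ} (hf : Integrable (fun b => Real.exp (f b)) μ) (c : ℝ) :
    μ.tilted (fun b => f b + c) = μ.tilted f := by
  have := isProbabilityMeasure_tilted hf
  have h := tilted_tilted hf (fun _ => c)
  rw [tilted_const] at h
  exact h.symm

/-- Integrating a function against an unnormalised density gives the normalising constant times its
expectation under the tilted law. -/
lemma lintegral_exp_mul_eq {β : Type*} [MeasurableSpace β] {μ : Measure β} [NeZero μ]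
    {g : β → ℝ} (hg : Integrable (fun b => Real.exp (g b)) μ) {H : β → ℝ≥0∞} (hgm : Measurable g)
    (hH : Measurable H) :
    ∫⁻ b, ENNReal.ofReal (Real.exp (g b)) * H b ∂μ
      = (∫⁻ b, ENNReal.ofReal (Real.exp (g b)) ∂μ) * ∫⁻ b, H b ∂(μ.tilted g) := by
  rw [lintegral_tilted]
  have hpos : 0 < ∫ b, Real.exp (g b) ∂μ := integral_exp_pos hg
  rw [← ofReal_integral_eq_lintegral_ofReal hg (ae_of_all _ fun b => (Real.exp_pos _).le),
    ← lintegral_const_mul _ (by fun_prop)]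
  congr with b
  rw [← mul_assoc, ← ENNReal.ofReal_mul hpos.le]
  congr 2
  field_simp

lemma measurable_lintegral_of_measurable {α β : Type*} [MeasurableSpace α] [MeasurableSpace β]
    {κ : α → Measure β} (hκ : Measurable κ) [∀ a, IsProbabilityMeasure (κ a)]
    {f : α × β → ℝ≥0∞} (hf : Measurable f) : Measurable fun a => ∫⁻ b, f (a, b) ∂(κ a) :=
  let K : Kernel α β := ⟨κ, hκ⟩
  have : IsMarkovKernel K := ⟨fun a => inferInstanceAs (IsProbabilityMeasure (κ a))⟩
  hf.lintegral_kernel_prod_right' (κ := K)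

section Posterior

variable {X : Type*} [MetricSpace X] [CompactSpace X] {P : Measure C(X, ℝ)}
  [IsProbabilityMeasure P] {σ : ℝ≥0}

lemma integrable_exp_of_le {β : Type*} [MeasurableSpace β] {μ : Measure β} [IsFiniteMeasure μ]
    {g : β → ℝ} (hgm : Measurable g) (C : ℝ) (hg : ∀ b, g b ≤ C) :
    Integrable (fun b => Real.exp (g b)) μ := by
  refine Integrable.mono' (integrable_const (Real.exp C)) (by fun_prop) (ae_of_all _ fun b => ?_)
  rw [Real.norm_eq_abs, abs_of_pos (Real.exp_pos _)]
  exact Real.exp_le_exp.2 (hg b)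

lemma measurable_logLikelihood {ι : Type*} [Fintype ι] (D : ι → X × ℝ) :
    Measurable fun φ : C(X, ℝ) => -(∑ i, ((D i).2 - φ (D i).1) ^ 2) / (2 * (σ : ℝ) ^ 2) :=
  (Finset.measurable_sum _ fun _ _ =>
    (measurable_const.sub (measurable_path_apply _)).pow_const 2).neg.div_const _

lemma logLikelihood_nonpos {ι : Type*} [Fintype ι] (D : ι → X × ℝ) (φ : C(X, ℝ)) :
    -(∑ i, ((D i).2 - φ (D i).1) ^ 2) / (2 * (σ : ℝ) ^ 2) ≤ 0 := by
  have : 0 ≤ ∑ i, ((D i).2 - φ (D i).1) ^ 2 := Finset.sum_nonneg fun i _ => sq_nonneg _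
  exact div_nonpos_of_nonpos_of_nonneg (by linarith) (by positivity)

lemma integrable_likelihood {ι : Type*} [Fintype ι] (D : ι → X × ℝ) :
    Integrable (fun φ : C(X, ℝ) =>
      Real.exp (-(∑ i, ((D i).2 - φ (D i).1) ^ 2) / (2 * (σ : ℝ) ^ 2))) P :=
  integrable_exp_of_le (measurable_logLikelihood D) 0 (logLikelihood_nonpos D)

instance isProbabilityMeasure_gpPosterior {ι : Type*} [Fintype ι] (D : ι → X × ℝ) :
    IsProbabilityMeasure (gpPosterior P σ D) :=
  isProbabilityMeasure_tilted (integrable_likelihood D)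

lemma integrable_gpPosterior {ι : Type*} [Fintype ι] (D : ι → X × ℝ) {h : C(X, ℝ) → ℝ}
    (hh : Integrable h P) : Integrable h (gpPosterior P σ D) := by
  unfold gpPosterior
  rw [integrable_tilted_iff]
  · refine hh.bdd_mul (c := 1)
      (Real.measurable_exp.comp (measurable_logLikelihood D)).aestronglyMeasurable
      (ae_of_all _ fun φ => ?_)
    rw [Real.norm_eq_abs, abs_of_pos (Real.exp_pos _), Real.exp_le_one_iff]
    exact logLikelihood_nonpos D φ
  · exact integrable_likelihood D

/-- The posterior law given the observations `y i` at the points `x i` for the indices `i ∈ N`. -/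
noncomputable def posteriorOn (P : Measure C(X, ℝ)) (σ : ℝ≥0) (N : Finset ℕ) (x : ℕ → X)
    (y : ℕ → ℝ) : Measure C(X, ℝ) :=
  gpPosterior P σ fun i : N => (x i, y i)

instance (N : Finset ℕ) (x : ℕ → X) (y : ℕ → ℝ) : IsProbabilityMeasure (posteriorOn P σ N x y) :=
  isProbabilityMeasure_gpPosterior _

lemma posteriorOn_eq_tilted (N : Finset ℕ) (x : ℕ → X) (y : ℕ → ℝ) :
    posteriorOn P σ N x y
      = P.tilted fun φ => -(∑ i ∈ N, (y i - φ (x i)) ^ 2) / (2 * (σ : ℝ) ^ 2) := by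
  unfold posteriorOn gpPosterior
  congr 1
  ext φ
  rw [← Finset.sum_coe_sort N]

lemma posteriorOn_empty (x : ℕ → X) (y : ℕ → ℝ) : posteriorOn P σ ∅ x y = P := by
  rw [posteriorOn_eq_tilted]
  simp

lemma posteriorOn_range (n : ℕ) (x : ℕ → X) (y : ℕ → ℝ) :
    posteriorOn P σ (Finset.range n) x y = gpPosterior P σ fun i : Fin n => (x i, y i) := by
  rw [posteriorOn_eq_tilted, gpPosterior]
  congr 1
  ext φ
  rw [Finset.sum_range]

variable [MeasurableSpace X] [BorelSpace X]

lemma measurable_gpPosterior {ι : Type*} [Fintype ι] :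
    Measurable fun D : ι → X × ℝ => gpPosterior P σ D := by
  refine measurable_tilted P ?_
  have h : ∀ i, Measurable fun p : (ι → X × ℝ) × C(X, ℝ) => p.2 (p.1 i).1 := fun i =>
    measurable_path_eval.comp (f := fun p : (ι → X × ℝ) × C(X, ℝ) => (p.2, (p.1 i).1))
      (by fun_prop)
  exact (Finset.measurable_sum _ fun i _ => Measurable.pow_const (Measurable.sub
    (f := fun p : (ι → X × ℝ) × C(X, ℝ) => (p.1 i).2) (by fun_prop) (h i)) 2).neg.div_const _

lemma measurable_posteriorOn :
    Measurable fun q : Finset ℕ × ((ℕ → X) × (ℕ → ℝ)) => posteriorOn P σ q.1 q.2.1 q.2.2 := by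
  refine measurable_from_prod_countable_right fun N => ?_
  exact (measurable_gpPosterior (P := P) (σ := σ)).comp
    (g := fun D : N → X × ℝ => gpPosterior P σ D)
    (f := fun q : (ℕ → X) × (ℕ → ℝ) => fun i : N => (q.1 i, q.2 i)) (by fun_prop)

/-- The observations after the indices in `J` have been revealed: the values at `J` are noisy values
of the path `φ`, the others are those of `y`. -/
def reveal (J : Finset ℕ) (x : ℕ → X) (y : ℕ → ℝ) (φ : C(X, ℝ)) (η : ℕ → ℝ) : ℕ → ℝ :=
  fun i => if i ∈ J then φ (x i) + η i else y i

lemma measurable_reveal :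
    Measurable fun q : (Finset ℕ × ((ℕ → X) × (ℕ → ℝ))) × (C(X, ℝ) × (ℕ → ℝ)) =>
      reveal q.1.1 q.1.2.1 q.1.2.2 q.2.1 q.2.2 := by
  refine measurable_pi_lambda _ fun i => measurable_ite_mem (by fun_prop) i ?_ (by fun_prop)
  refine Measurable.add (measurable_path_eval.comp (f := fun q :
    (Finset ℕ × ((ℕ → X) × (ℕ → ℝ))) × (C(X, ℝ) × (ℕ → ℝ)) => (q.2.1, q.1.2.1 i)) ?_) ?_
  · fun_prop
  · fun_prop

/-- The logarithm of the density of the noisy values of `φ` at the indices in `J` with respect to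
the noise law. -/
noncomputable def logDensityRatio (σ : ℝ≥0) (J : Finset ℕ) (x : ℕ → X) (φ : C(X, ℝ))
    (η : ℕ → ℝ) : ℝ :=
  ∑ i ∈ J, (φ (x i) * η i - φ (x i) ^ 2 / 2) / (σ : ℝ) ^ 2

lemma measurable_logDensityRatio (J : Finset ℕ) (x : ℕ → X) :
    Measurable fun p : C(X, ℝ) × (ℕ → ℝ) => logDensityRatio σ J x p.1 p.2 := by
  have h : ∀ i, Measurable fun p : C(X, ℝ) × (ℕ → ℝ) => p.1 (x i) := fun i =>
    (measurable_path_apply (x i)).comp measurable_fst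
  unfold logDensityRatio
  fun_prop

lemma integrable_exp_logDensityRatio (J : Finset ℕ) (x : ℕ → X) (η : ℕ → ℝ)
    (Q : Measure C(X, ℝ)) [IsFiniteMeasure Q] :
    Integrable (fun φ => Real.exp (logDensityRatio σ J x φ η)) Q := by
  refine integrable_exp_of_le ((measurable_logDensityRatio J x).comp measurable_prodMk_right)
    (∑ i ∈ J, η i ^ 2 / 2 / (σ : ℝ) ^ 2) fun φ => Finset.sum_le_sum fun i _ => ?_
  -- `φ η - φ² / 2 ≤ η² / 2`, uniformly in the path
  gcongr
  nlinarith [sq_nonneg (φ (x i) - η i)]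

/-- Updating the posterior given the observations in `N` by the density of values `η` at the
remaining indices of `N'` gives the posterior given the observations in `N'`. -/
lemma posteriorOn_tilted {N N' : Finset ℕ} (hN : N ⊆ N') (x : ℕ → X) (y η : ℕ → ℝ) :
    (posteriorOn P σ N x y).tilted (fun φ => logDensityRatio σ (N' \ N) x φ η)
      = posteriorOn P σ N' x (fun i => if i ∈ N' \ N then η i else y i) := by
  have hint : ∀ (M : Finset ℕ) (z : ℕ → ℝ), Integrable (fun φ : C(X, ℝ) =>
      Real.exp (-(∑ i ∈ M, (z i - φ (x i)) ^ 2) / (2 * (σ : ℝ) ^ 2))) P := by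
    intro M z
    have := integrable_likelihood (P := P) (σ := σ) (fun i : M => (x i, z i))
    simp only at this
    convert this using 5 with φ
    rw [← Finset.sum_coe_sort M]
  rw [posteriorOn_eq_tilted, posteriorOn_eq_tilted, tilted_tilted (hint N y),
    ← tilted_add_const (hint N' _) (∑ i ∈ N' \ N, η i ^ 2 / (2 * (σ : ℝ) ^ 2))]
  congr 1
  ext φ
  have h1 : ∑ i ∈ N', ((if i ∈ N' \ N then η i else y i) - φ (x i)) ^ 2
      = ∑ i ∈ N' \ N, (η i - φ (x i)) ^ 2 + ∑ i ∈ N, (y i - φ (x i)) ^ 2 := by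
    rw [← Finset.sum_sdiff hN]
    congr 1
    · exact Finset.sum_congr rfl fun i hi => by rw [if_pos hi]
    · exact Finset.sum_congr rfl fun i hi => by
        rw [if_neg fun h => (Finset.mem_sdiff.1 h).2 hi]
  rw [h1]
  simp only [Pi.add_apply, logDensityRatio, neg_add, add_div, neg_div, Finset.sum_div]
  have h2 : ∑ i ∈ N' \ N, (φ (x i) * η i - φ (x i) ^ 2 / 2) / (σ : ℝ) ^ 2
      = -∑ i ∈ N' \ N, (η i - φ (x i)) ^ 2 / (2 * (σ : ℝ) ^ 2)
        + ∑ i ∈ N' \ N, η i ^ 2 / (2 * (σ : ℝ) ^ 2) := by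
    rw [← Finset.sum_neg_distrib, ← Finset.sum_add_distrib]
    refine Finset.sum_congr rfl fun i _ => ?_
    by_cases hs : (σ : ℝ) = 0
    · simp [hs]
    · field_simp
      ring
  rw [h2]
  ring

/-- Integrals over noisy values of a path are integrals over pure noise, weighted by the density
ratio. -/
lemma lintegral_reveal (hσ : 0 < σ) (J : Finset ℕ) (x : ℕ → X) (y : ℕ → ℝ) (φ : C(X, ℝ))
    {H : (ℕ → ℝ) → ℝ≥0∞} (hH : Measurable H) :
    ∫⁻ η, H (reveal J x y φ η) ∂(noiseLaw σ)
      = ∫⁻ η, ENNReal.ofReal (Real.exp (logDensityRatio σ J x φ η)) *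
          H (fun i => if i ∈ J then η i else y i) ∂(noiseLaw σ) := by
  have hm : Measurable fun (η : ℕ → ℝ) i => if i ∈ J then η i else y i :=
    measurable_pi_lambda _ fun i => measurable_ite_mem measurable_const i (by fun_prop) (by fun_prop)
  refine Eq.trans (lintegral_congr fun η => ?_)
    (lintegral_noiseLaw_translate hσ J (fun i => φ (x i)) (hH.comp hm))
  congr 1
  ext i
  simp only [reveal]
  split_ifs <;> rfl

/-- Bayes' formula: if the path is a draw from the posterior given the observations in `N` and the
noisy values with indices in `N' \ N` are revealed, then the path and the noise of the remaining
indices may be redrawn from the posterior given the observations in `N'`. -/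
theorem lintegral_bayes (hσ : 0 < σ) {N N' : Finset ℕ} (hN : N ⊆ N') (x : ℕ → X) (y : ℕ → ℝ)
    {G : (ℕ → ℝ) × (C(X, ℝ) × (ℕ → ℝ)) → ℝ≥0∞} (hG : Measurable G) :
    ∫⁻ φ, ∫⁻ η, G (reveal (N' \ N) x y φ η, (φ, eraseOn N' η)) ∂(noiseLaw σ)
        ∂(posteriorOn P σ N x y)
      = ∫⁻ φ, ∫⁻ η, ∫⁻ φ', ∫⁻ η', G (reveal (N' \ N) x y φ η, (φ', eraseOn N' η')) ∂(noiseLaw σ)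
          ∂(posteriorOn P σ N' x (reveal (N' \ N) x y φ η)) ∂(noiseLaw σ)
          ∂(posteriorOn P σ N x y) := by
  set J := N' \ N with hJ
  set Q := posteriorOn P σ N x y with hQ
  let fill : (ℕ → ℝ) → ℕ → ℝ := fun η i => if i ∈ J then η i else y i
  have hfill : Measurable fill :=
    measurable_pi_lambda _ fun i => measurable_ite_mem measurable_const i (by fun_prop) (by fun_prop)
  let Gt : (ℕ → ℝ) × C(X, ℝ) → ℝ≥0∞ := fun p =>
    ∫⁻ η', G (p.1, (p.2, eraseOn N' η')) ∂(noiseLaw σ)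
  have hGt : Measurable Gt := by
    have hmap : Measurable fun q : ((ℕ → ℝ) × C(X, ℝ)) × (ℕ → ℝ) =>
        (q.1.1, (q.1.2, eraseOn N' q.2)) :=
      (measurable_fst.comp measurable_fst).prodMk
        ((measurable_snd.comp measurable_fst).prodMk
          ((measurable_eraseOn_right N').comp measurable_snd))
    exact (hG.comp hmap).lintegral_prod_right'
  let Rt : (ℕ → ℝ) → ℝ≥0∞ := fun z => ∫⁻ φ', Gt (z, φ') ∂(posteriorOn P σ N' x z)
  have hRt : Measurable Rt := by
    have hκ : Measurable fun z => posteriorOn P σ N' x z :=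
      (measurable_gpPosterior (P := P) (σ := σ)).comp
        (f := fun (z : ℕ → ℝ) (i : N') => (x i, z i)) (by fun_prop)
    exact measurable_lintegral_of_measurable hκ hGt
  have hratio : Measurable fun p : C(X, ℝ) × (ℕ → ℝ) =>
      ENNReal.ofReal (Real.exp (logDensityRatio σ J x p.1 p.2)) := by
    have := measurable_logDensityRatio (σ := σ) J x
    fun_prop
  have hrev : ∀ φ, Measurable fun η => reveal J x y φ η := fun φ =>
    measurable_reveal.comp (f := fun η => ((J, (x, y)), (φ, η))) (by fun_prop)
  have e1 : ∀ φ, ∫⁻ η, G (reveal J x y φ η, (φ, eraseOn N' η)) ∂(noiseLaw σ)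
      = ∫⁻ η, ENNReal.ofReal (Real.exp (logDensityRatio σ J x φ η)) * Gt (fill η, φ)
          ∂(noiseLaw σ) := by
    intro φ
    have hkeep : ∀ η, reveal J x y φ (keepOn N' η) = reveal J x y φ η := by
      intro η
      ext i
      simp only [reveal, keepOn]
      split_ifs with h1 h2
      · rfl
      · exact absurd (Finset.mem_sdiff.1 (hJ ▸ h1)).1 h2
      · rfl
    have h := lintegral_noiseLaw_split σ N'
      (K := fun p : (ℕ → ℝ) × (ℕ → ℝ) => G (reveal J x y φ p.1, (φ, p.2)))
      (hG.comp (((hrev φ).comp measurable_fst).prodMk (measurable_const.prodMk measurable_snd)))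
    simp only [hkeep] at h
    rw [h]
    exact lintegral_reveal hσ J x y φ (H := fun z => Gt (z, φ))
      (hGt.comp measurable_prodMk_right)
  have e2 : ∀ φ, ∫⁻ η, Rt (reveal J x y φ η) ∂(noiseLaw σ)
      = ∫⁻ η, ENNReal.ofReal (Real.exp (logDensityRatio σ J x φ η)) * Rt (fill η)
          ∂(noiseLaw σ) := fun φ => lintegral_reveal hσ J x y φ hRt
  change ∫⁻ φ, ∫⁻ η, G (reveal J x y φ η, (φ, eraseOn N' η)) ∂(noiseLaw σ) ∂Q
    = ∫⁻ φ, ∫⁻ η, Rt (reveal J x y φ η) ∂(noiseLaw σ) ∂Q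
  rw [lintegral_congr e1, lintegral_congr e2]
  refine (lintegral_lintegral_swap ?_).trans (Eq.trans ?_ (lintegral_lintegral_swap ?_).symm)
  · exact (hratio.mul (hGt.comp ((hfill.comp measurable_snd).prodMk measurable_fst))).aemeasurable
  · refine lintegral_congr fun η => ?_
    have hg : Measurable fun φ => logDensityRatio σ J x φ η :=
      (measurable_logDensityRatio J x).comp (f := fun φ => (φ, η)) (by fun_prop)
    have hr : Measurable fun φ => ENNReal.ofReal (Real.exp (logDensityRatio σ J x φ η)) :=
      hg.exp.ennreal_ofReal
    have hH : Measurable fun φ => Gt (fill η, φ) := hGt.comp measurable_prodMk_left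
    have hR : Rt (fill η) = ∫⁻ φ, Gt (fill η, φ) ∂(Q.tilted fun φ => logDensityRatio σ J x φ η) :=
      by rw [posteriorOn_tilted hN x y η]
    rw [lintegral_mul_const _ hr, hR]
    exact lintegral_exp_mul_eq (integrable_exp_logDensityRatio J x η Q) hg hH
  · exact (hratio.mul (hRt.comp (hfill.comp measurable_snd))).aemeasurable

end Posterior

/-! ### Densities of Gaussian vectors -/

section GaussianVectors

variable {ι : Type*} [Fintype ι]

/-- A product of measures with densities has the product density. -/
lemma pi_withDensity_prod {E : ι → Type*} [∀ i, MeasurableSpace (E i)]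
    (μ : ∀ i, Measure (E i)) [∀ i, IsProbabilityMeasure (μ i)]
    (f : ∀ i, E i → ℝ≥0∞) (hf : ∀ i, Measurable (f i)) (ν : ∀ i, Measure (E i))
    [∀ i, SigmaFinite (ν i)] (hν : ∀ i, ν i = (μ i).withDensity (f i)) :
    (Measure.pi μ).withDensity (fun η => ∏ i, f i (η i)) = Measure.pi ν := by
  classical
  refine (Measure.pi_eq fun s hs => ?_).symm
  have hm : MeasurableSet (Set.univ.pi s) := MeasurableSet.univ_pi hs
  have hg : ∀ i, Measurable ((s i).indicator (f i)) := fun i => (hf i).indicator (hs i)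
  have hind : iIndepFun (fun i (η : ∀ i, E i) => (s i).indicator (f i) (η i)) (Measure.pi μ) :=
    iIndepFun_pi fun i => (hg i).aemeasurable
  rw [withDensity_apply _ hm, ← lintegral_indicator hm]
  have e1 : ∀ η : ∀ i, E i, (Set.univ.pi s).indicator (fun η => ∏ i, f i (η i)) η
      = ∏ i, (s i).indicator (f i) (η i) := by
    intro η
    by_cases hη : η ∈ Set.univ.pi s
    · rw [Set.indicator_of_mem hη]
      exact Finset.prod_congr rfl fun i _ => (Set.indicator_of_mem (hη i trivial) _).symm
    · rw [Set.indicator_of_notMem hη]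
      obtain ⟨i, hi⟩ : ∃ i, η i ∉ s i := by simpa [Set.mem_pi] using hη
      rw [Finset.prod_eq_zero (Finset.mem_univ i) (Set.indicator_of_notMem hi _)]
  rw [lintegral_congr e1, lintegral_prod_eq_prod_lintegral_of_indepFun _ _ hind
    fun i => (hg i).comp (measurable_pi_apply i)]
  refine Finset.prod_congr rfl fun i _ => ?_
  rw [← lintegral_map (hg i) (measurable_pi_apply i), (measurePreserving_eval μ i).map_eq,
    lintegral_indicator (hs i), hν i, withDensity_apply _ (hs i)]

lemma map_withDensity_comp {α β : Type*} [MeasurableSpace α] [MeasurableSpace β] (μ : Measure α)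
    {g : α → β} (hg : Measurable g) {F : β → ℝ≥0∞} (hF : Measurable F) :
    (μ.withDensity fun a => F (g a)).map g = (μ.map g).withDensity F := by
  ext s hs
  rw [Measure.map_apply hg hs, withDensity_apply _ (hg hs), withDensity_apply _ hs,
    setLIntegral_map hs hF hg]

lemma pi_gaussianReal_eq_withDensity {v : ℝ≥0} (hv : v ≠ 0) :
    Measure.pi (fun _ : ι => gaussianReal 0 v)
      = volume.withDensity fun η : ι → ℝ => ENNReal.ofReal (Real.exp
          (-(∑ i, η i ^ 2) / (2 * v) - Fintype.card ι / 2 * Real.log (2 * Real.pi * v))) := by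
  have hv' : (0 : ℝ) < v := by positivity
  have hpi : 0 < 2 * Real.pi * (v : ℝ) := by positivity
  let h : ℝ → ℝ := fun z => z ^ 2 / (2 * v) + 1 / 2 * Real.log (2 * Real.pi * v)
  have hh : Measurable fun z => ENNReal.ofReal (Real.exp (h z)) := by fun_prop
  have h1 : (volume : Measure ℝ)
      = (gaussianReal 0 v).withDensity fun z => ENNReal.ofReal (Real.exp (h z)) := by
    rw [gaussianReal_of_var_ne_zero _ hv, ← withDensity_mul _ (measurable_gaussianPDF _ _) hh]
    conv_lhs => rw [← withDensity_one (μ := (volume : Measure ℝ))]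
    congr 1
    ext z
    simp only [gaussianPDF, gaussianPDFReal, Pi.mul_apply, Pi.one_apply, h]
    rw [← ENNReal.ofReal_mul (by positivity), Real.exp_add, one_div_mul_eq_div,
      ← Real.log_sqrt hpi.le, Real.exp_log (by positivity), sub_zero]
    have : (√(2 * Real.pi * v))⁻¹ * Real.exp (-z ^ 2 / (2 * v))
        * (Real.exp (z ^ 2 / (2 * v)) * √(2 * Real.pi * v)) = 1 := by
      rw [neg_div, Real.exp_neg]
      have := Real.exp_pos (z ^ 2 / (2 * v))
      field_simp
    rw [this, ENNReal.ofReal_one]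
  have h2 := pi_withDensity_prod (fun _ : ι => gaussianReal 0 v)
    (fun _ z => ENNReal.ofReal (Real.exp (h z))) (fun _ => hh) (fun _ => volume) (fun _ => h1)
  have h3 : ∀ η : ι → ℝ, ∏ i, ENNReal.ofReal (Real.exp (h (η i)))
      = ENNReal.ofReal (Real.exp (∑ i, h (η i))) := fun η => by
    rw [Real.exp_sum, ENNReal.ofReal_prod_of_nonneg fun i _ => (Real.exp_pos _).le]
  simp only [h3] at h2
  have h4 := withDensity_inv_same (μ := Measure.pi (fun _ : ι => gaussianReal 0 v))
    (f := fun η => ENNReal.ofReal (Real.exp (∑ i, h (η i)))) (by fun_prop)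
    (ae_of_all _ fun η => by simp [Real.exp_pos]) (ae_of_all _ fun η => ENNReal.ofReal_ne_top)
  rw [h2, ← volume_pi] at h4
  rw [← h4]
  congr 1
  ext η
  rw [← ENNReal.ofReal_inv_of_pos (Real.exp_pos _), ← Real.exp_neg]
  congr 2
  simp only [h, Finset.sum_add_distrib, Finset.sum_const, Finset.card_univ, nsmul_eq_mul,
    ← Finset.sum_div]
  ring

instance isGaussian_pi_gaussianReal (v : ℝ≥0) :
    IsGaussian (Measure.pi fun _ : ι => gaussianReal 0 v) := by
  have h : iIndepFun (fun i (η : ι → ℝ) => η i) (Measure.pi fun _ : ι => gaussianReal 0 v) :=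
    iIndepFun_pi (X := fun _ z => z) fun i => aemeasurable_id
  have h2 := h.hasGaussianLaw fun i =>
    ⟨by rw [(measurePreserving_eval (fun _ : ι => gaussianReal 0 v) i).map_eq]; infer_instance⟩
  have h3 := h2.isGaussian_map
  rwa [Measure.map_id'] at h3

lemma integral_pi_gaussianReal (v : ℝ≥0) (i : ι) :
    ∫ η, η i ∂(Measure.pi fun _ : ι => gaussianReal 0 v) = 0 := by
  have h := measurePreserving_eval (fun _ : ι => gaussianReal 0 v) i
  have h2 := integral_map (μ := Measure.pi fun _ : ι => gaussianReal 0 v)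
    (measurable_pi_apply i).aemeasurable (f := fun z : ℝ => z) (by fun_prop)
  rw [← h2, h.map_eq, integral_id_gaussianReal]

lemma memLp_eval_of_isGaussian (μ : Measure (ι → ℝ)) [IsGaussian μ] (i : ι) :
    MemLp (fun y : ι → ℝ => y i) 2 μ :=
  (IsGaussian.memLp_id μ 2 (by simp)).eval i

lemma covariance_pi_gaussianReal [DecidableEq ι] (v : ℝ≥0) (i j : ι) :
    covariance (fun η : ι → ℝ => η i) (fun η => η j) (Measure.pi fun _ : ι => gaussianReal 0 v)
      = if i = j then (v : ℝ) else 0 := by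
  split_ifs with hij
  · subst hij
    have h := measurePreserving_eval (fun _ : ι => gaussianReal 0 v) i
    rw [covariance_self (measurable_pi_apply i).aemeasurable]
    have h2 := variance_map (μ := Measure.pi fun _ : ι => gaussianReal 0 v) (X := id)
      aemeasurable_id h.measurable.aemeasurable
    rw [h.map_eq, variance_id_gaussianReal] at h2
    exact h2.symm
  · have h : iIndepFun (fun i (η : ι → ℝ) => η i) (Measure.pi fun _ : ι => gaussianReal 0 v) :=
      iIndepFun_pi (X := fun _ z => z) fun i => aemeasurable_id
    exact (h.indepFun hij).covariance_eq_zero (memLp_eval_of_isGaussian _ i)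
      (memLp_eval_of_isGaussian _ j)

/-- A Gaussian measure on `ι → ℝ` is determined by the means and covariances of the coordinates. -/
lemma isGaussian_ext_of_covariance {μ ν : Measure (ι → ℝ)} [IsGaussian μ] [IsGaussian ν]
    (hm : ∀ i, ∫ y, y i ∂μ = ∫ y, y i ∂ν)
    (hc : ∀ i j, covariance (fun y : ι → ℝ => y i) (fun y => y j) μ
      = covariance (fun y : ι → ℝ => y i) (fun y => y j) ν) : μ = ν := by
  classical
  apply Measure.ext_of_charFunDual
  ext L
  rw [IsGaussian.charFunDual_eq, IsGaussian.charFunDual_eq]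
  let a : ι → ℝ := fun i => L fun j => if i = j then 1 else 0
  have hL : ∀ y : ι → ℝ, L y = ∑ i, a i * y i := fun y => by
    rw [← ContinuousLinearMap.coe_coe, LinearMap.pi_apply_eq_sum_univ]
    simp [a, mul_comm]
  have hmean : ∀ (ρ : Measure (ι → ℝ)) [IsGaussian ρ],
      ∫ y, ((L y : ℝ) : ℂ) ∂ρ = ((∑ i, a i * ∫ y, y i ∂ρ : ℝ) : ℂ) := by
    intro ρ _
    rw [integral_complex_ofReal]
    simp_rw [hL]
    rw [integral_finsetSum _ fun i _ =>
      ((memLp_eval_of_isGaussian ρ i).integrable (by simp)).const_mul _]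
    simp_rw [integral_const_mul]
  have hvar : ∀ (ρ : Measure (ι → ℝ)) [IsGaussian ρ],
      Var[L; ρ] = ∑ i, ∑ j, a i * (a j * covariance (fun y : ι → ℝ => y i) (fun y => y j) ρ) := by
    intro ρ _
    have e : (L : (ι → ℝ) → ℝ) = fun y => ∑ i, a i * y i := funext hL
    rw [e, ← covariance_self (Measurable.aemeasurable (Finset.measurable_sum _ fun i _ =>
      (measurable_pi_apply i).const_mul _)), covariance_fun_sum_fun_sum
      (fun i => (memLp_eval_of_isGaussian ρ i).const_mul _)
      (fun i => (memLp_eval_of_isGaussian ρ i).const_mul _)]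
    simp_rw [covariance_const_mul_left, covariance_const_mul_right]
  rw [hmean μ, hmean ν, hvar μ, hvar ν]
  simp_rw [hm, hc]

open Matrix in
open scoped MatrixOrder in
/-- The density of a centred Gaussian vector with positive definite covariance matrix. -/
lemma isGaussian_eq_withDensity [DecidableEq ι] (μ : Measure (ι → ℝ)) [IsGaussian μ]
    (G : Matrix ι ι ℝ) (hG : G.PosDef) (hm : ∀ i, ∫ y, y i ∂μ = 0)
    (hc : ∀ i j, covariance (fun y : ι → ℝ => y i) (fun y => y j) μ = G i j) :
    μ = volume.withDensity fun y => ENNReal.ofReal (Real.exp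
      (-(y ⬝ᵥ G⁻¹ *ᵥ y) / 2 - Real.log G.det / 2
        - Fintype.card ι / 2 * Real.log (2 * Real.pi))) := by
  obtain ⟨B, hB⟩ := CStarAlgebra.nonneg_iff_eq_star_mul_self.mp hG.posSemidef.nonneg
  -- the measure is the image of the standard Gaussian measure under a square root of `G`
  let M : Matrix ι ι ℝ := Bᵀ
  have hGM : G = M * Mᵀ := by
    rw [hB]
    simp [M, star_eq_conjTranspose]
  have hdetG : G.det = M.det ^ 2 := by
    rw [hGM, det_mul, det_transpose M, sq]
  have hdet : M.det ≠ 0 := by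
    intro h
    have := hG.det_pos
    rw [hdetG, h] at this
    simp at this
  let γ : Measure (ι → ℝ) := Measure.pi fun _ : ι => gaussianReal 0 1
  let L : (ι → ℝ) →L[ℝ] (ι → ℝ) := LinearMap.toContinuousLinearMap (toLin' M)
  have hLa : ∀ z i, L z i = ∑ j, M i j * z j := fun z i => rfl
  have hLm : Measurable L := L.continuous.measurable
  have hint : ∀ i, Integrable (fun z : ι → ℝ => z i) γ := fun i =>
    (memLp_eval_of_isGaussian γ i).integrable (by simp)
  have hμ : μ = γ.map L := by
    refine isGaussian_ext_of_covariance (fun i => ?_) fun i j => ?_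
    · rw [hm, integral_map hLm.aemeasurable (measurable_pi_apply i).aestronglyMeasurable]
      simp_rw [hLa]
      rw [integral_finsetSum _ fun j _ => (hint j).const_mul _]
      simp_rw [integral_const_mul, γ, integral_pi_gaussianReal]
      simp
    · rw [hc, covariance_map (measurable_pi_apply i).aestronglyMeasurable
        (measurable_pi_apply j).aestronglyMeasurable hLm.aemeasurable]
      simp only [Function.comp_def, hLa]
      rw [covariance_fun_sum_fun_sum (fun j => (memLp_eval_of_isGaussian γ j).const_mul _)
        (fun j => (memLp_eval_of_isGaussian γ j).const_mul _)]
      simp_rw [covariance_const_mul_left, covariance_const_mul_right, γ,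
        covariance_pi_gaussianReal]
      rw [hGM, mul_apply]
      simp [transpose_apply]
  have hinv : G⁻¹ = (M⁻¹)ᵀ * M⁻¹ := by
    rw [hGM, Matrix.mul_inv_rev, transpose_nonsing_inv]
  have hquad : ∀ z : ι → ℝ, L z ⬝ᵥ G⁻¹ *ᵥ L z = ∑ i, z i ^ 2 := by
    intro z
    have hLz : L z = M *ᵥ z := rfl
    have hM : M⁻¹ *ᵥ (M *ᵥ z) = z := by
      rw [mulVec_mulVec, nonsing_inv_mul _ (isUnit_iff_ne_zero.2 hdet), one_mulVec]
    rw [hLz, hinv, ← mulVec_mulVec, hM, dotProduct_mulVec, vecMul_transpose, hM]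
    simp [dotProduct, sq]
  let F : (ι → ℝ) → ℝ≥0∞ := fun y => ENNReal.ofReal (Real.exp
      (-(y ⬝ᵥ G⁻¹ *ᵥ y) / 2 - Fintype.card ι / 2 * Real.log (2 * Real.pi)))
  have hγ : γ = volume.withDensity fun z => F (L z) := by
    simp only [γ, F, hquad]
    rw [pi_gaussianReal_eq_withDensity one_ne_zero]
    simp
  have hqm : Measurable fun y : ι → ℝ => y ⬝ᵥ G⁻¹ *ᵥ y := by
    simp only [dotProduct, mulVec]
    fun_prop
  have hvol : volume.map L = ENNReal.ofReal |M.det⁻¹| • (volume : Measure (ι → ℝ)) :=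
    Real.map_matrix_volume_pi_eq_smul_volume_pi hdet
  have hF : Measurable F := by fun_prop
  rw [hμ, hγ, map_withDensity_comp _ hLm hF, hvol, withDensity_smul_measure,
    ← withDensity_smul _ hF]
  congr 1
  ext y
  rw [Pi.smul_apply, smul_eq_mul, ← ENNReal.ofReal_mul (abs_nonneg _)]
  congr 1
  have hc' : |M.det⁻¹| = Real.exp (-(Real.log G.det / 2)) := by
    rw [hdetG, Real.log_pow, abs_inv, ← Real.log_abs, Real.exp_neg]
    push_cast
    rw [mul_div_cancel_left₀ _ (two_ne_zero), Real.exp_log (abs_pos.2 hdet)]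
  rw [hc', ← Real.exp_add]
  congr 1
  ring

end GaussianVectors

/-! ### Noisy observations at fixed inputs -/

section Observations

open Matrix

variable {X : Type*} [MetricSpace X] [CompactSpace X] {P : Measure C(X, ℝ)}
  [IsProbabilityMeasure P] {k : X → X → ℝ} {σ : ℝ≥0} {ι : Type*} [Fintype ι] [DecidableEq ι]

/-- The covariance matrix `K + σ² I` of noisy observations at the points `p`. -/
def noisyGram (k : X → X → ℝ) (σ : ℝ≥0) (p : ι → X) : Matrix ι ι ℝ :=
  Matrix.of (fun i j => k (p i) (p j)) + (σ : ℝ) ^ 2 • (1 : Matrix ι ι ℝ)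

lemma noisyGram_apply (p : ι → X) (i j : ι) :
    noisyGram k σ p i j = k (p i) (p j) + if i = j then (σ : ℝ) ^ 2 else 0 := by
  simp [noisyGram, Matrix.one_apply]

lemma kernelMatrix_posSemidef (hP : IsCenteredGP P k) (p : ι → X) :
    (Matrix.of fun i j => k (p i) (p j)).PosSemidef := by
  refine PosSemidef.of_dotProduct_mulVec_nonneg ?_ fun a => ?_
  · ext i j
    simp [hP.cov_symm (p i) (p j)]
  · have h : star a ⬝ᵥ (Matrix.of fun i j => k (p i) (p j)) *ᵥ a
        = ∫ φ : C(X, ℝ), (∑ i, a i * φ (p i)) ^ 2 ∂P := by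
      have e : ∀ φ : C(X, ℝ), (∑ i, a i * φ (p i)) ^ 2
          = ∑ i, ∑ j, a i * a j * (φ (p i) * φ (p j)) := by
        intro φ
        rw [sq, Finset.sum_mul_sum]
        exact Finset.sum_congr rfl fun i _ => Finset.sum_congr rfl fun j _ => by ring
      have hint : ∀ i j, Integrable (fun φ : C(X, ℝ) => a i * a j * (φ (p i) * φ (p j))) P :=
        fun i j => ((hP.memLp_eval (p i)).integrable_mul (hP.memLp_eval (p j))).const_mul _
      simp_rw [e]
      rw [integral_finsetSum _ fun i _ => integrable_finsetSum _ fun j _ => hint i j]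
      simp_rw [integral_finsetSum _ fun j _ => hint _ j, integral_const_mul, hP.integral_mul]
      simp only [dotProduct, mulVec, Finset.mul_sum, star_trivial, of_apply]
      exact Finset.sum_congr rfl fun i _ => Finset.sum_congr rfl fun j _ => by ring
    rw [h]
    exact integral_nonneg fun φ => sq_nonneg _

lemma noisyGram_posDef (hP : IsCenteredGP P k) (hσ : 0 < σ) (p : ι → X) :
    (noisyGram k σ p).PosDef := by
  refine PosDef.posSemidef_add (kernelMatrix_posSemidef hP p) ?_
  exact PosDef.one.smul (by positivity)

/-- The joint law of the path and the noise of finitely many observations. -/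
noncomputable abbrev pathNoise (P : Measure C(X, ℝ)) (σ : ℝ≥0) (ι : Type*) [Fintype ι] :
    Measure (C(X, ℝ) × (ι → ℝ)) :=
  P.prod (Measure.pi fun _ : ι => gaussianReal 0 (σ ^ 2))

lemma isGaussian_pathNoise (hP : IsCenteredGP P k) : IsGaussian (pathNoise P σ ι) :=
  have := hP.isGaussian
  inferInstance

/-- The noisy values of the path at the points `p`, as a continuous linear map. -/
noncomputable def noisyValues (p : ι → X) : C(X, ℝ) × (ι → ℝ) →L[ℝ] (ι → ℝ) :=
  ContinuousLinearMap.pi fun i => (ContinuousMap.evalCLM ℝ (p i)).comp (.fst ℝ _ _)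
    + (ContinuousLinearMap.proj i).comp (.snd ℝ _ _)

lemma noisyValues_apply (p : ι → X) (ω : C(X, ℝ) × (ι → ℝ)) (i : ι) :
    noisyValues p ω i = ω.1 (p i) + ω.2 i := rfl

lemma memLp_of_isGaussian (hP : IsCenteredGP P k) (L : C(X, ℝ) × (ι → ℝ) →L[ℝ] ℝ) :
    MemLp L 2 (pathNoise P σ ι) :=
  have := isGaussian_pathNoise (σ := σ) (ι := ι) hP
  (IsGaussian.hasGaussianLaw (X := L) (P := pathNoise P σ ι)).memLp_two

lemma memLp_pathNoise_fst (hP : IsCenteredGP P k) (x : X) :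
    MemLp (fun ω : C(X, ℝ) × (ι → ℝ) => ω.1 x) 2 (pathNoise P σ ι) :=
  memLp_of_isGaussian hP ((ContinuousMap.evalCLM ℝ x).comp (.fst ℝ _ _))

lemma memLp_pathNoise_snd (hP : IsCenteredGP P k) (i : ι) :
    MemLp (fun ω : C(X, ℝ) × (ι → ℝ) => ω.2 i) 2 (pathNoise P σ ι) :=
  memLp_of_isGaussian hP ((ContinuousLinearMap.proj i).comp (.snd ℝ _ _))

lemma memLp_noisyValues (hP : IsCenteredGP P k) (p : ι → X) (i : ι) :
    MemLp (fun ω => noisyValues p ω i) 2 (pathNoise P σ ι) :=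
  memLp_of_isGaussian hP ((ContinuousLinearMap.proj i).comp (noisyValues p))

lemma map_fst_pathNoise : (pathNoise P σ ι).map Prod.fst = P :=
  (measurePreserving_fst (μ := P) (ν := Measure.pi fun _ : ι => gaussianReal 0 (σ ^ 2))).map_eq

lemma map_snd_pathNoise :
    (pathNoise P σ ι).map Prod.snd = Measure.pi fun _ : ι => gaussianReal 0 (σ ^ 2) :=
  (measurePreserving_snd (μ := P) (ν := Measure.pi fun _ : ι => gaussianReal 0 (σ ^ 2))).map_eq

lemma integral_pathNoise_fst (hP : IsCenteredGP P k) (x : X) :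
    ∫ ω, ω.1 x ∂(pathNoise P σ ι) = 0 := by
  have h := integral_map (μ := pathNoise P σ ι) measurable_fst.aemeasurable
    (f := fun φ : C(X, ℝ) => φ x) (measurable_path_apply x).aestronglyMeasurable
  rw [map_fst_pathNoise, hP.mean_eq_zero] at h
  exact h.symm

lemma integral_pathNoise_snd (i : ι) :
    ∫ ω, ω.2 i ∂(pathNoise P σ ι) = 0 := by
  have h := integral_map (μ := pathNoise P σ ι) measurable_snd.aemeasurable
    (f := fun z : ι → ℝ => z i) (measurable_pi_apply i).aestronglyMeasurable
  rw [map_snd_pathNoise, integral_pi_gaussianReal] at h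
  exact h.symm

lemma integral_noisyValues (hP : IsCenteredGP P k) (p : ι → X) (i : ι) :
    ∫ ω, noisyValues p ω i ∂(pathNoise P σ ι) = 0 := by
  simp_rw [noisyValues_apply]
  rw [integral_add ((memLp_pathNoise_fst hP _).integrable (by simp))
    ((memLp_pathNoise_snd hP i).integrable (by simp)), integral_pathNoise_fst hP,
    integral_pathNoise_snd, add_zero]

lemma covariance_path_path (hP : IsCenteredGP P k) (x x' : X) :
    covariance (fun ω => ω.1 x) (fun ω => ω.1 x') (pathNoise P σ ι) = k x x' := by
  have h := covariance_map (μ := pathNoise P σ ι) (Z := Prod.fst)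
    (X := fun φ : C(X, ℝ) => φ x) (Y := fun φ : C(X, ℝ) => φ x')
    (measurable_path_apply x).aestronglyMeasurable
    (measurable_path_apply x').aestronglyMeasurable measurable_fst.aemeasurable
  rw [map_fst_pathNoise, hP.cov_eq] at h
  exact h.symm

lemma covariance_noise_noise (i j : ι) :
    covariance (fun ω => ω.2 i) (fun ω => ω.2 j) (pathNoise P σ ι)
      = if i = j then (σ : ℝ) ^ 2 else 0 := by
  have h := covariance_map (μ := pathNoise P σ ι) (Z := Prod.snd)
    (X := fun z : ι → ℝ => z i) (Y := fun z : ι → ℝ => z j)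
    (measurable_pi_apply i).aestronglyMeasurable
    (measurable_pi_apply j).aestronglyMeasurable measurable_snd.aemeasurable
  rw [map_snd_pathNoise, covariance_pi_gaussianReal, NNReal.coe_pow] at h
  exact h.symm

lemma covariance_path_noise (hP : IsCenteredGP P k) (x : X) (i : ι) :
    covariance (fun ω => ω.1 x) (fun ω => ω.2 i) (pathNoise P σ ι) = 0 :=
  (indepFun_prod (measurable_path_apply x) (measurable_pi_apply i)).covariance_eq_zero
    (memLp_pathNoise_fst hP x) (memLp_pathNoise_snd hP i)

lemma covariance_path_noisyValues (hP : IsCenteredGP P k) (p : ι → X) (x : X) (j : ι) :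
    covariance (fun ω => ω.1 x) (fun ω => noisyValues p ω j) (pathNoise P σ ι) = k x (p j) := by
  have h := covariance_add_right (memLp_pathNoise_fst (σ := σ) (ι := ι) hP x)
    (memLp_pathNoise_fst hP (p j)) (memLp_pathNoise_snd hP j)
  rw [covariance_path_path hP, covariance_path_noise hP, add_zero] at h
  exact h

lemma covariance_noisyValues (hP : IsCenteredGP P k) (p : ι → X) (i j : ι) :
    covariance (fun ω => noisyValues p ω i) (fun ω => noisyValues p ω j) (pathNoise P σ ι)
      = noisyGram k σ p i j := by
  have h := covariance_add_left (memLp_pathNoise_fst (σ := σ) (ι := ι) hP (p i))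
    (memLp_pathNoise_snd hP i) (memLp_noisyValues hP p j)
  have h2 := covariance_add_right (memLp_pathNoise_snd (σ := σ) (ι := ι) hP i)
    (memLp_pathNoise_fst hP (p j)) (memLp_pathNoise_snd hP j)
  have h3 : covariance (fun ω => ω.2 i) (fun ω => ω.1 (p j)) (pathNoise P σ ι) = 0 := by
    rw [covariance_comm]
    exact covariance_path_noise hP (p j) i
  rw [covariance_noise_noise, h3, zero_add] at h2
  rw [covariance_path_noisyValues hP, show covariance (fun ω => ω.2 i)
    (fun ω => noisyValues p ω j) (pathNoise P σ ι) = _ from h2] at h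
  rw [noisyGram_apply]
  exact h

/-- The log-density of the noisy values at the points `p`. -/
noncomputable def logEvidence (k : X → X → ℝ) (σ : ℝ≥0) (p : ι → X) (y : ι → ℝ) : ℝ :=
  -(y ⬝ᵥ (noisyGram k σ p)⁻¹ *ᵥ y) / 2 - Real.log (noisyGram k σ p).det / 2
    - Fintype.card ι / 2 * Real.log (2 * Real.pi)

/-- The log-density of the noise. -/
noncomputable def logNoiseDensity (σ : ℝ≥0) (η : ι → ℝ) : ℝ :=
  -(∑ i, η i ^ 2) / (2 * (σ : ℝ) ^ 2) - Fintype.card ι / 2 * Real.log (2 * Real.pi * (σ : ℝ) ^ 2)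

lemma measurable_quadForm (G : Matrix ι ι ℝ) : Measurable fun y : ι → ℝ => y ⬝ᵥ G *ᵥ y := by
  simp only [dotProduct, mulVec]
  fun_prop

lemma measurable_logEvidence (p : ι → X) : Measurable (logEvidence k σ p) := by
  have := measurable_quadForm (noisyGram k σ p)⁻¹
  unfold logEvidence
  fun_prop

lemma measurable_logNoiseDensity : Measurable (logNoiseDensity (ι := ι) σ) := by
  unfold logNoiseDensity
  fun_prop

lemma map_noisyValues (hP : IsCenteredGP P k) (hσ : 0 < σ) (p : ι → X) :
    (pathNoise P σ ι).map (noisyValues p)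
      = volume.withDensity fun y => ENNReal.ofReal (Real.exp (logEvidence k σ p y)) := by
  have := isGaussian_pathNoise (σ := σ) (ι := ι) hP
  have hm : Measurable (noisyValues (X := X) p) := (noisyValues p).continuous.measurable
  refine isGaussian_eq_withDensity _ _ (noisyGram_posDef hP hσ p) (fun i => ?_) fun i j => ?_
  · rw [integral_map hm.aemeasurable (measurable_pi_apply i).aestronglyMeasurable,
      integral_noisyValues hP]
  · rw [covariance_map (measurable_pi_apply i).aestronglyMeasurable
        (measurable_pi_apply j).aestronglyMeasurable hm.aemeasurable]
    exact covariance_noisyValues hP p i j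

lemma pi_noise_eq_withDensity (hσ : 0 < σ) :
    Measure.pi (fun _ : ι => gaussianReal 0 (σ ^ 2))
      = volume.withDensity fun η : ι → ℝ =>
        ENNReal.ofReal (Real.exp (logNoiseDensity σ η)) := by
  rw [pi_gaussianReal_eq_withDensity (by positivity)]
  simp [logNoiseDensity]

end Observations

/-! ### Mutual information of observations and values -/

section MutualInformation

open Matrix

variable {X : Type*} [MetricSpace X] [CompactSpace X] {P : Measure C(X, ℝ)}
  [IsProbabilityMeasure P] {k : X → X → ℝ} {σ : ℝ≥0} {T : ℕ}

lemma measurable_observation (p : Fin T → X) :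
    Measurable fun ω : C(X, ℝ) × (Fin T → ℝ) => (noisyValues p ω, fun i => ω.1 (p i)) :=
  (noisyValues p).continuous.measurable.prodMk
    (measurable_pi_lambda _ fun i => (measurable_path_apply (p i)).comp measurable_fst)

lemma observationLaw_eq (p : Fin T → X) :
    observationLaw P σ p = (pathNoise P σ (Fin T)).map
      fun ω => (noisyValues p ω, fun i => ω.1 (p i)) := rfl

/-- The joint law of noisy observations and noiseless values has an explicit density with respect
to the product of its marginals. -/
lemma observationLaw_eq_withDensity (hP : IsCenteredGP P k) (hσ : 0 < σ) (p : Fin T → X) :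
    observationLaw P σ p
      = ((observationLaw P σ p).fst.prod (observationLaw P σ p).snd).withDensity fun q =>
        ENNReal.ofReal (Real.exp (logNoiseDensity σ (q.1 - q.2) - logEvidence k σ p q.1)) := by
  have hm := measurable_observation (X := X) p
  have hev : Measurable fun (φ : C(X, ℝ)) i => φ (p i) :=
    measurable_pi_lambda _ fun i => measurable_path_apply (p i)
  have hE := measurable_logEvidence (k := k) (σ := σ) p
  have hN := measurable_logNoiseDensity (σ := σ) (ι := Fin T)
  have hprob : IsProbabilityMeasure (observationLaw P σ p) := by
    rw [observationLaw_eq]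
    exact Measure.isProbabilityMeasure_map hm.aemeasurable
  have hfst : (observationLaw P σ p).fst
      = volume.withDensity fun y => ENNReal.ofReal (Real.exp (logEvidence k σ p y)) := by
    rw [← map_noisyValues hP hσ, observationLaw_eq, Measure.fst, Measure.map_map measurable_fst hm]
    rfl
  have hsnd : (observationLaw P σ p).snd = P.map fun φ i => φ (p i) := by
    have h := Measure.map_map (μ := pathNoise P σ (Fin T)) hev measurable_fst
    rw [map_fst_pathNoise] at h
    rw [h, observationLaw_eq, Measure.snd, Measure.map_map measurable_snd hm]
    rfl
  have hd : Measurable fun q : (Fin T → ℝ) × (Fin T → ℝ) =>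
      ENNReal.ofReal (Real.exp (logNoiseDensity σ (q.1 - q.2) - logEvidence k σ p q.1)) := by
    fun_prop
  refine Measure.ext_of_lintegral _ fun F hF => ?_
  rw [lintegral_withDensity_eq_lintegral_mul _ hd hF,
    lintegral_prod_symm _ (hd.mul hF).aemeasurable]
  have hA : ∀ z : Fin T → ℝ, ∫⁻ y, ((fun q : (Fin T → ℝ) × (Fin T → ℝ) =>
        ENNReal.ofReal (Real.exp (logNoiseDensity σ (q.1 - q.2) - logEvidence k σ p q.1))) * F)
          (y, z) ∂(observationLaw P σ p).fst
      = ∫⁻ η, F (z + η, z) ∂(Measure.pi fun _ : Fin T => gaussianReal 0 (σ ^ 2)) := by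
    intro z
    rw [hfst, pi_noise_eq_withDensity hσ, lintegral_withDensity_eq_lintegral_mul _ (by fun_prop)
      (by fun_prop), lintegral_withDensity_eq_lintegral_mul _ (by fun_prop) (by fun_prop),
      ← lintegral_add_right_eq_self (μ := (volume : Measure (Fin T → ℝ))) _ z]
    refine lintegral_congr fun η => ?_
    simp only [Pi.mul_apply, add_sub_cancel_right]
    rw [← mul_assoc, ← ENNReal.ofReal_mul (Real.exp_pos _).le, ← Real.exp_add, add_comm z η]
    congr 3
    ring
  rw [lintegral_congr hA, hsnd, lintegral_map _ hev]
  · rw [observationLaw_eq, lintegral_map hF hm]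
    exact lintegral_prod (μ := P) (fun ω => F (noisyValues p ω, fun i => ω.1 (p i)))
      (hF.comp hm).aemeasurable
  · exact Measurable.lintegral_prod_right'
      (f := fun q : (Fin T → ℝ) × (Fin T → ℝ) => F (q.1 + q.2, q.1)) (by fun_prop)

/-- The mutual information of noisy observations and noiseless values of a Gaussian process. The
quadratic forms in the two Gaussian log-densities have the same expectation, so that only the
log-determinants remain. -/
theorem mutualInfo_observationLaw (hP : IsCenteredGP P k) (hσ : 0 < σ) (p : Fin T → X) :
    mutualInfo (observationLaw P σ p) ≠ ⊤ ∧
    (mutualInfo (observationLaw P σ p)).toReal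
      = (Real.log (noisyGram k σ p).det - T * Real.log ((σ : ℝ) ^ 2)) / 2 := by
  have hs : (0 : ℝ) < σ := by exact_mod_cast hσ
  have hm := measurable_observation (X := X) p
  have hE := measurable_logEvidence (k := k) (σ := σ) p
  have hN := measurable_logNoiseDensity (σ := σ) (ι := Fin T)
  set ρ := observationLaw P σ p with hρ
  have hprob : IsProbabilityMeasure ρ := by
    rw [hρ, observationLaw_eq]
    exact Measure.isProbabilityMeasure_map hm.aemeasurable
  let h : (Fin T → ℝ) × (Fin T → ℝ) → ℝ := fun q =>
    logNoiseDensity σ (q.1 - q.2) - logEvidence k σ p q.1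
  have hh : Measurable h := by fun_prop
  have hden : ρ = (ρ.fst.prod ρ.snd).withDensity fun q => ENNReal.ofReal (Real.exp (h q)) :=
    observationLaw_eq_withDensity hP hσ p
  have hac : ρ ≪ ρ.fst.prod ρ.snd := by
    conv_lhs => rw [hden]
    exact withDensity_absolutelyContinuous _ _
  have hllr : llr ρ (ρ.fst.prod ρ.snd) =ᵐ[ρ] h := by
    have h1 := Measure.rnDeriv_withDensity (ρ.fst.prod ρ.snd)
      (f := fun q => ENNReal.ofReal (Real.exp (h q))) (by fun_prop)
    rw [← hden] at h1
    filter_upwards [hac h1] with q hq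
    rw [llr, hq, ENNReal.toReal_ofReal (Real.exp_pos _).le, Real.log_exp]
  -- the quadratic forms are `‖ε‖² / σ²` and `yᵀ G⁻¹ y`; both have expectation `T`
  have hsq : ∀ i, Integrable (fun ω : C(X, ℝ) × (Fin T → ℝ) => ω.2 i ^ 2)
      (pathNoise P σ (Fin T)) := fun i => (memLp_pathNoise_snd hP i).integrable_sq
  have hsqv : ∀ i : Fin T, ∫ ω, ω.2 i ^ 2 ∂(pathNoise P σ (Fin T)) = (σ : ℝ) ^ 2 := by
    intro i
    have h1 := covariance_noise_noise (P := P) (σ := σ) i i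
    rw [covariance_eq_sub (memLp_pathNoise_snd hP i) (memLp_pathNoise_snd hP i),
      integral_pathNoise_snd] at h1
    simpa [sq] using h1
  have hyy : ∀ i j, Integrable (fun ω => noisyValues p ω i * noisyValues p ω j)
      (pathNoise P σ (Fin T)) := fun i j =>
    (memLp_noisyValues hP p i).integrable_mul (memLp_noisyValues hP p j)
  have hyyv : ∀ i j, ∫ ω, noisyValues p ω i * noisyValues p ω j ∂(pathNoise P σ (Fin T))
      = noisyGram k σ p i j := by
    intro i j
    have h1 := covariance_noisyValues (σ := σ) hP p i j
    rw [covariance_eq_sub (memLp_noisyValues hP p i) (memLp_noisyValues hP p j),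
      integral_noisyValues hP] at h1
    simpa using h1
  have hquad : ∀ y : Fin T → ℝ, y ⬝ᵥ (noisyGram k σ p)⁻¹ *ᵥ y
      = ∑ i, ∑ j, (noisyGram k σ p)⁻¹ i j * (y i * y j) := by
    intro y
    simp only [dotProduct, mulVec, Finset.mul_sum]
    exact Finset.sum_congr rfl fun i _ => Finset.sum_congr rfl fun j _ => by ring
  have hI1 : Integrable (fun ω : C(X, ℝ) × (Fin T → ℝ) => ∑ i, ω.2 i ^ 2)
      (pathNoise P σ (Fin T)) := integrable_finsetSum _ fun i _ => hsq i
  have hI2 : Integrable (fun ω => noisyValues p ω ⬝ᵥ (noisyGram k σ p)⁻¹ *ᵥ noisyValues p ω)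
      (pathNoise P σ (Fin T)) := by
    simp_rw [hquad]
    exact integrable_finsetSum _ fun i _ => integrable_finsetSum _ fun j _ => (hyy i j).const_mul _
  have hV1 : ∫ ω, ∑ i, ω.2 i ^ 2 ∂(pathNoise P σ (Fin T)) = T * (σ : ℝ) ^ 2 := by
    rw [integral_finsetSum _ fun i _ => hsq i]
    simp [hsqv]
  have hV2 : ∫ ω, noisyValues p ω ⬝ᵥ (noisyGram k σ p)⁻¹ *ᵥ noisyValues p ω
      ∂(pathNoise P σ (Fin T)) = T := by
    simp_rw [hquad]
    have hyyc : ∀ i j, Integrable (fun ω => (noisyGram k σ p)⁻¹ i j *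
        (noisyValues p ω i * noisyValues p ω j)) (pathNoise P σ (Fin T)) :=
      fun i j => (hyy i j).const_mul _
    refine (integral_finsetSum _ fun i _ => integrable_finsetSum _ fun j _ => hyyc i j).trans ?_
    simp_rw [integral_finsetSum _ fun j _ => hyyc _ j, integral_const_mul, hyyv]
    have hG := noisyGram_posDef hP hσ p
    have htr : ((noisyGram k σ p)⁻¹ * noisyGram k σ p).trace = T := by
      rw [nonsing_inv_mul _ (isUnit_iff_ne_zero.2 hG.det_pos.ne')]
      simp
    rw [← htr, trace]
    simp only [diag, mul_apply]
    refine Finset.sum_congr rfl fun i _ => Finset.sum_congr rfl fun j _ => ?_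
    have hsymm : noisyGram k σ p i j = noisyGram k σ p j i := by
      simp [noisyGram_apply, hP.cov_symm (p i) (p j), eq_comm]
    rw [hsymm]
  have hcomp : ∀ ω : C(X, ℝ) × (Fin T → ℝ), h (noisyValues p ω, fun i => ω.1 (p i))
      = (-(∑ i, ω.2 i ^ 2) / (2 * (σ : ℝ) ^ 2)
          + (noisyValues p ω ⬝ᵥ (noisyGram k σ p)⁻¹ *ᵥ noisyValues p ω) / 2)
        + (Real.log (noisyGram k σ p).det - T * Real.log ((σ : ℝ) ^ 2)) / 2 := by
    intro ω
    have e : (noisyValues p ω - fun i => ω.1 (p i)) = ω.2 := by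
      ext i
      simp [noisyValues_apply]
    simp only [h, e, logNoiseDensity, logEvidence, Fintype.card_fin]
    rw [Real.log_mul (by positivity) (by positivity)]
    ring
  have hI4 : Integrable (fun ω : C(X, ℝ) × (Fin T → ℝ) => -(∑ i, ω.2 i ^ 2) / (2 * (σ : ℝ) ^ 2))
      (pathNoise P σ (Fin T)) := hI1.neg.div_const _
  have hI5 : Integrable (fun ω => noisyValues p ω ⬝ᵥ (noisyGram k σ p)⁻¹ *ᵥ noisyValues p ω / 2)
      (pathNoise P σ (Fin T)) := hI2.div_const 2
  have hI3 : Integrable (fun ω : C(X, ℝ) × (Fin T → ℝ) => -(∑ i, ω.2 i ^ 2) / (2 * (σ : ℝ) ^ 2)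
      + noisyValues p ω ⬝ᵥ (noisyGram k σ p)⁻¹ *ᵥ noisyValues p ω / 2)
      (pathNoise P σ (Fin T)) := hI4.add hI5
  have hint : Integrable h ρ := by
    rw [hρ, observationLaw_eq, integrable_map_measure hh.aestronglyMeasurable hm.aemeasurable]
    refine Integrable.congr (hI3.add (integrable_const _)) (ae_of_all _ fun ω => (hcomp ω).symm)
  have hval : ∫ q, h q ∂ρ = (Real.log (noisyGram k σ p).det - T * Real.log ((σ : ℝ) ^ 2)) / 2 := by
    rw [hρ, observationLaw_eq, integral_map hm.aemeasurable hh.aestronglyMeasurable]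
    simp_rw [hcomp]
    rw [integral_add hI3 (integrable_const _), integral_add hI4 hI5, integral_div, integral_div, integral_neg, hV1, hV2]
    simp only [integral_const, probReal_univ, smul_eq_mul, one_mul]
    field_simp
    ring
  refine ⟨InformationTheory.klDiv_ne_top hac (hint.congr hllr.symm), ?_⟩
  rw [mutualInfo, InformationTheory.toReal_klDiv_of_measure_eq hac (by simp),
    integral_congr_ae hllr, hval]

end MutualInformation

/-! ### The posterior mean and variance formulas -/

section PosteriorMean

open Matrix

variable {X : Type*} [MetricSpace X] [CompactSpace X] {P : Measure C(X, ℝ)}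
  [IsProbabilityMeasure P] {k : X → X → ℝ} {σ : ℝ≥0} {n : ℕ}

/-- The coefficients `(K + σ² I)⁻¹ k(x)` of the linear predictor of the value at `x`. -/
noncomputable def predictorWeights (k : X → X → ℝ) (σ : ℝ≥0) (p : Fin n → X) (x : X) : Fin n → ℝ :=
  (fun i => k x (p i)) ᵥ* (noisyGram k σ p)⁻¹

/-- The prediction error at `x` of the linear predictor from noisy values at `p`. -/
noncomputable def predictionError (k : X → X → ℝ) (σ : ℝ≥0) (p : Fin n → X) (x : X) :
    C(X, ℝ) × (Fin n → ℝ) →L[ℝ] ℝ :=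
  (ContinuousMap.evalCLM ℝ x).comp (.fst ℝ _ _)
    - ∑ i, predictorWeights k σ p x i • (ContinuousLinearMap.proj i).comp (noisyValues p)

lemma predictionError_apply (p : Fin n → X) (x : X) (ω : C(X, ℝ) × (Fin n → ℝ)) :
    predictionError k σ p x ω = ω.1 x - predictorWeights k σ p x ⬝ᵥ noisyValues p ω := by
  simp [predictionError, dotProduct]

lemma posteriorMean_eq (D : Dataset X n) (x : X) :
    posteriorMean k σ D x
      = predictorWeights k σ (fun i => (D i).1) x ⬝ᵥ fun i => (D i).2 :=
  dotProduct_mulVec _ _ _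

lemma posteriorVar_eq (D : Dataset X n) (x : X) :
    posteriorVar k σ D x = k x x -
      predictorWeights k σ (fun i => (D i).1) x ⬝ᵥ fun i => k x (D i).1 := by
  rw [posteriorVar, dotProduct_mulVec]
  rfl

lemma predictorWeights_vecMul (hP : IsCenteredGP P k) (hσ : 0 < σ) (p : Fin n → X) (x : X) :
    predictorWeights k σ p x ᵥ* noisyGram k σ p = fun i => k x (p i) := by
  rw [predictorWeights, vecMul_vecMul, nonsing_inv_mul _
    (isUnit_iff_ne_zero.2 (noisyGram_posDef hP hσ p).det_pos.ne'), vecMul_one]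

lemma covariance_predictionError_left (hP : IsCenteredGP P k) (p : Fin n → X) (x : X)
    {Y : C(X, ℝ) × (Fin n → ℝ) → ℝ} (hY : MemLp Y 2 (pathNoise P σ (Fin n))) :
    covariance (predictionError k σ p x) Y (pathNoise P σ (Fin n))
      = covariance (fun ω => ω.1 x) Y (pathNoise P σ (Fin n))
        - ∑ i, predictorWeights k σ p x i *
          covariance (fun ω => noisyValues p ω i) Y (pathNoise P σ (Fin n)) := by
  have hs : ∀ i, MemLp (fun ω => predictorWeights k σ p x i * noisyValues p ω i) 2
      (pathNoise P σ (Fin n)) := fun i => (memLp_noisyValues hP p i).const_mul _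
  have e : (predictionError k σ p x : C(X, ℝ) × (Fin n → ℝ) → ℝ)
      = (fun ω => ω.1 x) - fun ω => ∑ i, predictorWeights k σ p x i * noisyValues p ω i :=
    funext fun ω => predictionError_apply p x ω
  rw [e, covariance_sub_left (memLp_pathNoise_fst hP x) (memLp_finsetSum _ fun i _ => hs i) hY,
    covariance_fun_sum_left hs hY]
  simp_rw [covariance_const_mul_left]

lemma covariance_predictionError_noisyValues (hP : IsCenteredGP P k) (hσ : 0 < σ) (p : Fin n → X)
    (x : X) (j : Fin n) :
    covariance (predictionError k σ p x) (fun ω => noisyValues p ω j) (pathNoise P σ (Fin n)) = 0 := by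
  rw [covariance_predictionError_left hP p x (memLp_noisyValues hP p j)]
  simp_rw [covariance_path_noisyValues hP, covariance_noisyValues hP]
  have := congrFun (predictorWeights_vecMul hP hσ p x) j
  simp only [vecMul, dotProduct] at this
  rw [this, sub_self]

/-- The variance of the prediction error is the posterior variance, by orthogonality of the error to
the noisy values. -/
lemma covariance_predictionError_self (hP : IsCenteredGP P k) (hσ : 0 < σ) (D : Dataset X n) (x : X) :
    covariance (predictionError k σ (fun i => (D i).1) x) (predictionError k σ (fun i => (D i).1) x)
      (pathNoise P σ (Fin n)) = posteriorVar k σ D x := by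
  rw [covariance_predictionError_left hP _ x (memLp_of_isGaussian hP _)]
  simp_rw [covariance_comm _ (predictionError k σ (fun i => (D i).1) x),
    covariance_predictionError_noisyValues hP hσ, mul_zero, Finset.sum_const_zero, sub_zero]
  rw [covariance_predictionError_left hP _ x (memLp_pathNoise_fst hP x), covariance_path_path hP,
    posteriorVar_eq]
  simp_rw [covariance_comm _ (fun ω : C(X, ℝ) × (Fin n → ℝ) => ω.1 x),
    covariance_path_noisyValues hP]
  rfl

lemma posteriorVar_nonneg (hP : IsCenteredGP P k) (hσ : 0 < σ) (D : Dataset X n) (x : X) :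
    0 ≤ posteriorVar k σ D x := by
  rw [← covariance_predictionError_self hP hσ, covariance_self
    (predictionError k σ (fun i => (D i).1) x).continuous.measurable.aemeasurable]
  exact variance_nonneg _ _

lemma posteriorVar_le_self (hP : IsCenteredGP P k) (hσ : 0 < σ) (D : Dataset X n) (x : X) :
    posteriorVar k σ D x ≤ k x x := by
  have := (noisyGram_posDef hP hσ fun i => (D i).1).inv.posSemidef.dotProduct_mulVec_nonneg
    fun i => k x (D i).1
  rw [posteriorVar]
  exact sub_le_self _ this

/-- The prediction error is uncorrelated with, hence independent of, the noisy values. -/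
lemma indepFun_predictionError_noisyValues (hP : IsCenteredGP P k) (hσ : 0 < σ) (p : Fin n → X) (x : X) :
    IndepFun (predictionError k σ p x) (noisyValues p) (pathNoise P σ (Fin n)) := by
  have := isGaussian_pathNoise (σ := σ) (ι := Fin n) hP
  have hG : HasGaussianLaw
      (((ContinuousLinearMap.pi fun _ : Unit => predictionError k σ p x).prod (noisyValues p) :
        C(X, ℝ) × (Fin n → ℝ) →L[ℝ] (Unit → ℝ) × (Fin n → ℝ))) (pathNoise P σ (Fin n)) :=
    IsGaussian.hasGaussianLaw
  have h := HasGaussianLaw.indepFun_of_covariance_eval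
    (X := fun (_ : Unit) ω => predictionError k σ p x ω) (Y := fun j ω => noisyValues p ω j) hG
    fun _ j => covariance_predictionError_noisyValues hP hσ p x j
  exact h.comp (φ := fun z : Unit → ℝ => z ()) (measurable_pi_apply _) measurable_id

lemma integral_predictionError (hP : IsCenteredGP P k) (p : Fin n → X) (x : X) :
    ∫ ω, predictionError k σ p x ω ∂(pathNoise P σ (Fin n)) = 0 := by
  simp_rw [predictionError_apply, dotProduct]
  have hs : ∀ i, Integrable (fun ω => predictorWeights k σ p x i * noisyValues p ω i)
      (pathNoise P σ (Fin n)) :=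
    fun i => ((memLp_noisyValues hP p i).integrable (by simp)).const_mul _
  rw [integral_sub ((memLp_pathNoise_fst hP x).integrable (by simp))
    (integrable_finsetSum _ fun i _ => hs i), integral_pathNoise_fst hP,
    integral_finsetSum _ fun i _ => hs i]
  simp_rw [integral_const_mul, integral_noisyValues hP]
  simp

/-- The unnormalised likelihood of the path given the values `y` at the points `p`. -/
noncomputable def likelihood (σ : ℝ≥0) (p : Fin n → X) (y : Fin n → ℝ) (φ : C(X, ℝ)) : ℝ :=
  Real.exp (-(∑ i, (y i - φ (p i)) ^ 2) / (2 * (σ : ℝ) ^ 2))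

lemma measurable_likelihood (p : Fin n → X) :
    Measurable fun q : (Fin n → ℝ) × C(X, ℝ) => likelihood σ p q.1 q.2 := by
  have h : ∀ i, Measurable fun q : (Fin n → ℝ) × C(X, ℝ) => q.2 (p i) := fun i =>
    (measurable_path_apply (p i)).comp measurable_snd
  unfold likelihood
  fun_prop

lemma likelihood_pos (p : Fin n → X) (y : Fin n → ℝ) (φ : C(X, ℝ)) : 0 < likelihood σ p y φ :=
  Real.exp_pos _

lemma likelihood_le_one (p : Fin n → X) (y : Fin n → ℝ) (φ : C(X, ℝ)) : likelihood σ p y φ ≤ 1 :=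
  Real.exp_le_one_iff.2 (logLikelihood_nonpos (σ := σ) (fun i => (p i, y i)) φ)

lemma continuous_likelihood (p : Fin n → X) (φ : C(X, ℝ)) :
    Continuous fun y => likelihood σ p y φ := by
  unfold likelihood
  fun_prop

/-- The joint law of noisy values and path has a density proportional to the likelihood. -/
lemma map_noisyValues_path (hσ : 0 < σ) (p : Fin n → X) :
    ∃ c : ℝ, 0 < c ∧ (pathNoise P σ (Fin n)).map (fun ω => (noisyValues p ω, ω.1))
      = ((volume : Measure (Fin n → ℝ)).prod P).withDensity fun q =>
        ENNReal.ofReal (c * likelihood σ p q.1 q.2) := by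
  refine ⟨Real.exp (-((n : ℝ) / 2 * Real.log (2 * Real.pi * (σ : ℝ) ^ 2))), Real.exp_pos _, ?_⟩
  have hm : Measurable fun ω : C(X, ℝ) × (Fin n → ℝ) => (noisyValues p ω, ω.1) :=
    (noisyValues p).continuous.measurable.prodMk measurable_fst
  have hL := measurable_likelihood (σ := σ) p
  have hN := measurable_logNoiseDensity (σ := σ) (ι := Fin n)
  refine Measure.ext_of_lintegral _ fun F hF => ?_
  rw [lintegral_withDensity_eq_lintegral_mul _ (by fun_prop) hF, lintegral_map hF hm]
  refine (lintegral_prod (μ := P) (ν := Measure.pi fun _ : Fin n => gaussianReal 0 (σ ^ 2))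
      (fun ω => F (noisyValues p ω, ω.1))
      (hF.comp hm).aemeasurable).trans ?_
  rw [lintegral_prod_symm _ (by fun_prop)]
  refine lintegral_congr fun φ => ?_
  have hFφ : Measurable fun η : Fin n → ℝ => F (noisyValues p (φ, η), φ) :=
    hF.comp (hm.comp measurable_prodMk_left)
  change ∫⁻ η, F (noisyValues p (φ, η), φ) ∂_ = _
  rw [pi_noise_eq_withDensity hσ, lintegral_withDensity_eq_lintegral_mul _ (by fun_prop) hFφ]
  refine Eq.trans (lintegral_congr fun η => ?_)
    (lintegral_add_right_eq_self (μ := (volume : Measure (Fin n → ℝ))) _ (fun i => φ (p i)))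
  simp only [Pi.mul_apply]
  congr 1
  · rw [likelihood, ← Real.exp_add, logNoiseDensity]
    simp only [Pi.add_apply, add_sub_cancel_right, Fintype.card_fin]
    ring_nf
  · congr 2
    ext i
    exact add_comm _ _

/-- By independence of prediction error and noisy values, the prediction error averages to zero
under the unnormalised posterior, for almost all values of the observations. -/
lemma integral_likelihood_mul_ae (hP : IsCenteredGP P k) (hσ : 0 < σ) (p : Fin n → X) (x : X) :
    ∀ᵐ y : Fin n → ℝ, ∫ φ, likelihood σ p y φ * (φ x - predictorWeights k σ p x ⬝ᵥ y) ∂P = 0 := by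
  obtain ⟨c, hc, hmap⟩ := map_noisyValues_path (P := P) hσ p
  set a := predictorWeights k σ p x with ha
  have hm : Measurable fun ω : C(X, ℝ) × (Fin n → ℝ) => (noisyValues p ω, ω.1) :=
    (noisyValues p).continuous.measurable.prodMk measurable_fst
  have hL := measurable_likelihood (σ := σ) p
  have hx : Measurable fun q : (Fin n → ℝ) × C(X, ℝ) => q.2 x :=
    (measurable_path_apply x).comp measurable_snd
  have hh : Measurable fun q : (Fin n → ℝ) × C(X, ℝ) => q.2 x - a ⬝ᵥ q.1 := by
    simp only [dotProduct]
    fun_prop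
  have herr : Integrable (predictionError k σ p x) (pathNoise P σ (Fin n)) :=
    (memLp_of_isGaussian hP _).integrable (by simp)
  have hden : Measurable fun q : (Fin n → ℝ) × C(X, ℝ) =>
      ENNReal.ofReal (c * likelihood σ p q.1 q.2) := by fun_prop
  have hsmul : (fun q : (Fin n → ℝ) × C(X, ℝ) =>
      (ENNReal.ofReal (c * likelihood σ p q.1 q.2)).toReal • (q.2 x - a ⬝ᵥ q.1))
      = fun q => c * likelihood σ p q.1 q.2 * (q.2 x - a ⬝ᵥ q.1) := by
    ext q
    rw [ENNReal.toReal_ofReal (mul_pos hc (likelihood_pos _ _ _)).le, smul_eq_mul]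
  have hint : Integrable (fun q : (Fin n → ℝ) × C(X, ℝ) =>
      c * likelihood σ p q.1 q.2 * (q.2 x - a ⬝ᵥ q.1)) (volume.prod P) := by
    rw [← hsmul, ← integrable_withDensity_iff_integrable_smul' hden (by simp), ← hmap,
      integrable_map_measure hh.aestronglyMeasurable hm.aemeasurable]
    exact herr.congr (ae_of_all _ fun ω => predictionError_apply p x ω)
  have hae := Integrable.ae_eq_zero_of_forall_setIntegral_eq_zero hint.integral_prod_left
    fun s hs _ => ?_
  · filter_upwards [hae] with y hy
    simp only [mul_assoc, integral_const_mul, Pi.zero_apply] at hy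
    exact (mul_eq_zero.1 hy).resolve_left hc.ne'
  · have hone : Measurable (s.indicator fun _ => (1 : ℝ)) := measurable_const.indicator hs
    have hind := (indepFun_predictionError_noisyValues hP hσ p x).comp (φ := id)
      (ψ := s.indicator fun _ => (1 : ℝ)) measurable_id hone
    have h0 := hind.integral_mul_eq_mul_integral
      (predictionError k σ p x).continuous.measurable.aestronglyMeasurable
      (hone.comp
        (noisyValues p).continuous.measurable).aestronglyMeasurable
    rw [show ∫ ω, (id ∘ predictionError k σ p x) ω ∂(pathNoise P σ (Fin n)) = 0 from
      integral_predictionError hP p x, zero_mul] at h0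
    have h1 : ∫ q in s ×ˢ Set.univ, (q.2 x - a ⬝ᵥ q.1)
        ∂((pathNoise P σ (Fin n)).map fun ω => (noisyValues p ω, ω.1)) = 0 := by
      rw [← integral_indicator (hs.prod .univ), integral_map hm.aemeasurable
        (hh.indicator (hs.prod .univ)).aestronglyMeasurable, ← h0]
      refine integral_congr_ae (ae_of_all _ fun ω => ?_)
      by_cases hω : noisyValues p ω ∈ s
      · simp [hω, predictionError_apply, ha]
      · simp [hω]
    rw [hmap, restrict_withDensity (hs.prod .univ),
      integral_withDensity_eq_integral_toReal_smul hden (by simp), hsmul,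
      setIntegral_prod _ hint.integrableOn] at h1
    simpa using h1

/-- The expectation of the value at `x` under the posterior is given by the linear predictor. -/
theorem integral_gpPosterior (hP : IsCenteredGP P k) (hσ : 0 < σ) (D : Dataset X n) (x : X) :
    ∫ φ, φ x ∂(gpPosterior P σ D) = posteriorMean k σ D x := by
  set p : Fin n → X := fun i => (D i).1 with hp
  set a := predictorWeights k σ p x with ha
  have hLm : ∀ y, Measurable (likelihood σ p y) := fun y =>
    (measurable_likelihood (σ := σ) p).comp (f := fun φ => (y, φ)) measurable_prodMk_left
  have hLn : ∀ y φ, ‖likelihood σ p y φ‖ ≤ 1 := fun y φ => by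
    rw [Real.norm_eq_abs, abs_of_pos (likelihood_pos _ _ _)]
    exact likelihood_le_one p y φ
  have hI1 : ∀ y, Integrable (likelihood σ p y) P := fun y =>
    Integrable.mono' (integrable_const 1) (hLm y).aestronglyMeasurable (ae_of_all _ (hLn y))
  have hI2 : ∀ y, Integrable (fun φ => likelihood σ p y φ * φ x) P := fun y =>
    (hP.integrable_eval x).bdd_mul (hLm y).aestronglyMeasurable (ae_of_all _ (hLn y))
  have hZ : Continuous fun y => ∫ φ, likelihood σ p y φ ∂P :=
    continuous_of_dominated (F := likelihood σ p) (fun y => (hLm y).aestronglyMeasurable)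
      (bound := fun _ => (1 : ℝ)) (fun y => ae_of_all _ (hLn y)) (integrable_const 1)
      (ae_of_all _ fun φ => continuous_likelihood p φ)
  have hM : Continuous fun y => ∫ φ, likelihood σ p y φ * φ x ∂P := by
    refine continuous_of_dominated (bound := fun φ => |φ x|)
      (fun y => (hI2 y).aestronglyMeasurable) (fun y => ae_of_all _ fun φ => ?_)
      (hP.integrable_eval x).abs (ae_of_all _ fun φ => (continuous_likelihood p φ).mul_const _)
    rw [norm_mul]
    exact (mul_le_mul_of_nonneg_right (hLn y φ) (norm_nonneg _)).trans_eq (one_mul _)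
  -- both sides are continuous in the observed values and agree almost everywhere
  have key : (fun y => ∫ φ, likelihood σ p y φ * φ x ∂P)
      = fun y => (∫ φ, likelihood σ p y φ ∂P) * (a ⬝ᵥ y) := by
    have hlin : Continuous fun y => a ⬝ᵥ y := by
      simp only [dotProduct]
      fun_prop
    refine (Continuous.ae_eq_iff_eq volume hM (hZ.mul hlin)).1 ?_
    filter_upwards [integral_likelihood_mul_ae hP hσ p x] with y hy
    simp_rw [mul_sub] at hy
    rw [integral_sub (hI2 y) ((hI1 y).mul_const _), integral_mul_const] at hy
    exact sub_eq_zero.1 hy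
  have hy := congrFun key fun i => (D i).2
  rw [posteriorMean_eq, gpPosterior, integral_tilted]
  have hpos : 0 < ∫ φ, likelihood σ p (fun i => (D i).2) φ ∂P :=
    integral_exp_pos (integrable_likelihood D)
  simp_rw [smul_eq_mul, div_mul_eq_mul_div, integral_div]
  rw [div_eq_iff (integral_exp_pos (integrable_likelihood D)).ne', mul_comm (_ ⬝ᵥ _)]
  exact hy

end PosteriorMean

/-! ### Posterior variances and information gain -/

section MatrixMeasurability

open Matrix

variable {α : Type*} [MeasurableSpace α] {n : ℕ}

lemma measurable_matrix_det {M : α → Matrix (Fin n) (Fin n) ℝ}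
    (hM : ∀ i j, Measurable fun a => M a i j) : Measurable fun a => (M a).det := by
  simp_rw [det_apply]
  exact Finset.measurable_sum _ fun s _ =>
    (Finset.measurable_prod _ fun i _ => hM (s i) i).const_smul _

lemma measurable_matrix_inv {M : α → Matrix (Fin n) (Fin n) ℝ}
    (hM : ∀ i j, Measurable fun a => M a i j) (i j : Fin n) :
    Measurable fun a => (M a)⁻¹ i j := by
  simp_rw [inv_def, Matrix.smul_apply, adjugate_apply, Ring.inverse_eq_inv', smul_eq_mul]
  refine (measurable_matrix_det hM).inv.mul (measurable_matrix_det fun i' j' => ?_)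
  simp_rw [updateRow_apply]
  split_ifs
  · exact measurable_const
  · exact hM i' j'

end MatrixMeasurability

section InformationGain

open Matrix

variable {X : Type*} [MetricSpace X] [CompactSpace X] {P : Measure C(X, ℝ)}
  [IsProbabilityMeasure P] {k : X → X → ℝ} {σ : ℝ≥0} {n : ℕ}

section Measurability

variable [MeasurableSpace X] [BorelSpace X]

lemma measurable_gramMatrix_inv (hP : IsCenteredGP P k) (i j : Fin n) :
    Measurable fun D : Dataset X n => (gramMatrix k σ D)⁻¹ i j := by
  refine measurable_matrix_inv (fun i j => ?_) i j
  have h := hP.measurable_kernel.comp (f := fun D : Dataset X n => ((D i).1, (D j).1))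
    (by fun_prop)
  exact h.add measurable_const

lemma measurable_kernel_data (hP : IsCenteredGP P k) (i : Fin n) :
    Measurable fun q : Dataset X n × X => k q.2 (q.1 i).1 :=
  hP.measurable_kernel.comp (f := fun q : Dataset X n × X => (q.2, (q.1 i).1)) (by fun_prop)

lemma measurable_posteriorVar (hP : IsCenteredGP P k) :
    Measurable fun q : Dataset X n × X => posteriorVar k σ q.1 q.2 := by
  have h1 := fun i => measurable_kernel_data (n := n) hP i
  have h2 : ∀ i j, Measurable fun q : Dataset X n × X => (gramMatrix k σ q.1)⁻¹ i j := fun i j =>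
    (measurable_gramMatrix_inv (σ := σ) (n := n) hP i j).comp measurable_fst
  have h3 : Measurable fun q : Dataset X n × X => k q.2 q.2 :=
    hP.measurable_kernel.comp (f := fun q : Dataset X n × X => (q.2, q.2)) (by fun_prop)
  simp only [posteriorVar, dotProduct, mulVec]
  exact h3.sub (Finset.measurable_sum _ fun i _ => (h1 i).mul
    (Finset.measurable_sum _ fun j _ => (h2 i j).mul (h1 j)))

end Measurability

/-- The data set with inputs `p 0, …, p (n - 1)` and all observations equal to zero. -/
def inputsOnly (p : ℕ → X) (n : ℕ) : Dataset X n := fun i => (p i, 0)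

lemma posteriorVar_congr {D D' : Dataset X n} (h : ∀ i, (D i).1 = (D' i).1) (x : X) :
    posteriorVar k σ D x = posteriorVar k σ D' x := by
  simp [posteriorVar, gramMatrix, h]

/-- The Schur complement formula for the determinant, for one more observation. -/
lemma det_noisyGram_succ (hP : IsCenteredGP P k) (hσ : 0 < σ) (p : ℕ → X) (n : ℕ) :
    (noisyGram k σ fun i : Fin (n + 1) => p i).det
      = (noisyGram k σ fun i : Fin n => p i).det *
        (posteriorVar k σ (inputsOnly p n) (p n) + (σ : ℝ) ^ 2) := by
  set A := noisyGram k σ fun i : Fin n => p i with hA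
  have hAu : IsUnit A.det := isUnit_iff_ne_zero.2 (noisyGram_posDef hP hσ _).det_pos.ne'
  let _ : Invertible A := invertibleOfIsUnitDet A hAu
  have hblocks : (noisyGram k σ fun i : Fin (n + 1) => p i).submatrix
      finSumFinEquiv finSumFinEquiv
      = fromBlocks A (Matrix.of fun i (_ : Fin 1) => k (p i) (p n))
        (Matrix.of fun (_ : Fin 1) j => k (p n) (p j))
        (Matrix.of fun (_ _ : Fin 1) => k (p n) (p n) + (σ : ℝ) ^ 2) := by
    ext (i | i) (j | j)
    · simp [hA, noisyGram_apply, Fin.ext_iff]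
    · have : (i : ℕ) ≠ n := i.2.ne
      simp [noisyGram_apply, Fin.ext_iff, this]
    · have : n ≠ (j : ℕ) := j.2.ne'
      simp [noisyGram_apply, Fin.ext_iff, this]
    · simp [noisyGram_apply, Fin.ext_iff]
  rw [← det_submatrix_equiv_self finSumFinEquiv, hblocks, det_fromBlocks₁₁]
  congr 1
  rw [det_unique, Matrix.sub_apply, invOf_eq_nonsing_inv, posteriorVar]
  have hs : ∀ i : Fin n, k (p i) (p n) = k (p n) (p i) := fun i => hP.cov_symm _ _
  simp only [mul_apply, of_apply, dotProduct, mulVec, hs, Finset.sum_mul, Finset.mul_sum]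
  rw [Finset.sum_comm]
  have : gramMatrix k σ (inputsOnly p n) = A := rfl
  rw [this]
  simp only [inputsOnly, mul_assoc]
  ring

/-- The log-determinant, relative to that of pure noise, splits into contributions of the single
queries. -/
lemma log_det_noisyGram (hP : IsCenteredGP P k) (hσ : 0 < σ) (p : ℕ → X) (n : ℕ) :
    Real.log (noisyGram k σ fun i : Fin n => p i).det - n * Real.log ((σ : ℝ) ^ 2)
      = ∑ t ∈ Finset.range n,
        Real.log (1 + ((σ : ℝ) ^ 2)⁻¹ * posteriorVar k σ (inputsOnly p t) (p t)) := by
  have hs : (0 : ℝ) < (σ : ℝ) ^ 2 := by positivity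
  induction n with
  | zero => simp
  | succ n ih =>
    have hv := posteriorVar_nonneg hP hσ (inputsOnly p n) (p n)
    rw [Finset.sum_range_succ, ← ih, det_noisyGram_succ hP hσ,
      Real.log_mul (noisyGram_posDef hP hσ _).det_pos.ne' (by positivity),
      show posteriorVar k σ (inputsOnly p n) (p n) + (σ : ℝ) ^ 2
        = (1 + ((σ : ℝ) ^ 2)⁻¹ * posteriorVar k σ (inputsOnly p n) (p n)) * (σ : ℝ) ^ 2 by
        field_simp
        ring, Real.log_mul (by positivity) hs.ne']
    push_cast
    ring

/-- The chain rule for the information gain. -/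
lemma toReal_mutualInfo (hP : IsCenteredGP P k) (hσ : 0 < σ) (p : ℕ → X) (n : ℕ) :
    (mutualInfo (observationLaw P σ fun i : Fin n => p i)).toReal
      = (∑ t ∈ Finset.range n,
        Real.log (1 + ((σ : ℝ) ^ 2)⁻¹ * posteriorVar k σ (inputsOnly p t) (p t))) / 2 := by
  rw [(mutualInfo_observationLaw hP hσ _).2, log_det_noisyGram hP hσ]

lemma toReal_mutualInfo_le (hP : IsCenteredGP P k) (hk : ∀ x, k x x ≤ 1) (hσ : 0 < σ)
    (p : Fin n → X) :
    (mutualInfo (observationLaw P σ p)).toReal ≤ n * Real.log (1 + ((σ : ℝ) ^ 2)⁻¹) / 2 := by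
  rcases n with _ | n
  · rw [(mutualInfo_observationLaw hP hσ _).2]
    simp
  · have hp : p = fun i : Fin (n + 1) => (fun j : ℕ => p (Fin.ofNat (n + 1) j)) i := by
      ext i
      simp
    rw [hp, toReal_mutualInfo hP hσ fun j => p (Fin.ofNat (n + 1) j)]
    refine div_le_div_of_nonneg_right ?_ zero_le_two
    refine (Finset.sum_le_card_nsmul _ _ (Real.log (1 + ((σ : ℝ) ^ 2)⁻¹)) fun t _ => ?_).trans_eq
      (by simp)
    have hv := posteriorVar_nonneg hP hσ (inputsOnly (fun j => p (Fin.ofNat (n + 1) j)) t)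
      (p (Fin.ofNat (n + 1) t))
    have hv1 := (posteriorVar_le_self hP hσ (inputsOnly (fun j => p (Fin.ofNat (n + 1) j)) t)
      (p (Fin.ofNat (n + 1) t))).trans (hk _)
    refine Real.log_le_log (by positivity) ?_
    gcongr
    exact mul_le_of_le_one_right (by positivity) hv1

lemma iSup_mutualInfo_ne_top (hP : IsCenteredGP P k) (hk : ∀ x, k x x ≤ 1) (hσ : 0 < σ) :
    ⨆ p : Fin n → X, mutualInfo (observationLaw P σ p) ≠ ⊤ := by
  refine ne_top_of_le_ne_top
    (ENNReal.ofReal_ne_top (r := n * Real.log (1 + ((σ : ℝ) ^ 2)⁻¹) / 2)) (iSup_le fun p => ?_)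
  rw [← ENNReal.ofReal_toReal (mutualInfo_observationLaw hP hσ p).1]
  exact ENNReal.ofReal_le_ofReal (toReal_mutualInfo_le hP hk hσ p)

lemma toReal_mutualInfo_le_maxInfoGain (hP : IsCenteredGP P k) (hk : ∀ x, k x x ≤ 1) (hσ : 0 < σ)
    (p : Fin n → X) : (mutualInfo (observationLaw P σ p)).toReal ≤ maxInfoGain P σ n :=
  ENNReal.toReal_mono (iSup_mutualInfo_ne_top hP hk hσ)
    (le_iSup (fun p : Fin n → X => mutualInfo (observationLaw P σ p)) p)

lemma log_one_add_inv_pos (hσ : 0 < σ) : 0 < Real.log (1 + ((σ : ℝ) ^ 2)⁻¹) :=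
  Real.log_pos (lt_add_of_pos_right 1 (by positivity))

/-- The posterior variances along any sequence of queries add up to at most a multiple of the
maximum information gain: `v log (1 + σ⁻²) ≤ log (1 + σ⁻² v)` for `0 ≤ v ≤ 1` by Bernoulli's
inequality. -/
theorem sum_posteriorVar_le (hP : IsCenteredGP P k) (hk : ∀ x, k x x ≤ 1) (hσ : 0 < σ)
    (p : ℕ → X) (n : ℕ) :
    ∑ t ∈ Finset.range n, posteriorVar k σ (inputsOnly p t) (p t)
      ≤ 2 / Real.log (1 + ((σ : ℝ) ^ 2)⁻¹) * maxInfoGain P σ n := by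
  have hL := log_one_add_inv_pos hσ
  have h := toReal_mutualInfo_le_maxInfoGain hP hk hσ fun i : Fin n => p i
  rw [toReal_mutualInfo hP hσ] at h
  rw [div_mul_eq_mul_div, le_div_iff₀ hL, Finset.sum_mul]
  refine (Finset.sum_le_sum fun t _ => ?_).trans (show _ ≤ _ by linarith)
  have hv := posteriorVar_nonneg hP hσ (inputsOnly p t) (p t)
  have hv1 := (posteriorVar_le_self hP hσ (inputsOnly p t) (p t)).trans (hk _)
  rw [← Real.log_rpow (by positivity), mul_comm (((σ : ℝ) ^ 2)⁻¹)]
  exact Real.log_le_log (by positivity) (rpow_one_add_le_one_add_mul_self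
    (by linarith [show 0 < ((σ : ℝ) ^ 2)⁻¹ by positivity]) hv hv1)

lemma maxInfoGain_nonneg (P : Measure C(X, ℝ)) (σ : ℝ≥0) (n : ℕ) : 0 ≤ maxInfoGain P σ n :=
  ENNReal.toReal_nonneg

/-- A single informative query bounds the information gain from below. -/
lemma log_le_maxInfoGain (hP : IsCenteredGP P k) (hk : ∀ x, k x x ≤ 1) (hσ : 0 < σ) (x : X)
    (hn : 1 ≤ n) : Real.log (1 + ((σ : ℝ) ^ 2)⁻¹ * k x x) / 2 ≤ maxInfoGain P σ n := by
  refine le_trans ?_ (toReal_mutualInfo_le_maxInfoGain hP hk hσ fun _ => x)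
  have e := toReal_mutualInfo hP hσ (fun _ => x) n
  rw [show (fun _ : Fin n => x) = fun i : Fin n => (fun _ : ℕ => x) i from rfl, e]
  refine div_le_div_of_nonneg_right ?_ zero_le_two
  refine le_trans (le_of_eq ?_) (Finset.single_le_sum (fun t _ => Real.log_nonneg ?_)
    (Finset.mem_range.2 hn))
  · simp [posteriorVar]
  · have hv := posteriorVar_nonneg hP hσ (inputsOnly (fun _ => x) t) x
    linarith [show 0 ≤ ((σ : ℝ) ^ 2)⁻¹ * posteriorVar k σ (inputsOnly (fun _ => x) t) x by
      positivity]

/-- The order of the regret bound. -/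
theorem isSoftBigO_regretBound (hP : IsCenteredGP P k) (hk : ∀ x, k x x ≤ 1) (hσ : 0 < σ)
    {ζ ξ : ℕ → ℝ} (hζ : IsSoftBigO (fun T => ∑ t ∈ Finset.range T, ζ t) fun T => (T : ℝ))
    (hξ : (fun T : ℕ => ∑ t ∈ Finset.range T, ξ t) =O[atTop] fun _ => (1 : ℝ))
    (hne : ∃ x, k x x ≠ 0) :
    IsSoftBigO (regretBound P σ ζ ξ) fun T => Real.sqrt (T * maxInfoGain P σ T) := by
  obtain ⟨x, hx⟩ := hne
  have hxx : 0 < k x x := lt_of_le_of_ne (hP.self_nonneg x) hx.symm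
  obtain ⟨q, hq⟩ := hζ
  obtain ⟨c, hc⟩ := hq.bound
  obtain ⟨c', hc'⟩ := hξ.bound
  set L := Real.log (1 + ((σ : ℝ) ^ 2)⁻¹) with hL
  have hLpos : 0 < L := log_one_add_inv_pos hσ
  set m := Real.log (1 + ((σ : ℝ) ^ 2)⁻¹ * k x x) / 2 with hm
  have hmpos : 0 < m := half_pos (Real.log_pos (lt_add_of_pos_right 1 (by positivity)))
  refine ⟨q, IsBigO.of_bound (Real.sqrt (2 / L * |c|) + |c'| / Real.sqrt m) ?_⟩
  filter_upwards [hc, hc', eventually_ge_atTop 3] with T h1 h2 h3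
  have hlog : 1 ≤ Real.log T := by
    rw [Real.le_log_iff_exp_le (by positivity)]
    have : (3 : ℝ) ≤ T := by exact_mod_cast h3
    linarith [Real.exp_one_lt_three]
  have hlogq : 1 ≤ Real.log T ^ q := one_le_pow₀ hlog
  have hγ : m ≤ maxInfoGain P σ T := log_le_maxInfoGain hP hk hσ x (by omega)
  set γ := maxInfoGain P σ T
  have hγ0 : 0 ≤ γ := hmpos.le.trans hγ
  have hT1 : (1 : ℝ) ≤ T := by exact_mod_cast (by omega : 1 ≤ T)
  simp only [Real.norm_eq_abs, abs_one, mul_one] at h1 h2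
  rw [abs_mul, abs_of_pos (by positivity : (0 : ℝ) < T),
    abs_of_pos (by linarith : 0 < Real.log T ^ q)] at h1
  have hS : ∑ t ∈ Finset.range T, ζ t ≤ |c| * (T * Real.log T ^ q) :=
    (le_abs_self _).trans (h1.trans (mul_le_mul_of_nonneg_right (le_abs_self c) (by positivity)))
  have hfirst : Real.sqrt (2 / L * γ * ∑ t ∈ Finset.range T, ζ t)
      ≤ Real.sqrt (2 / L * |c|) * (Real.sqrt (T * γ) * Real.log T ^ q) := by
    rw [← Real.sqrt_sq (by positivity : 0 ≤ Real.log T ^ q), ← Real.sqrt_mul (by positivity),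
      ← Real.sqrt_mul (by positivity)]
    refine Real.sqrt_le_sqrt ?_
    calc 2 / L * γ * ∑ t ∈ Finset.range T, ζ t
        ≤ 2 / L * γ * (|c| * (T * Real.log T ^ q)) := by gcongr
      _ = 2 / L * |c| * (T * γ * Real.log T ^ q) := by ring
      _ ≤ 2 / L * |c| * (T * γ * (Real.log T ^ q) ^ 2) := by
        gcongr
        exact le_self_pow₀ hlogq two_ne_zero
  have hsecond : |∑ t ∈ Finset.range T, ξ t|
      ≤ |c'| / Real.sqrt m * (Real.sqrt (T * γ) * Real.log T ^ q) := by
    refine (h2.trans (le_abs_self c')).trans ?_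
    have hsm : 0 < Real.sqrt m := Real.sqrt_pos.2 hmpos
    rw [div_mul_eq_mul_div, le_div_iff₀ hsm]
    gcongr
    calc Real.sqrt m ≤ Real.sqrt (T * γ) := Real.sqrt_le_sqrt (hγ.trans
          (le_mul_of_one_le_left hγ0 hT1))
      _ ≤ Real.sqrt (T * γ) * Real.log T ^ q := le_mul_of_one_le_right (Real.sqrt_nonneg _) hlogq
  rw [Real.norm_eq_abs, Real.norm_eq_abs, abs_of_nonneg (by positivity : 0 ≤ Real.sqrt (T * γ)
    * Real.log T ^ q), add_mul]
  refine (abs_add_le _ _).trans (add_le_add ?_ hsecond)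
  rw [abs_of_nonneg (Real.sqrt_nonneg _)]
  exact hfirst

end InformationGain

/-! ### The observable history of a run -/

section History

variable {X S W : Type*} [MetricSpace X] [CompactSpace X] [MeasurableSpace X] [BorelSpace X]
  [MeasurableSpace S] [MeasurableSpace W] {P : Measure C(X, ℝ)} [IsProbabilityMeasure P]
  {σ : ℝ≥0} {ν : Measure S} [IsProbabilityMeasure ν]

/-- What can be seen at the beginning of a round: the exogenous randomness, the indices of the
available observations, the queries and the available observations. Queries and observations are
stored as infinite sequences, padded with a fixed point and with `0`. -/
abbrev History (X W : Type*) : Type _ := W × (Finset ℕ × ((ℕ → X) × (ℕ → ℝ)))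

/-- The posterior law of the path given the available observations. -/
noncomputable def historyPosterior (P : Measure C(X, ℝ)) [IsProbabilityMeasure P] (σ : ℝ≥0) :
    Kernel (History X W) C(X, ℝ) :=
  ⟨fun h => posteriorOn P σ h.2.1 h.2.2.1 h.2.2.2, measurable_posteriorOn.comp measurable_snd⟩

lemma historyPosterior_apply (h : History X W) :
    historyPosterior P σ h = posteriorOn P σ h.2.1 h.2.2.1 h.2.2.2 := rfl

instance : IsMarkovKernel (historyPosterior P σ : Kernel (History X W) C(X, ℝ)) :=
  ⟨fun h => inferInstanceAs (IsProbabilityMeasure (posteriorOn P σ h.2.1 h.2.2.1 h.2.2.2))⟩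

/-- The law of a posterior path together with independent noise. -/
noncomputable def historyModel (P : Measure C(X, ℝ)) [IsProbabilityMeasure P] (σ : ℝ≥0) :
    Kernel (History X W) (C(X, ℝ) × (ℕ → ℝ)) :=
  historyPosterior P σ ×ₖ Kernel.const _ (noiseLaw σ)

instance : IsMarkovKernel (historyModel P σ : Kernel (History X W) _) := by
  unfold historyModel
  infer_instance

lemma historyModel_apply (h : History X W) :
    historyModel P σ h = (posteriorOn P σ h.2.1 h.2.2.1 h.2.2.2).prod (noiseLaw σ) := by
  rw [historyModel, Kernel.prod_apply, Kernel.const_apply, historyPosterior_apply]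

/-- The law of the randomness drawn in a round: a posterior path, imputation noise and a seed. -/
noncomputable def historyDraw (P : Measure C(X, ℝ)) [IsProbabilityMeasure P] (σ : ℝ≥0)
    (ν : Measure S) : Kernel (History X W) (C(X, ℝ) × ((ℕ → ℝ) × S)) :=
  historyPosterior P σ ×ₖ Kernel.const _ ((noiseLaw σ).prod ν)

instance : IsMarkovKernel (historyDraw P σ ν : Kernel (History X W) _) := by
  unfold historyDraw
  infer_instance

lemma historyDraw_apply (h : History X W) :
    historyDraw P σ ν h
      = (posteriorOn P σ h.2.1 h.2.2.1 h.2.2.2).prod ((noiseLaw σ).prod ν) := by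
  rw [historyDraw, Kernel.prod_apply, Kernel.const_apply, historyPosterior_apply]

/-- The data set of the first `n` input-output pairs. -/
def toDataset (n : ℕ) (x : ℕ → X) (y : ℕ → ℝ) : Dataset X n := fun i => (x i, y i)

/-- The data set obtained from a history by filling in the missing observations with noisy values
of the path `φ`. -/
def completedData (t : ℕ) (h : History X W) (φ : C(X, ℝ)) (η : ℕ → ℝ) : Dataset X t :=
  toDataset t h.2.2.1 (reveal (Finset.range t \ h.2.1) h.2.2.1 h.2.2.2 φ η)

lemma measurable_completedData (t : ℕ) :
    Measurable fun q : History X W × (C(X, ℝ) × (ℕ → ℝ)) => completedData t q.1 q.2.1 q.2.2 := by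
  have hr := measurable_reveal.comp (f := fun q : History X W × (C(X, ℝ) × (ℕ → ℝ)) =>
    (((Finset.range t \ q.1.2.1, (q.1.2.2.1, q.1.2.2.2)), q.2) :
      (Finset ℕ × ((ℕ → X) × (ℕ → ℝ))) × (C(X, ℝ) × (ℕ → ℝ)))) (by
    have h : Measurable fun N : Finset ℕ => Finset.range t \ N := .of_discrete
    have h' := h.comp (f := fun q : History X W × (C(X, ℝ) × (ℕ → ℝ)) => q.1.2.1) (by fun_prop)
    exact (h'.prodMk (by fun_prop)).prodMk (by fun_prop))
  exact measurable_pi_lambda _ fun i => Measurable.prodMk (by fun_prop)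
    ((measurable_pi_apply (i : ℕ)).comp hr)

/-- The query of the base algorithm after the history `h`, with randomness `d`. -/
def nextQuery (A : ∀ t : ℕ, Dataset X t → S → X) (t : ℕ) (h : History X W)
    (d : C(X, ℝ) × ((ℕ → ℝ) × S)) : X :=
  A t (completedData t h d.1 d.2.1) d.2.2

lemma measurable_nextQuery {A : ∀ t : ℕ, Dataset X t → S → X}
    (hA : ∀ t, Measurable fun q : Dataset X t × S => A t q.1 q.2) (t : ℕ) :
    Measurable fun q : History X W × (C(X, ℝ) × ((ℕ → ℝ) × S)) => nextQuery A t q.1 q.2 :=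
  (hA t).comp (((measurable_completedData t).comp
    (f := fun q : History X W × (C(X, ℝ) × ((ℕ → ℝ) × S)) => (q.1, (q.2.1, q.2.2.1)))
    (by fun_prop)).prodMk (by fun_prop))

/-- The queries including the one of round `t`. -/
def nextInputs (A : ∀ t : ℕ, Dataset X t → S → X) (t : ℕ) (h : History X W)
    (d : C(X, ℝ) × ((ℕ → ℝ) × S)) : ℕ → X :=
  fun i => if i = t then nextQuery A t h d else h.2.2.1 i

lemma measurable_nextInputs {A : ∀ t : ℕ, Dataset X t → S → X}
    (hA : ∀ t, Measurable fun q : Dataset X t × S => A t q.1 q.2) (t : ℕ) :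
    Measurable fun q : History X W × (C(X, ℝ) × ((ℕ → ℝ) × S)) => nextInputs A t q.1 q.2 := by
  refine measurable_pi_lambda _ fun i => ?_
  unfold nextInputs
  split_ifs
  · exact measurable_nextQuery hA t
  · fun_prop

/-- The indices of the observations available after round `t`. -/
def nextAvailable (A : ∀ t : ℕ, Dataset X t → S → X) (t : ℕ)
    (sched : W × ((Fin (t + 1) → X) × (Fin (t + 1) → ℝ)) → Finset ℕ) (h : History X W)
    (d : C(X, ℝ) × ((ℕ → ℝ) × S)) : Finset ℕ :=
  h.2.1 ∪ sched (h.1, (fun i => nextInputs A t h d i, fun i => h.2.2.2 i))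

lemma measurable_nextAvailable {A : ∀ t : ℕ, Dataset X t → S → X}
    (hA : ∀ t, Measurable fun q : Dataset X t × S => A t q.1 q.2) (t : ℕ)
    {sched : W × ((Fin (t + 1) → X) × (Fin (t + 1) → ℝ)) → Finset ℕ} (hs : Measurable sched) :
    Measurable fun q : History X W × (C(X, ℝ) × ((ℕ → ℝ) × S)) =>
      nextAvailable A t sched q.1 q.2 := by
  have hx := measurable_nextInputs (W := W) hA t
  have hu : Measurable fun q : Finset ℕ × Finset ℕ => q.1 ∪ q.2 := .of_discrete
  have hin : Measurable fun q : History X W × (C(X, ℝ) × ((ℕ → ℝ) × S)) =>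
      (fun i : Fin (t + 1) => nextInputs A t q.1 q.2 i) :=
    measurable_pi_lambda _ fun i => (measurable_pi_apply (i : ℕ)).comp hx
  have hs' := hs.comp (f := fun q : History X W × (C(X, ℝ) × ((ℕ → ℝ) × S)) =>
    (q.1.1, ((fun i : Fin (t + 1) => nextInputs A t q.1 q.2 i), fun i : Fin (t + 1) =>
      q.1.2.2.2 i))) (Measurable.prodMk (by fun_prop) (hin.prodMk (by fun_prop)))
  exact hu.comp (Measurable.prodMk (by fun_prop) hs')

/-- The history after round `t`, if the objective function is `φ` and the noise is `z`. -/
def nextHistory (A : ∀ t : ℕ, Dataset X t → S → X) (t : ℕ)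
    (sched : W × ((Fin (t + 1) → X) × (Fin (t + 1) → ℝ)) → Finset ℕ) (h : History X W)
    (d : C(X, ℝ) × ((ℕ → ℝ) × S)) (φ : C(X, ℝ)) (z : ℕ → ℝ) : History X W :=
  (h.1, (nextAvailable A t sched h d, (nextInputs A t h d,
    reveal (nextAvailable A t sched h d \ h.2.1) (nextInputs A t h d) h.2.2.2 φ z)))

lemma measurable_nextHistory {A : ∀ t : ℕ, Dataset X t → S → X}
    (hA : ∀ t, Measurable fun q : Dataset X t × S => A t q.1 q.2) (t : ℕ)
    {sched : W × ((Fin (t + 1) → X) × (Fin (t + 1) → ℝ)) → Finset ℕ} (hs : Measurable sched) :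
    Measurable fun q : (History X W × (C(X, ℝ) × (ℕ → ℝ))) × (C(X, ℝ) × ((ℕ → ℝ) × S)) =>
      nextHistory A t sched q.1.1 q.2 q.1.2.1 q.1.2.2 := by
  have hx := (measurable_nextInputs (W := W) hA t).comp
    (f := fun q : (History X W × (C(X, ℝ) × (ℕ → ℝ))) × (C(X, ℝ) × ((ℕ → ℝ) × S)) =>
      (q.1.1, q.2)) (by fun_prop)
  have hN := (measurable_nextAvailable (W := W) hA t hs).comp
    (f := fun q : (History X W × (C(X, ℝ) × (ℕ → ℝ))) × (C(X, ℝ) × ((ℕ → ℝ) × S)) =>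
      (q.1.1, q.2)) (by fun_prop)
  have hd : Measurable fun q : Finset ℕ × Finset ℕ => q.1 \ q.2 := .of_discrete
  have hdiff := hd.comp (hN.prodMk (g := fun q : (History X W × (C(X, ℝ) × (ℕ → ℝ))) ×
    (C(X, ℝ) × ((ℕ → ℝ) × S)) => q.1.1.2.1) (by fun_prop))
  have hr := measurable_reveal.comp ((hdiff.prodMk (hx.prodMk
    (g := fun q : (History X W × (C(X, ℝ) × (ℕ → ℝ))) × (C(X, ℝ) × ((ℕ → ℝ) × S)) =>
      q.1.1.2.2.2) (by fun_prop))).prodMk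
    (g := fun q : (History X W × (C(X, ℝ) × (ℕ → ℝ))) × (C(X, ℝ) × ((ℕ → ℝ) × S)) => q.1.2)
    (by fun_prop))
  exact Measurable.prodMk (by fun_prop) (hN.prodMk (hx.prodMk hr))

end History

section Run

variable {Ω X S W : Type*} [MetricSpace X] [CompactSpace X] [MeasurableSpace X] [BorelSpace X]
  [MeasurableSpace Ω] [MeasurableSpace S] [MeasurableSpace W] {P : Measure C(X, ℝ)}
  [IsProbabilityMeasure P] {σ : ℝ≥0} {ν : Measure S} [IsProbabilityMeasure ν]
  {A : ∀ t : ℕ, Dataset X t → S → X} {μΩ : Measure Ω} [IsProbabilityMeasure μΩ]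
  {R : ParallelRun Ω X S W}

namespace ParallelRun

/-- The history of a run at the beginning of round `t`. -/
def history (R : ParallelRun Ω X S W) (x₀ : X) (t : ℕ) (ω : Ω) : History X W :=
  (R.w ω, (R.N t ω, (fun i => if i < t then R.x i ω else x₀,
    keepOn (R.N t ω) fun i => R.y i ω)))

/-- The objective function and the noise of the observations not yet available. -/
def hidden (R : ParallelRun Ω X S W) (t : ℕ) (ω : Ω) : C(X, ℝ) × (ℕ → ℝ) :=
  (R.f ω, eraseOn (R.N t ω) fun i => R.ε i ω)

end ParallelRun

lemma imputedData_eq (x₀ : X) (t : ℕ) (ω : Ω) :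
    R.imputedData t ω = completedData t (R.history x₀ t ω) (R.g t ω) (R.η t ω) := by
  ext i
  · simp [ParallelRun.imputedData, completedData, toDataset, ParallelRun.history]
  · by_cases hi : (i : ℕ) ∈ R.N t ω <;>
    simp [ParallelRun.imputedData, completedData, toDataset, ParallelRun.history, reveal, keepOn,
      hi]

lemma data_eq (x₀ : X) (t : ℕ) (ω : Ω) :
    R.data t ω
      = completedData t (R.history x₀ t ω) (R.hidden t ω).1 (R.hidden t ω).2 := by
  ext i
  · simp [ParallelRun.data, completedData, toDataset, ParallelRun.history]
  · by_cases hi : (i : ℕ) ∈ R.N t ω <;>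
    simp [ParallelRun.data, completedData, toDataset, ParallelRun.history, reveal, keepOn,
      ParallelRun.hidden, eraseOn, ParallelRun.y, hi]

namespace IsRandomizedKrigingBeliever

lemma query_eq_nextQuery (hR : IsRandomizedKrigingBeliever P σ ν A μΩ R) (x₀ : X) (t : ℕ) (ω : Ω) :
    R.x t ω = nextQuery A t (R.history x₀ t ω) (R.draw t ω) := by
  rw [hR.query_eq, imputedData_eq x₀]
  rfl

lemma nextInputs_history (hR : IsRandomizedKrigingBeliever P σ ν A μΩ R) (x₀ : X) (t : ℕ) (ω : Ω) :
    nextInputs A t (R.history x₀ t ω) (R.draw t ω)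
      = fun i => if i < t + 1 then R.x i ω else x₀ := by
  ext i
  rw [nextInputs, ← hR.query_eq_nextQuery]
  rcases lt_trichotomy i t with h | rfl | h
  · simp [ParallelRun.history, h, h.ne, h.trans (Nat.lt_succ_self t)]
  · simp
  · simp [ParallelRun.history, h.ne', h.not_gt, show ¬ i < t + 1 by omega]

/-- The history evolves as a function of the randomness drawn in each round, of the objective
function and of the noise not yet observed. -/
lemma history_succ (hR : IsRandomizedKrigingBeliever P σ ν A μΩ R) (x₀ : X) (t : ℕ) :
    ∃ sched : W × ((Fin (t + 1) → X) × (Fin (t + 1) → ℝ)) → Finset ℕ, Measurable sched ∧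
      ∀ ω, R.history x₀ (t + 1) ω = nextHistory A t sched (R.history x₀ t ω) (R.draw t ω)
        (R.hidden t ω).1 (R.hidden t ω).2 := by
  obtain ⟨sched, hm, hs⟩ := hR.available_eq t
  refine ⟨sched, hm, fun ω => ?_⟩
  have hx := hR.nextInputs_history x₀ t ω
  have hN : nextAvailable A t sched (R.history x₀ t ω) (R.draw t ω) = R.N (t + 1) ω := by
    have e : sched ((R.history x₀ t ω).1, (fun i : Fin (t + 1) => nextInputs A t
        (R.history x₀ t ω) (R.draw t ω) i, fun i : Fin (t + 1) => (R.history x₀ t ω).2.2.2 i))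
        = R.N (t + 1) ω := by
      rw [hs ω, hx]
      simp only [ParallelRun.history, keepOn, Fin.is_lt, if_true]
    rw [nextAvailable, e]
    exact Finset.union_eq_right.2 (hR.available_mono t ω)
  rw [nextHistory, hN, hx]
  simp only [ParallelRun.history, Prod.mk.injEq, true_and]
  ext i
  have h1 := @hR.available_mono t ω
  have h2 := @hR.available_subset (t + 1) ω
  by_cases hi : i ∈ R.N t ω
  · simp [reveal, keepOn, hi, h1 hi]
  · by_cases hi' : i ∈ R.N (t + 1) ω
    · have := Finset.mem_range.1 (h2 hi')
      simp [reveal, keepOn, hi, hi', this, ParallelRun.hidden, eraseOn, ParallelRun.y]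
    · simp [reveal, keepOn, hi, hi']

lemma hidden_succ (hR : IsRandomizedKrigingBeliever P σ ν A μΩ R) (t : ℕ) (ω : Ω) :
    R.hidden (t + 1) ω = ((R.hidden t ω).1, eraseOn (R.N (t + 1) ω) (R.hidden t ω).2) := by
  ext i
  · rfl
  · have h1 := @hR.available_mono t ω i
    by_cases hi' : i ∈ R.N (t + 1) ω
    · simp [ParallelRun.hidden, eraseOn, hi']
    · have hi : i ∉ R.N t ω := fun h => hi' (h1 h)
      simp [ParallelRun.hidden, eraseOn, hi, hi']

lemma available_zero (hR : IsRandomizedKrigingBeliever P σ ν A μΩ R) (ω : Ω) : R.N 0 ω = ∅ :=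
  Finset.subset_empty.1 (hR.available_subset 0 ω)

lemma history_zero (hR : IsRandomizedKrigingBeliever P σ ν A μΩ R) (x₀ : X) (ω : Ω) :
    R.history x₀ 0 ω = (R.w ω, (∅, (fun _ => x₀, fun _ => 0))) := by
  simp only [ParallelRun.history, hR.available_zero, Nat.not_lt_zero, if_false, Prod.mk.injEq,
    true_and]
  exact funext fun i => if_neg (Finset.notMem_empty i)

/-- The history at the beginning of a round is a function of the randomness of the past. -/
lemma exists_history_eq (hR : IsRandomizedKrigingBeliever P σ ν A μΩ R)
    (hA : ∀ t, Measurable fun q : Dataset X t × S => A t q.1 q.2) (x₀ : X) (t : ℕ) :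
    ∃ Φ : (C(X, ℝ) × ((ℕ → ℝ) × W)) × (Fin t → C(X, ℝ) × ((ℕ → ℝ) × S)) → History X W,
      Measurable Φ ∧ ∀ ω, R.history x₀ t ω = Φ (R.past t ω) := by
  induction t with
  | zero =>
    refine ⟨fun p => (p.1.2.2, (∅, (fun _ => x₀, fun _ => 0))), by fun_prop, fun ω => ?_⟩
    rw [hR.history_zero]
    rfl
  | succ t ih =>
    obtain ⟨Φ, hΦ, h⟩ := ih
    obtain ⟨sched, hm, hs⟩ := hR.history_succ x₀ t
    have hprev : Measurable fun p : (C(X, ℝ) × ((ℕ → ℝ) × W)) ×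
        (Fin (t + 1) → C(X, ℝ) × ((ℕ → ℝ) × S)) => Φ (p.1, fun i => p.2 i.castSucc) :=
      hΦ.comp (by fun_prop)
    have her := measurable_eraseOn.comp (f := fun p : (C(X, ℝ) × ((ℕ → ℝ) × W)) ×
        (Fin (t + 1) → C(X, ℝ) × ((ℕ → ℝ) × S)) =>
          ((Φ (p.1, fun i => p.2 i.castSucc)).2.1, p.1.2.1)) (by fun_prop)
    refine ⟨_, (measurable_nextHistory hA t hm).comp (f := fun p : (C(X, ℝ) × ((ℕ → ℝ) × W)) ×
      (Fin (t + 1) → C(X, ℝ) × ((ℕ → ℝ) × S)) => ((Φ (p.1, fun i => p.2 i.castSucc), (p.1.1,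
        eraseOn (Φ (p.1, fun i => p.2 i.castSucc)).2.1 p.1.2.1)), p.2 (Fin.last t)))
      ((hprev.prodMk (Measurable.prodMk (by fun_prop) her)).prodMk (by fun_prop)), fun ω => ?_⟩
    have e : R.history x₀ t ω = Φ ((R.past (t + 1) ω).1, fun i => (R.past (t + 1) ω).2 i.castSucc) :=
      h ω
    rw [hs ω]
    simp only [Function.comp_apply]
    rw [← e]
    rfl

lemma measurable_past (hR : IsRandomizedKrigingBeliever P σ ν A μΩ R) (t : ℕ) :
    Measurable (R.past t) := by
  have h1 := hR.measurable_f
  have h2 := hR.measurable_w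
  have h3 : Measurable fun ω i => R.ε i ω := measurable_pi_lambda _ hR.measurable_ε
  exact (h1.prodMk (h3.prodMk h2)).prodMk (measurable_pi_lambda _ fun i =>
    (hR.measurable_g i).prodMk ((hR.measurable_η i).prodMk (hR.measurable_s i)))

lemma measurable_draw (hR : IsRandomizedKrigingBeliever P σ ν A μΩ R) (t : ℕ) :
    Measurable (R.draw t) :=
  (hR.measurable_g t).prodMk ((hR.measurable_η t).prodMk (hR.measurable_s t))

lemma measurable_history (hR : IsRandomizedKrigingBeliever P σ ν A μΩ R)
    (hA : ∀ t, Measurable fun q : Dataset X t × S => A t q.1 q.2) (x₀ : X) (t : ℕ) :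
    Measurable (R.history x₀ t) := by
  obtain ⟨Φ, hΦ, h⟩ := hR.exists_history_eq hA x₀ t
  rw [show R.history x₀ t = Φ ∘ R.past t from funext h]
  exact hΦ.comp (hR.measurable_past t)

lemma measurable_hidden (hR : IsRandomizedKrigingBeliever P σ ν A μΩ R)
    (hA : ∀ t, Measurable fun q : Dataset X t × S => A t q.1 q.2) (x₀ : X) (t : ℕ) :
    Measurable (R.hidden t) := by
  have h := hR.measurable_history hA x₀ t
  have h3 : Measurable fun ω i => R.ε i ω := measurable_pi_lambda _ hR.measurable_ε
  exact hR.measurable_f.prodMk (measurable_eraseOn.comp (h.snd.fst.prodMk h3))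

lemma measurable_data (hR : IsRandomizedKrigingBeliever P σ ν A μΩ R)
    (hA : ∀ t, Measurable fun q : Dataset X t × S => A t q.1 q.2) (x₀ : X) (t : ℕ) :
    Measurable (R.data t) := by
  rw [show R.data t = _ from funext (data_eq x₀ t)]
  exact (measurable_completedData t).comp
    ((hR.measurable_history hA x₀ t).prodMk (hR.measurable_hidden hA x₀ t))

lemma measurable_imputedData (hR : IsRandomizedKrigingBeliever P σ ν A μΩ R)
    (hA : ∀ t, Measurable fun q : Dataset X t × S => A t q.1 q.2) (x₀ : X) (t : ℕ) :
    Measurable (R.imputedData t) := by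
  rw [show R.imputedData t = _ from funext (imputedData_eq x₀ t)]
  exact (measurable_completedData t).comp ((hR.measurable_history hA x₀ t).prodMk
    ((hR.measurable_g t).prodMk (hR.measurable_η t)))

end IsRandomizedKrigingBeliever

end Run

/-! ### Posterior sampling along a run -/

section Bayes

variable {X S W : Type*} [MetricSpace X] [CompactSpace X] [MeasurableSpace X] [BorelSpace X]
  [MeasurableSpace S] [MeasurableSpace W] {P : Measure C(X, ℝ)} [IsProbabilityMeasure P]
  {σ : ℝ≥0} {ν : Measure S} [IsProbabilityMeasure ν]

lemma posteriorOn_congr {N : Finset ℕ} {x x' : ℕ → X} {y y' : ℕ → ℝ}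
    (hx : ∀ i ∈ N, x i = x' i) (hy : ∀ i ∈ N, y i = y' i) :
    posteriorOn P σ N x y = posteriorOn P σ N x' y' := by
  unfold posteriorOn
  congr 1
  ext i
  · rw [hx i i.2]
  · rw [hy i i.2]

lemma reveal_congr {J : Finset ℕ} {x : ℕ → X} {y : ℕ → ℝ} {φ : C(X, ℝ)} {z z' : ℕ → ℝ}
    (h : ∀ i ∈ J, z i = z' i) : reveal J x y φ z = reveal J x y φ z' := by
  ext i
  by_cases hi : i ∈ J
  · simp [reveal, hi, h i hi]
  · simp [reveal, hi]

lemma eraseOn_eraseOn {N N' : Finset ℕ} (h : N ⊆ N') (z : ℕ → ℝ) :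
    eraseOn N' (eraseOn N z) = eraseOn N' z := by
  ext i
  by_cases hi : i ∈ N'
  · simp [eraseOn, hi]
  · have : i ∉ N := fun h' => hi (h h')
    simp [eraseOn, hi, this]

lemma reveal_eraseOn {N N' : Finset ℕ} (x : ℕ → X) (y : ℕ → ℝ) (φ : C(X, ℝ)) (z : ℕ → ℝ) :
    reveal (N' \ N) x y φ (eraseOn N z) = reveal (N' \ N) x y φ z :=
  reveal_congr fun i hi => by simp [eraseOn, (Finset.mem_sdiff.1 hi).2]

/-- The form of Bayes' formula used along a run: after new observations are revealed, path and
remaining noise are distributed according to the new posterior. -/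
lemma lintegral_bayes_prod (hσ : 0 < σ) {N N' : Finset ℕ} (hN : N ⊆ N') (x : ℕ → X) (y : ℕ → ℝ)
    {G : (ℕ → ℝ) × (C(X, ℝ) × (ℕ → ℝ)) → ℝ≥0∞} (hG : Measurable G) :
    ∫⁻ q, G (reveal (N' \ N) x y q.1 q.2, (q.1, eraseOn N' q.2))
        ∂((posteriorOn P σ N x y).prod (noiseLaw σ))
      = ∫⁻ q, ∫⁻ q', G (reveal (N' \ N) x y q.1 q.2, (q'.1, eraseOn N' q'.2))
          ∂((posteriorOn P σ N' x (reveal (N' \ N) x y q.1 q.2)).prod (noiseLaw σ))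
          ∂((posteriorOn P σ N x y).prod (noiseLaw σ)) := by
  have he := measurable_eraseOn_right N'
  have hr : Measurable fun q : C(X, ℝ) × (ℕ → ℝ) => reveal (N' \ N) x y q.1 q.2 :=
    measurable_reveal.comp (f := fun q : C(X, ℝ) × (ℕ → ℝ) => ((N' \ N, (x, y)), q)) (by fun_prop)
  have hin : ∀ q : C(X, ℝ) × (ℕ → ℝ), ∫⁻ q', G (reveal (N' \ N) x y q.1 q.2, (q'.1, eraseOn N' q'.2))
        ∂((posteriorOn P σ N' x (reveal (N' \ N) x y q.1 q.2)).prod (noiseLaw σ))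
      = ∫⁻ φ', ∫⁻ η', G (reveal (N' \ N) x y q.1 q.2, (φ', eraseOn N' η')) ∂(noiseLaw σ)
          ∂(posteriorOn P σ N' x (reveal (N' \ N) x y q.1 q.2)) := fun q =>
    lintegral_prod (fun q' => G (reveal (N' \ N) x y q.1 q.2, (q'.1, eraseOn N' q'.2)))
      (by fun_prop)
  simp_rw [hin]
  have hpost : Measurable fun q : C(X, ℝ) × (ℕ → ℝ) =>
      posteriorOn P σ N' x (reveal (N' \ N) x y q.1 q.2) :=
    measurable_posteriorOn.comp (f := fun q : C(X, ℝ) × (ℕ → ℝ) =>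
      (N', (x, reveal (N' \ N) x y q.1 q.2))) (by fun_prop)
  have hm1 : Measurable fun q : C(X, ℝ) × (ℕ → ℝ) =>
      G (reveal (N' \ N) x y q.1 q.2, (q.1, eraseOn N' q.2)) := by fun_prop
  have hm0 : Measurable fun r : (C(X, ℝ) × (ℕ → ℝ)) × C(X, ℝ) => ∫⁻ η',
      G (reveal (N' \ N) x y r.1.1 r.1.2, (r.2, eraseOn N' η')) ∂(noiseLaw σ) :=
    Measurable.lintegral_prod_right' (f := fun r : ((C(X, ℝ) × (ℕ → ℝ)) × C(X, ℝ)) × (ℕ → ℝ) =>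
      G (reveal (N' \ N) x y r.1.1.1 r.1.1.2, (r.1.2, eraseOn N' r.2))) (by fun_prop)
  have hm2 := measurable_lintegral_of_measurable hpost hm0
  rw [lintegral_prod _ hm1.aemeasurable, lintegral_prod _ hm2.aemeasurable]
  exact lintegral_bayes hσ hN x y hG

end Bayes

namespace IsRandomizedKrigingBeliever

variable {Ω X S W : Type*} [MetricSpace X] [CompactSpace X] [MeasurableSpace X] [BorelSpace X]
  [MeasurableSpace Ω] [MeasurableSpace S] [MeasurableSpace W] {P : Measure C(X, ℝ)}
  [IsProbabilityMeasure P] {σ : ℝ≥0} {ν : Measure S} [IsProbabilityMeasure ν]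
  {A : ∀ t : ℕ, Dataset X t → S → X} {μΩ : Measure Ω} [IsProbabilityMeasure μΩ]
  {R : ParallelRun Ω X S W}

lemma posterior_history (hR : IsRandomizedKrigingBeliever P σ ν A μΩ R) (x₀ : X) (t : ℕ) (ω : Ω) :
    historyPosterior P σ (R.history x₀ t ω) = gpPosterior P σ (R.availableData t ω) := by
  change posteriorOn P σ (R.N t ω) _ _
    = posteriorOn P σ (R.N t ω) (fun i => R.x i ω) (fun i => R.y i ω)
  refine posteriorOn_congr (fun i hi => ?_) fun i hi => ?_
  · have hi' := Finset.mem_range.1 (hR.available_subset t ω hi)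
    simp [ParallelRun.history, hi']
  · simp [ParallelRun.history, keepOn, hi]

/-- The randomness drawn in a round is independent of the hidden quantities given the history. -/
lemma lintegral_draw (hR : IsRandomizedKrigingBeliever P σ ν A μΩ R)
    (hA : ∀ t, Measurable fun q : Dataset X t × S => A t q.1 q.2) (x₀ : X) (t : ℕ)
    {G : (History X W × (C(X, ℝ) × (ℕ → ℝ))) × (C(X, ℝ) × ((ℕ → ℝ) × S)) → ℝ≥0∞}
    (hG : Measurable G) :
    ∫⁻ ω, G ((R.history x₀ t ω, R.hidden t ω), R.draw t ω) ∂μΩ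
      = ∫⁻ ω, ∫⁻ d, G ((R.history x₀ t ω, R.hidden t ω), d)
          ∂(historyDraw P σ ν (R.history x₀ t ω)) ∂μΩ := by
  have hh := hR.measurable_history hA x₀ t
  have hz := hR.measurable_hidden hA x₀ t
  have hd := hR.measurable_draw t
  obtain ⟨Φ, hΦ, hΦe⟩ := hR.exists_history_eq hA x₀ t
  let π : (C(X, ℝ) × ((ℕ → ℝ) × W)) × (Fin t → C(X, ℝ) × ((ℕ → ℝ) × S)) →
      History X W × (C(X, ℝ) × (ℕ → ℝ)) := fun p => (Φ p, (p.1.1, eraseOn (Φ p).2.1 p.1.2.1))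
  have hπ : Measurable π := hΦ.prodMk (Measurable.prodMk (by fun_prop)
    (measurable_eraseOn.comp (hΦ.snd.fst.prodMk (by fun_prop))))
  have hπe : (fun ω => (R.history x₀ t ω, R.hidden t ω)) = π ∘ R.past t := by
    funext ω
    simp only [Function.comp_apply, π, ← hΦe]
    rfl
  have hpair : Measurable fun ω => (R.history x₀ t ω, R.hidden t ω) := hh.prodMk hz
  let K : Kernel (History X W × (C(X, ℝ) × (ℕ → ℝ))) (C(X, ℝ) × ((ℕ → ℝ) × S)) :=
    (historyDraw P σ ν).comap Prod.fst measurable_fst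
  have : IsProbabilityMeasure (μΩ.map fun ω => (R.history x₀ t ω, R.hidden t ω)) :=
    Measure.isProbabilityMeasure_map hpair.aemeasurable
  have : IsProbabilityMeasure (μΩ.map fun ω => ((R.history x₀ t ω, R.hidden t ω), R.draw t ω)) :=
    Measure.isProbabilityMeasure_map (hpair.prodMk hd).aemeasurable
  have key : μΩ.map (fun ω => ((R.history x₀ t ω, R.hidden t ω), R.draw t ω))
      = (μΩ.map fun ω => (R.history x₀ t ω, R.hidden t ω)) ⊗ₘ K := by
    refine Measure.ext_prod fun {B C} hB hC => ?_
    rw [Measure.map_apply (hpair.prodMk hd) (hB.prod hC), Measure.compProd_apply_prod hB hC,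
      setLIntegral_map hB (Kernel.measurable_coe K hC) hpair]
    have e := hR.law_draw t (π ⁻¹' B) C (hπ hB) hC
    have e1 : (fun ω => (R.history x₀ t ω, R.hidden t ω)) ⁻¹' B = R.past t ⁻¹' (π ⁻¹' B) := by
      rw [hπe]
      rfl
    rw [e1, ← show (fun ω => (R.history x₀ t ω, R.hidden t ω)) ⁻¹' B ∩ R.draw t ⁻¹' C
      = (fun ω => ((R.history x₀ t ω, R.hidden t ω), R.draw t ω)) ⁻¹' (B ×ˢ C) from rfl, e1, e]
    refine lintegral_congr fun ω => ?_
    rw [← hR.posterior_history x₀]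
    change _ = historyDraw P σ ν (R.history x₀ t ω) C
    rw [historyDraw_apply, historyPosterior_apply]
  rw [← lintegral_map hG (hpair.prodMk hd), key, Measure.lintegral_compProd hG,
    lintegral_map hG.lintegral_kernel_prod_right' hpair]
  rfl

/-- Given the history, the objective function is a posterior path, and the noise of the observations
not yet available is still independent of it. The noise of the available observations is determined
by history and path, so it is erased to `0` on both sides. -/
def HiddenLaw (P : Measure C(X, ℝ)) [IsProbabilityMeasure P] (σ : ℝ≥0) (μΩ : Measure Ω)
    (R : ParallelRun Ω X S W) (x₀ : X) (t : ℕ) : Prop :=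
  ∀ F : History X W × (C(X, ℝ) × (ℕ → ℝ)) → ℝ≥0∞, Measurable F →
    ∫⁻ ω, F (R.history x₀ t ω, R.hidden t ω) ∂μΩ
      = ∫⁻ ω, ∫⁻ q, F (R.history x₀ t ω, (q.1, eraseOn (R.N t ω) q.2))
          ∂(historyModel P σ (R.history x₀ t ω)) ∂μΩ

lemma hiddenLaw_zero (hR : IsRandomizedKrigingBeliever P σ ν A μΩ R) (x₀ : X) :
    HiddenLaw P σ μΩ R x₀ 0 := by
  intro F hF
  have hw := hR.measurable_w
  have hm : Measurable fun ω => (R.f ω, (fun i => R.ε i ω, R.w ω)) :=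
    hR.measurable_f.prodMk ((measurable_pi_lambda _ hR.measurable_ε).prodMk hw)
  have he : ∀ z : ℕ → ℝ, eraseOn ∅ z = z := fun z => funext fun i =>
    if_neg (Finset.notMem_empty i)
  have hprob : IsProbabilityMeasure (μΩ.map R.w) := Measure.isProbabilityMeasure_map hw.aemeasurable
  have hw' : Measurable fun q : (C(X, ℝ) × ((ℕ → ℝ) × W)) => ((q.2.2, ((∅ : Finset ℕ),
      ((fun _ => x₀ : ℕ → X), (fun _ => 0 : ℕ → ℝ)))), (q.1, q.2.1)) := by fun_prop
  have hF1 : Measurable fun r : W × (C(X, ℝ) × (ℕ → ℝ)) => F ((r.1, ((∅ : Finset ℕ),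
      ((fun _ => x₀ : ℕ → X), (fun _ => 0 : ℕ → ℝ)))), (r.2.1, r.2.2)) := hF.comp (by fun_prop)
  have hhid : ∀ ω, R.hidden 0 ω = (R.f ω, fun i => R.ε i ω) := fun ω => by
    rw [ParallelRun.hidden, hR.available_zero, he]
  simp_rw [hR.history_zero, hhid, historyModel_apply, posteriorOn_empty, hR.available_zero, he]
  calc ∫⁻ ω, F ((R.w ω, ∅, (fun _ => x₀, fun _ => 0)), R.f ω, fun i => R.ε i ω) ∂μΩ
      = ∫⁻ q, F ((q.2.2, (∅, (fun _ => x₀, fun _ => 0))), (q.1, q.2.1))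
          ∂(μΩ.map fun ω => (R.f ω, (fun i => R.ε i ω, R.w ω))) :=
        (lintegral_map (hF.comp hw') hm).symm
    _ = ∫⁻ φ, ∫⁻ η, ∫⁻ a, F ((a, (∅, (fun _ => x₀, fun _ => 0))), (φ, η))
          ∂(μΩ.map R.w) ∂(noiseLaw σ) ∂P := by
        rw [hR.law_base]
        refine (lintegral_prod (fun q : C(X, ℝ) × ((ℕ → ℝ) × W) =>
          F ((q.2.2, (∅, (fun _ => x₀, fun _ => 0))), (q.1, q.2.1)))
          (hF.comp hw').aemeasurable).trans (lintegral_congr fun φ => ?_)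
        exact lintegral_prod (fun r : (ℕ → ℝ) × W =>
          F ((r.2, (∅, (fun _ => x₀, fun _ => 0))), (φ, r.1)))
          ((hF.comp hw').comp measurable_prodMk_left).aemeasurable
    _ = ∫⁻ q, ∫⁻ a, F ((a, (∅, (fun _ => x₀, fun _ => 0))), (q.1, q.2))
          ∂(μΩ.map R.w) ∂(P.prod (noiseLaw σ)) :=
        (lintegral_prod _ (hF1.lintegral_prod_left').aemeasurable).symm
    _ = ∫⁻ a, ∫⁻ q, F ((a, (∅, (fun _ => x₀, fun _ => 0))), (q.1, q.2))
          ∂(P.prod (noiseLaw σ)) ∂(μΩ.map R.w) :=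
        lintegral_lintegral_swap (hF1.comp measurable_swap).aemeasurable
    _ = _ := lintegral_map hF1.lintegral_prod_right' hw

/-- One round: given the history, the objective function and the remaining noise follow the
posterior, independently of the randomness drawn. -/
lemma HiddenLaw.lintegral_draw {x₀ : X} {t : ℕ} (hL : HiddenLaw P σ μΩ R x₀ t)
    (hR : IsRandomizedKrigingBeliever P σ ν A μΩ R)
    (hA : ∀ t, Measurable fun q : Dataset X t × S => A t q.1 q.2)
    {G : (History X W × (C(X, ℝ) × (ℕ → ℝ))) × (C(X, ℝ) × ((ℕ → ℝ) × S)) → ℝ≥0∞}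
    (hG : Measurable G) :
    ∫⁻ ω, G ((R.history x₀ t ω, R.hidden t ω), R.draw t ω) ∂μΩ
      = ∫⁻ ω, ∫⁻ d, ∫⁻ q, G ((R.history x₀ t ω, (q.1, eraseOn (R.N t ω) q.2)), d)
          ∂(historyModel P σ (R.history x₀ t ω))
          ∂(historyDraw P σ ν (R.history x₀ t ω)) ∂μΩ := by
  rw [hR.lintegral_draw hA x₀ t hG]
  let K : Kernel (History X W × (C(X, ℝ) × (ℕ → ℝ))) (C(X, ℝ) × ((ℕ → ℝ) × S)) :=
    (historyDraw P σ ν).comap Prod.fst measurable_fst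
  refine (hL (fun r => ∫⁻ d, G (r, d) ∂(K r)) hG.lintegral_kernel_prod_right').trans
    (lintegral_congr fun ω => ?_)
  have he := measurable_eraseOn_right (R.N t ω)
  change ∫⁻ q, ∫⁻ d, G ((R.history x₀ t ω, (q.1, eraseOn (R.N t ω) q.2)), d)
    ∂(historyDraw P σ ν (R.history x₀ t ω)) ∂(historyModel P σ (R.history x₀ t ω)) = _
  refine lintegral_lintegral_swap (Measurable.aemeasurable ?_)
  exact hG.comp (f := fun r : (C(X, ℝ) × (ℕ → ℝ)) × (C(X, ℝ) × ((ℕ → ℝ) × S)) =>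
    ((R.history x₀ t ω, (r.1.1, eraseOn (R.N t ω) r.1.2)), r.2)) (by fun_prop)

lemma hiddenLaw_succ (hR : IsRandomizedKrigingBeliever P σ ν A μΩ R) (hσ : 0 < σ)
    (hA : ∀ t, Measurable fun q : Dataset X t × S => A t q.1 q.2) (x₀ : X) (t : ℕ)
    (hL : HiddenLaw P σ μΩ R x₀ t) : HiddenLaw P σ μΩ R x₀ (t + 1) := by
  intro F hF
  obtain ⟨sched, hm, hs⟩ := hR.history_succ x₀ t
  have hnext := measurable_nextHistory (W := W) hA t hm
  -- the right-hand side as a function of the new history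
  let F' : History X W → ℝ≥0∞ := fun h =>
    ∫⁻ q, F (h, (q.1, eraseOn h.2.1 q.2)) ∂(historyModel P σ h)
  have hF' : Measurable F' := by
    refine Measurable.lintegral_kernel_prod_right' (κ := historyModel P σ)
      (f := fun r : History X W × (C(X, ℝ) × (ℕ → ℝ)) => F (r.1, (r.2.1, eraseOn r.1.2.1 r.2.2))) ?_
    have he := measurable_eraseOn.comp (f := fun r : History X W × (C(X, ℝ) × (ℕ → ℝ)) =>
      (r.1.2.1, r.2.2)) (by fun_prop)
    exact hF.comp (Measurable.prodMk (by fun_prop) (Measurable.prodMk (by fun_prop) he))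
  let G : (History X W × (C(X, ℝ) × (ℕ → ℝ))) × (C(X, ℝ) × ((ℕ → ℝ) × S)) → ℝ≥0∞ := fun r =>
    F (nextHistory A t sched r.1.1 r.2 r.1.2.1 r.1.2.2,
      (r.1.2.1, eraseOn (nextAvailable A t sched r.1.1 r.2) r.1.2.2))
  have hG : Measurable G := by
    have he := measurable_eraseOn.comp (f := fun r : (History X W × (C(X, ℝ) × (ℕ → ℝ))) ×
      (C(X, ℝ) × ((ℕ → ℝ) × S)) => (nextAvailable A t sched r.1.1 r.2, r.1.2.2))
      (hnext.snd.fst.prodMk (by fun_prop))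
    exact hF.comp (hnext.prodMk (Measurable.prodMk (by fun_prop) he))
  have hleft : ∀ ω, F (R.history x₀ (t + 1) ω, R.hidden (t + 1) ω)
      = G ((R.history x₀ t ω, R.hidden t ω), R.draw t ω) := fun ω => by
    have hN : R.N (t + 1) ω = nextAvailable A t sched (R.history x₀ t ω) (R.draw t ω) :=
      congrArg (fun h : History X W => h.2.1) (hs ω)
    simp only [G]
    rw [← hs ω, ← hN, hR.hidden_succ]
  have hright : ∀ ω, F' (R.history x₀ (t + 1) ω)
      = (fun r : (History X W × (C(X, ℝ) × (ℕ → ℝ))) × (C(X, ℝ) × ((ℕ → ℝ) × S)) =>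
        F' (nextHistory A t sched r.1.1 r.2 r.1.2.1 r.1.2.2))
          ((R.history x₀ t ω, R.hidden t ω), R.draw t ω) := fun ω => by rw [hs ω]
  refine Eq.trans (lintegral_congr hleft) (Eq.trans ?_ (lintegral_congr hright).symm)
  rw [hL.lintegral_draw hR hA hG, hL.lintegral_draw hR hA
    (G := fun r => F' (nextHistory A t sched r.1.1 r.2 r.1.2.1 r.1.2.2)) (hF'.comp hnext)]
  refine lintegral_congr fun ω => lintegral_congr fun d => ?_
  set h := R.history x₀ t ω with hh
  have hN : h.2.1 ⊆ nextAvailable A t sched h d := Finset.subset_union_left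
  set N' := nextAvailable A t sched h d with hN'
  set x' := nextInputs A t h d with hx'
  have hpost : posteriorOn P σ h.2.1 h.2.2.1 h.2.2.2 = posteriorOn P σ h.2.1 x' h.2.2.2 := by
    refine posteriorOn_congr (fun i hi => ?_) fun i _ => rfl
    have hi' := Finset.mem_range.1 (hR.available_subset t ω hi)
    simp [hx', nextInputs, hi'.ne]
  have hb := lintegral_bayes_prod (P := P) hσ hN x' h.2.2.2
    (G := fun r => F ((h.1, (N', (x', r.1))), r.2)) (hF.comp (by fun_prop))
  rw [historyModel_apply, hpost]
  refine Eq.trans (lintegral_congr fun q => ?_) (hb.trans (lintegral_congr fun q => ?_))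
  · change F ((h.1, (N', (x', reveal (N' \ h.2.1) x' h.2.2.2 q.1 (eraseOn h.2.1 q.2)))),
      (q.1, eraseOn N' (eraseOn h.2.1 q.2))) = _
    rw [reveal_eraseOn, eraseOn_eraseOn hN]
  · change _ = ∫⁻ q', F ((h.1, (N', (x', reveal (N' \ h.2.1) x' h.2.2.2 q.1 (eraseOn h.2.1 q.2)))),
      (q'.1, eraseOn N' q'.2)) ∂(historyModel P σ (h.1, (N', (x',
        reveal (N' \ h.2.1) x' h.2.2.2 q.1 (eraseOn h.2.1 q.2)))))
    rw [reveal_eraseOn, historyModel_apply]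

lemma hiddenLaw (hR : IsRandomizedKrigingBeliever P σ ν A μΩ R) (hσ : 0 < σ)
    (hA : ∀ t, Measurable fun q : Dataset X t × S => A t q.1 q.2) (x₀ : X) (t : ℕ) :
    HiddenLaw P σ μΩ R x₀ t := by
  induction t with
  | zero => exact hR.hiddenLaw_zero x₀
  | succ t ih => exact hR.hiddenLaw_succ hσ hA x₀ t ih

/-- Complete data and objective function, expressed by the conditional law given the history. -/
lemma lintegral_data_path_eq (hR : IsRandomizedKrigingBeliever P σ ν A μΩ R) (hσ : 0 < σ)
    (hA : ∀ t, Measurable fun q : Dataset X t × S => A t q.1 q.2) (x₀ : X) (t : ℕ)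
    {F : Dataset X t × C(X, ℝ) → ℝ≥0∞} (hF : Measurable F) :
    ∫⁻ ω, F (R.data t ω, R.f ω) ∂μΩ
      = ∫⁻ ω, ∫⁻ q, F (completedData t (R.history x₀ t ω) q.1 q.2, q.1)
          ∂(historyModel P σ (R.history x₀ t ω)) ∂μΩ := by
  have h := hR.hiddenLaw hσ hA x₀ t
    (fun r => F (completedData t r.1 r.2.1 r.2.2, r.2.1))
    (hF.comp ((measurable_completedData t).prodMk (by fun_prop)))
  refine Eq.trans (lintegral_congr fun ω => ?_) (h.trans (lintegral_congr fun ω =>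
    lintegral_congr fun q => ?_))
  · rw [data_eq x₀]
    rfl
  · simp only [completedData]
    rw [show (R.history x₀ t ω).2.1 = R.N t ω from rfl, reveal_eraseOn]

/-- Given the complete data, the objective function is a posterior path. -/
theorem lintegral_data_path (hR : IsRandomizedKrigingBeliever P σ ν A μΩ R) (hσ : 0 < σ)
    (hA : ∀ t, Measurable fun q : Dataset X t × S => A t q.1 q.2) [Nonempty X] (t : ℕ)
    {F : Dataset X t × C(X, ℝ) → ℝ≥0∞} (hF : Measurable F) :
    ∫⁻ ω, F (R.data t ω, R.f ω) ∂μΩ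
      = ∫⁻ ω, ∫⁻ φ, F (R.data t ω, φ) ∂(gpPosterior P σ (R.data t ω)) ∂μΩ := by
  obtain ⟨x₀⟩ := ‹Nonempty X›
  have hF' : Measurable fun r : Dataset X t × C(X, ℝ) => ∫⁻ φ, F (r.1, φ) ∂(gpPosterior P σ r.1) :=
    (measurable_lintegral_of_measurable measurable_gpPosterior hF).comp measurable_fst
  refine (hR.lintegral_data_path_eq hσ hA x₀ t hF).trans
    (Eq.trans ?_ (hR.lintegral_data_path_eq hσ hA x₀ t hF').symm)
  refine lintegral_congr fun ω => ?_
  set h := R.history x₀ t ω with hh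
  have hb := lintegral_bayes_prod (P := P) hσ (hR.available_subset t ω) h.2.2.1 h.2.2.2
    (G := fun r => F (toDataset t h.2.2.1 r.1, r.2.1)) (hF.comp (Measurable.prodMk
      (measurable_pi_lambda _ fun i => Measurable.prodMk measurable_const
        ((measurable_pi_apply (i : ℕ)).comp measurable_fst)) (by fun_prop)))
  rw [historyModel_apply]
  refine hb.trans (lintegral_congr fun q => ?_)
  rw [posteriorOn_range]
  exact (measurePreserving_fst (μ := gpPosterior P σ (completedData t h q.1 q.2))
    (ν := noiseLaw σ)).lintegral_comp (f := fun φ => F (completedData t h q.1 q.2, φ))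
    (hF.comp measurable_prodMk_left)

/-- The imputed data and the sampled path have the law of the complete data and the objective
function, and the seed is independent of them. -/
theorem lintegral_imputedData (hR : IsRandomizedKrigingBeliever P σ ν A μΩ R) (hσ : 0 < σ)
    (hA : ∀ t, Measurable fun q : Dataset X t × S => A t q.1 q.2) [Nonempty X] (t : ℕ)
    {F : Dataset X t × (C(X, ℝ) × S) → ℝ≥0∞} (hF : Measurable F) :
    ∫⁻ ω, F (R.imputedData t ω, (R.g t ω, R.s t ω)) ∂μΩ
      = ∫⁻ ω, ∫⁻ q, F (R.data t ω, q) ∂((gpPosterior P σ (R.data t ω)).prod ν) ∂μΩ := by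
  obtain ⟨x₀⟩ := ‹Nonempty X›
  have hF' : Measurable fun r : Dataset X t × C(X, ℝ) => ∫⁻ s, F (r.1, (r.2, s)) ∂ν :=
    Measurable.lintegral_prod_right' (f := fun r : (Dataset X t × C(X, ℝ)) × S =>
      F (r.1.1, (r.1.2, r.2))) (hF.comp (by fun_prop))
  have hc := measurable_completedData (X := X) (W := W) t
  have hG : Measurable fun r : (History X W × (C(X, ℝ) × (ℕ → ℝ))) × (C(X, ℝ) × ((ℕ → ℝ) × S)) =>
      F (completedData t r.1.1 r.2.1 r.2.2.1, (r.2.1, r.2.2.2)) := by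
    have := hc.comp (f := fun r : (History X W × (C(X, ℝ) × (ℕ → ℝ))) ×
      (C(X, ℝ) × ((ℕ → ℝ) × S)) => (r.1.1, (r.2.1, r.2.2.1))) (by fun_prop)
    exact hF.comp (this.prodMk (by fun_prop))
  calc ∫⁻ ω, F (R.imputedData t ω, (R.g t ω, R.s t ω)) ∂μΩ
      = ∫⁻ ω, ∫⁻ d, F (completedData t (R.history x₀ t ω) d.1 d.2.1, (d.1, d.2.2))
          ∂(historyDraw P σ ν (R.history x₀ t ω)) ∂μΩ := by
        refine Eq.trans (lintegral_congr fun ω => ?_) (hR.lintegral_draw hA x₀ t hG)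
        rw [imputedData_eq x₀]
        rfl
    _ = ∫⁻ ω, ∫⁻ q, ∫⁻ s, F (completedData t (R.history x₀ t ω) q.1 q.2, (q.1, s)) ∂ν
          ∂(historyModel P σ (R.history x₀ t ω)) ∂μΩ := by
        refine lintegral_congr fun ω => ?_
        rw [historyDraw_apply, historyModel_apply]
        set h := R.history x₀ t ω
        have hc' : Measurable fun q : C(X, ℝ) × (ℕ → ℝ) => completedData t h q.1 q.2 :=
          hc.comp measurable_prodMk_left
        have hm1 : Measurable fun d : C(X, ℝ) × ((ℕ → ℝ) × S) =>
            F (completedData t h d.1 d.2.1, (d.1, d.2.2)) :=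
          hF.comp ((hc'.comp (f := fun d : C(X, ℝ) × ((ℕ → ℝ) × S) => (d.1, d.2.1))
            (by fun_prop)).prodMk (by fun_prop))
        have hm2 : Measurable fun q : C(X, ℝ) × (ℕ → ℝ) =>
            ∫⁻ s, F (completedData t h q.1 q.2, (q.1, s)) ∂ν :=
          hF'.comp (hc'.prodMk measurable_fst)
        rw [lintegral_prod _ hm1.aemeasurable, lintegral_prod _ hm2.aemeasurable]
        refine lintegral_congr fun φ => ?_
        exact lintegral_prod _ (hm1.comp measurable_prodMk_left).aemeasurable
    _ = ∫⁻ ω, ∫⁻ s, F (R.data t ω, (R.f ω, s)) ∂ν ∂μΩ :=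
        (hR.lintegral_data_path_eq hσ hA x₀ t hF').symm
    _ = ∫⁻ ω, ∫⁻ φ, ∫⁻ s, F (R.data t ω, (φ, s)) ∂ν ∂(gpPosterior P σ (R.data t ω)) ∂μΩ :=
        have : Nonempty X := ⟨x₀⟩
        hR.lintegral_data_path hσ hA t hF'
    _ = _ := lintegral_congr fun ω =>
        (lintegral_prod _ (hF.comp measurable_prodMk_left).aemeasurable).symm

end IsRandomizedKrigingBeliever

/-! ### The regret of one round -/

/-- A quantity bounded by every weighted arithmetic mean of `a` and `b` is bounded by their
geometric mean. The weight is optimised here, after summation, since the optimal one depends on the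
sums over all rounds. -/
lemma le_sqrt_mul_of_forall_weight {a b c : ℝ} (ha : 0 ≤ a) (hb : 0 ≤ b)
    (h : ∀ l : ℝ, 0 < l → c ≤ (l * a + b / l) / 2) : c ≤ Real.sqrt (a * b) := by
  rcases le_or_gt c 0 with hc | hc
  · exact hc.trans (Real.sqrt_nonneg _)
  refine Real.le_sqrt_of_sq_le ?_
  rcases ha.eq_or_lt with rfl | ha
  · -- for `a = 0` the infimum over the weights is not attained; a large weight suffices
    have h1 := h ((b + 1) / c) (by positivity)
    rw [mul_zero, zero_add, div_div_eq_mul_div, div_div, le_div_iff₀ (by positivity)] at h1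
    nlinarith
  · have h1 := h (c / a) (by positivity)
    rw [div_mul_cancel₀ _ ha.ne', div_div_eq_mul_div] at h1
    have h2 : c ≤ b * a / c := by linarith
    rw [le_div_iff₀ hc] at h2
    nlinarith

section Round

variable {X S : Type*} [MetricSpace X] [CompactSpace X] [MeasurableSpace X] [BorelSpace X]
  [MeasurableSpace S] {P : Measure C(X, ℝ)} [IsProbabilityMeasure P] {k : X → X → ℝ}
  {σ : ℝ≥0} {ν : Measure S} [IsProbabilityMeasure ν]

lemma integrable_of_abs_le_norm {α : Type*} [MeasurableSpace α]
    {μ : Measure α} {f : α → C(X, ℝ)} (hf : Integrable (fun a => ‖f a‖) μ) {h : α → ℝ}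
    (hm : Measurable h) (hb : ∀ a, |h a| ≤ 2 * ‖f a‖) : Integrable h μ :=
  (hf.const_mul 2).mono' hm.aestronglyMeasurable (ae_of_all _ hb)

lemma abs_pathMax_sub_apply_le [Nonempty X] (φ : C(X, ℝ)) (x : X) :
    |pathMax φ - φ x| ≤ 2 * ‖φ‖ := by
  have h1 := abs_pathMax_le φ
  have h2 := φ.norm_coe_le_norm x
  rw [Real.norm_eq_abs] at h2
  linarith [abs_sub (pathMax φ) (φ x)]

/-- The posterior regret of the best point is at most that of the query, which the condition on the
base algorithm controls. -/
lemma posterior_regret_le [Nonempty X] (hP : IsCenteredGP P k) (hk : ∀ x, k x x ≤ 1) (hσ : 0 < σ)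
    {t : ℕ} {B : Dataset X t → S → X} (hB : Measurable fun q : Dataset X t × S => B q.1 q.2)
    (D : Dataset X t) {x : X} (hx : ∀ x', posteriorMean k σ D x' ≤ posteriorMean k σ D x)
    {u v : C(X, ℝ) × S → ℝ} (hu : Measurable u) {a b : ℝ}
    (hreg : ∫ q, (pathMax q.1 - q.1 (B D q.2)) ∂((gpPosterior P σ D).prod ν)
      ≤ ∫ q, (u q * posteriorStd k σ D (B D q.2) + v q) ∂((gpPosterior P σ D).prod ν))
    (hu2 : Integrable (fun q => u q ^ 2) ((gpPosterior P σ D).prod ν))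
    (hv : Integrable v ((gpPosterior P σ D).prod ν))
    (hua : ∫ q, u q ^ 2 ∂((gpPosterior P σ D).prod ν) ≤ a)
    (hvb : ∫ q, v q ∂((gpPosterior P σ D).prod ν) ≤ b) {l : ℝ} (hl : 0 < l) :
    ∫ φ, (pathMax φ - φ x) ∂(gpPosterior P σ D)
      ≤ (l * a + (∫ s, posteriorVar k σ D (B D s) ∂ν) / l) / 2 + b := by
  set Q := gpPosterior P σ D with hQ
  have hBD : Measurable (B D) := hB.comp measurable_prodMk_left
  have hmax : Measurable (pathMax : C(X, ℝ) → ℝ) := continuous_pathMax.measurable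
  have hnorm : Integrable (fun φ : C(X, ℝ) => ‖φ‖) Q := integrable_gpPosterior D hP.integrable_norm
  have hnorm' : Integrable (fun q : C(X, ℝ) × S => ‖q.1‖) (Q.prod ν) := hnorm.comp_fst ν
  have heval : Measurable fun q : C(X, ℝ) × S => q.1 (B D q.2) :=
    measurable_path_eval.comp (measurable_fst.prodMk (hBD.comp measurable_snd))
  have hint : Integrable (fun q : C(X, ℝ) × S => q.1 (B D q.2)) (Q.prod ν) :=
    hnorm'.mono' heval.aestronglyMeasurable (ae_of_all _ fun q => q.1.norm_coe_le_norm _)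
  have hmaxint : Integrable (pathMax : C(X, ℝ) → ℝ) Q :=
    hnorm.mono' hmax.aestronglyMeasurable (ae_of_all _ fun φ => abs_pathMax_le φ)
  have hvar : Measurable fun s => posteriorVar k σ D (B D s) :=
    (measurable_posteriorVar hP).comp (f := fun s => (D, B D s)) (measurable_const.prodMk hBD)
  have hvar0 : ∀ s, 0 ≤ posteriorVar k σ D (B D s) := fun s => posteriorVar_nonneg hP hσ D _
  have hvarint : Integrable (fun s => posteriorVar k σ D (B D s)) ν := by
    refine (integrable_const (1 : ℝ)).mono' hvar.aestronglyMeasurable (ae_of_all _ fun s => ?_)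
    rw [Real.norm_eq_abs, abs_of_nonneg (hvar0 s)]
    exact (posteriorVar_le_self hP hσ D _).trans (hk _)
  have hvarint' : Integrable (fun q : C(X, ℝ) × S => posteriorVar k σ D (B D q.2)) (Q.prod ν) :=
    hvarint.comp_snd Q
  -- the weighted inequality of arithmetic and geometric means
  have hamgm : ∀ q : C(X, ℝ) × S, |u q * posteriorStd k σ D (B D q.2)|
      ≤ (l * u q ^ 2 + posteriorVar k σ D (B D q.2) / l) / 2 := fun q => by
    rw [← Real.sq_sqrt (hvar0 q.2), abs_mul]
    change |u q| * |posteriorStd k σ D (B D q.2)|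
      ≤ (l * u q ^ 2 + posteriorStd k σ D (B D q.2) ^ 2 / l) / 2
    rw [← sq_abs (u q), ← sq_abs (posteriorStd k σ D (B D q.2)), le_div_iff₀ two_pos,
      ← sub_nonneg]
    have : l * |u q| ^ 2 + |posteriorStd k σ D (B D q.2)| ^ 2 / l
        - |u q| * |posteriorStd k σ D (B D q.2)| * 2
        = (l * |u q| - |posteriorStd k σ D (B D q.2)|) ^ 2 / l := by
      field_simp
      ring
    rw [this]
    positivity
  have hsum : Integrable (fun q : C(X, ℝ) × S =>
      (l * u q ^ 2 + posteriorVar k σ D (B D q.2) / l) / 2) (Q.prod ν) :=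
    ((hu2.const_mul l).add (hvarint'.div_const l)).div_const 2
  have hstd : Measurable fun q : C(X, ℝ) × S => posteriorStd k σ D (B D q.2) :=
    (hvar.comp measurable_snd).sqrt
  have hus : Integrable (fun q : C(X, ℝ) × S => u q * posteriorStd k σ D (B D q.2)) (Q.prod ν) :=
    hsum.mono' (hu.mul hstd).aestronglyMeasurable (ae_of_all _ hamgm)
  have hxint : Integrable (fun φ : C(X, ℝ) => φ x) Q :=
    integrable_gpPosterior D (hP.integrable_eval x)
  calc ∫ φ, (pathMax φ - φ x) ∂Q
      = ∫ φ, pathMax φ ∂Q - posteriorMean k σ D x := by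
        rw [integral_sub hmaxint hxint, integral_gpPosterior hP hσ]
    _ ≤ ∫ φ, pathMax φ ∂Q - ∫ q, q.1 (B D q.2) ∂(Q.prod ν) := by
        refine sub_le_sub_left ?_ _
        rw [integral_prod_symm _ hint]
        have hle : ∀ s, ∫ φ : C(X, ℝ), φ (B D s) ∂Q ≤ posteriorMean k σ D x := fun s => by
          rw [integral_gpPosterior hP hσ]
          exact hx _
        refine (integral_mono hint.integral_prod_right (integrable_const _) hle).trans_eq ?_
        simp
    _ = ∫ q, (pathMax q.1 - q.1 (B D q.2)) ∂(Q.prod ν) := by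
        rw [integral_sub (hmaxint.comp_fst ν) hint, integral_fun_fst]
        simp
    _ ≤ ∫ q, (u q * posteriorStd k σ D (B D q.2) + v q) ∂(Q.prod ν) := hreg
    _ ≤ ∫ q, ((l * u q ^ 2 + posteriorVar k σ D (B D q.2) / l) / 2 + v q) ∂(Q.prod ν) :=
        integral_mono (hus.add hv) (hsum.add hv) fun q =>
          add_le_add_left ((le_abs_self _).trans (hamgm q)) _
    _ = (l * ∫ q, u q ^ 2 ∂(Q.prod ν) + (∫ s, posteriorVar k σ D (B D s) ∂ν) / l) / 2
          + ∫ q, v q ∂(Q.prod ν) := by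
        rw [integral_add hsum hv, integral_div, integral_add (hu2.const_mul l)
          (hvarint'.div_const l), integral_const_mul, integral_div,
          integral_fun_snd (fun s => posteriorVar k σ D (B D s))]
        simp
    _ ≤ _ := by gcongr

end Round

/-! ### The regret of a run -/

namespace IsRandomizedKrigingBeliever

variable {Ω X S W : Type*} [MetricSpace X] [CompactSpace X] [MeasurableSpace X] [BorelSpace X]
  [Nonempty X] [MeasurableSpace Ω] [MeasurableSpace S] [MeasurableSpace W] {P : Measure C(X, ℝ)}
  [IsProbabilityMeasure P] {k : X → X → ℝ} {σ : ℝ≥0} {ν : Measure S} [IsProbabilityMeasure ν]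
  {A : ∀ t : ℕ, Dataset X t → S → X} {μΩ : Measure Ω} [IsProbabilityMeasure μΩ]
  {R : ParallelRun Ω X S W} {ρ : ∀ T : ℕ, Dataset X T → X}

lemma map_f (hR : IsRandomizedKrigingBeliever P σ ν A μΩ R) : μΩ.map R.f = P := by
  have hm : Measurable fun ω => (R.f ω, (fun i => R.ε i ω, R.w ω)) :=
    hR.measurable_f.prodMk ((measurable_pi_lambda _ hR.measurable_ε).prodMk hR.measurable_w)
  have : IsProbabilityMeasure (μΩ.map R.w) :=
    Measure.isProbabilityMeasure_map hR.measurable_w.aemeasurable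
  have h := congrArg (Measure.map Prod.fst) hR.law_base
  rw [Measure.map_map measurable_fst hm, Measure.map_fst_prod, measure_univ, one_smul] at h
  exact h

lemma integrable_norm_f (hR : IsRandomizedKrigingBeliever P σ ν A μΩ R) (hP : IsCenteredGP P k) :
    Integrable (fun ω => ‖R.f ω‖) μΩ := by
  have h := hP.integrable_norm
  rw [← hR.map_f] at h
  exact h.comp_measurable hR.measurable_f

/-- Averages over data and objective function are averages over posterior paths. -/
lemma integral_data_path (hR : IsRandomizedKrigingBeliever P σ ν A μΩ R) (hσ : 0 < σ)
    (hA : ∀ t, Measurable fun q : Dataset X t × S => A t q.1 q.2) (t : ℕ)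
    {h : Dataset X t × C(X, ℝ) → ℝ} (hm : Measurable h)
    (hint : Integrable (fun ω => h (R.data t ω, R.f ω)) μΩ) :
    Integrable (fun ω => ∫ φ, h (R.data t ω, φ) ∂(gpPosterior P σ (R.data t ω))) μΩ ∧
    ∫ ω, h (R.data t ω, R.f ω) ∂μΩ
      = ∫ ω, ∫ φ, h (R.data t ω, φ) ∂(gpPosterior P σ (R.data t ω)) ∂μΩ := by
  have hD := hR.measurable_data hA (Classical.arbitrary X) t
  let κ : Kernel (Dataset X t) C(X, ℝ) := ⟨fun D => gpPosterior P σ D, measurable_gpPosterior⟩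
  have : IsMarkovKernel κ := ⟨fun D => isProbabilityMeasure_gpPosterior D⟩
  have hpair := hD.prodMk hR.measurable_f
  have : IsProbabilityMeasure (μΩ.map (R.data t)) := Measure.isProbabilityMeasure_map hD.aemeasurable
  have hlaw : μΩ.map (fun ω => (R.data t ω, R.f ω)) = (μΩ.map (R.data t)) ⊗ₘ κ := by
    refine Measure.ext_of_lintegral _ fun F hF => ?_
    rw [lintegral_map hF hpair, Measure.lintegral_compProd hF,
      lintegral_map hF.lintegral_kernel_prod_right' hD]
    exact hR.lintegral_data_path hσ hA t hF
  have hint' : Integrable h ((μΩ.map (R.data t)) ⊗ₘ κ) := by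
    rw [← hlaw]
    exact (integrable_map_measure hm.aestronglyMeasurable hpair.aemeasurable).2 hint
  have hi : Integrable (fun D => ∫ φ, h (D, φ) ∂(κ D)) (μΩ.map (R.data t)) := by
    refine ((Measure.integrable_compProd_iff hint'.1).1 hint').2.mono'
      (hm.stronglyMeasurable.integral_kernel_prod_right' (κ := κ)).aestronglyMeasurable
      (ae_of_all _ fun D => norm_integral_le_integral_norm _)
  refine ⟨hi.comp_measurable hD, ?_⟩
  have e := integral_map hpair.aemeasurable (μ := μΩ) hm.aestronglyMeasurable
  rw [hlaw, Measure.integral_compProd hint',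
    integral_map hD.aemeasurable hi.aestronglyMeasurable] at e
  exact e.symm

/-- Imputed data and seed have the law of the complete data and an independent seed. -/
lemma integral_imputedData (hR : IsRandomizedKrigingBeliever P σ ν A μΩ R) (hσ : 0 < σ)
    (hA : ∀ t, Measurable fun q : Dataset X t × S => A t q.1 q.2) (t : ℕ)
    {h : Dataset X t × S → ℝ} (hm : Measurable h) (h0 : ∀ q, 0 ≤ h q) (h1 : ∀ q, h q ≤ 1) :
    Integrable (fun ω => ∫ s, h (R.data t ω, s) ∂ν) μΩ ∧
    ∫ ω, ∫ s, h (R.data t ω, s) ∂ν ∂μΩ = ∫ ω, h (R.imputedData t ω, R.s t ω) ∂μΩ := by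
  have hD := hR.measurable_data hA (Classical.arbitrary X) t
  have hI := hR.measurable_imputedData hA (Classical.arbitrary X) t
  have hpair := hI.prodMk (hR.measurable_s t)
  have : IsProbabilityMeasure (μΩ.map (R.data t)) := Measure.isProbabilityMeasure_map hD.aemeasurable
  have hlaw : μΩ.map (fun ω => (R.imputedData t ω, R.s t ω)) = (μΩ.map (R.data t)).prod ν := by
    refine Measure.ext_of_lintegral _ fun F hF => ?_
    rw [lintegral_map hF hpair, lintegral_prod _ hF.aemeasurable,
      lintegral_map hF.lintegral_prod_right' hD]
    refine (hR.lintegral_imputedData hσ hA t (F := fun r => F (r.1, r.2.2))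
      (hF.comp (by fun_prop))).trans (lintegral_congr fun ω => ?_)
    exact (measurePreserving_snd (μ := gpPosterior P σ (R.data t ω)) (ν := ν)).lintegral_comp
      (f := fun s => F (R.data t ω, s)) (hF.comp measurable_prodMk_left)
  have hint : Integrable h ((μΩ.map (R.data t)).prod ν) := by
    refine (integrable_const (1 : ℝ)).mono' hm.aestronglyMeasurable (ae_of_all _ fun q => ?_)
    rw [Real.norm_eq_abs, abs_of_nonneg (h0 q)]
    exact h1 q
  have hi := hint.integral_prod_left
  refine ⟨hi.comp_measurable hD, ?_⟩
  have e := integral_map hpair.aemeasurable (μ := μΩ) hm.aestronglyMeasurable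
  rw [hlaw, integral_prod _ hint, integral_map hD.aemeasurable hi.aestronglyMeasurable] at e
  exact e

lemma measurable_simpleRegret (hR : IsRandomizedKrigingBeliever P σ ν A μΩ R)
    (hA : ∀ t, Measurable fun q : Dataset X t × S => A t q.1 q.2) (hρ : IsMeanMaximizer k σ ρ)
    (t : ℕ) : Measurable (simpleRegret R ρ t) := by
  have hD := hR.measurable_data hA (Classical.arbitrary X) t
  exact (continuous_pathMax.measurable.comp hR.measurable_f).sub
    (measurable_path_eval.comp (hR.measurable_f.prodMk ((hρ.measurable t).comp hD)))

lemma integrable_simpleRegret (hR : IsRandomizedKrigingBeliever P σ ν A μΩ R)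
    (hP : IsCenteredGP P k) (hA : ∀ t, Measurable fun q : Dataset X t × S => A t q.1 q.2)
    (hρ : IsMeanMaximizer k σ ρ) (t : ℕ) : Integrable (simpleRegret R ρ t) μΩ :=
  integrable_of_abs_le_norm (hR.integrable_norm_f hP) (hR.measurable_simpleRegret hA hρ t)
    fun _ => abs_pathMax_sub_apply_le _ _

/-- The expected value at a point chosen from the data is the expected posterior mean there. -/
lemma integral_f_apply (hR : IsRandomizedKrigingBeliever P σ ν A μΩ R) (hP : IsCenteredGP P k)
    (hσ : 0 < σ) (hA : ∀ t, Measurable fun q : Dataset X t × S => A t q.1 q.2) (t : ℕ)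
    {q : Dataset X t → X} (hq : Measurable q) :
    Integrable (fun ω => R.f ω (q (R.data t ω))) μΩ ∧
    Integrable (fun ω => posteriorMean k σ (R.data t ω) (q (R.data t ω))) μΩ ∧
    ∫ ω, R.f ω (q (R.data t ω)) ∂μΩ
      = ∫ ω, posteriorMean k σ (R.data t ω) (q (R.data t ω)) ∂μΩ := by
  have hD := hR.measurable_data hA (Classical.arbitrary X) t
  have hm : Measurable fun r : Dataset X t × C(X, ℝ) => r.2 (q r.1) :=
    measurable_path_eval.comp (measurable_snd.prodMk (hq.comp measurable_fst))
  have hint : Integrable (fun ω => R.f ω (q (R.data t ω))) μΩ :=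
    (hR.integrable_norm_f hP).mono' (hm.comp (hD.prodMk hR.measurable_f)).aestronglyMeasurable
      (ae_of_all _ fun ω => (R.f ω).norm_coe_le_norm _)
  obtain ⟨h1, h2⟩ := hR.integral_data_path hσ hA t hm hint
  simp only [integral_gpPosterior hP hσ] at h1 h2
  exact ⟨hint, h1, h2⟩

/-- More data can only improve the recommendation on average. -/
lemma integral_simpleRegret_anti (hR : IsRandomizedKrigingBeliever P σ ν A μΩ R)
    (hP : IsCenteredGP P k) (hσ : 0 < σ)
    (hA : ∀ t, Measurable fun q : Dataset X t × S => A t q.1 q.2)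
    (hρ : IsMeanMaximizer k σ ρ) {t T : ℕ} (ht : t ≤ T) :
    ∫ ω, simpleRegret R ρ T ω ∂μΩ ≤ ∫ ω, simpleRegret R ρ t ω ∂μΩ := by
  have hmax : Integrable (fun ω => pathMax (R.f ω)) μΩ :=
    (hR.integrable_norm_f hP).mono'
      (continuous_pathMax.measurable.comp hR.measurable_f).aestronglyMeasurable
      (ae_of_all _ fun ω => abs_pathMax_le _)
  -- the recommendation after `t` queries is one of the points that can be chosen from the data of
  -- `T` queries
  let q : Dataset X T → X := fun D => ρ t fun i => D (Fin.castLE ht i)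
  have hq : Measurable q := (hρ.measurable t).comp (by fun_prop)
  obtain ⟨hi1, hi2, he⟩ := hR.integral_f_apply hP hσ hA T hq
  obtain ⟨hi1', hi2', he'⟩ := hR.integral_f_apply hP hσ hA T (hρ.measurable T)
  have hle : ∫ ω, R.f ω (q (R.data T ω)) ∂μΩ ≤ ∫ ω, R.f ω (ρ T (R.data T ω)) ∂μΩ := by
    rw [he, he']
    exact integral_mono hi2 hi2' fun ω => hρ.le_mean T _ _
  have e1 : ∫ ω, simpleRegret R ρ T ω ∂μΩ
      = ∫ ω, pathMax (R.f ω) ∂μΩ - ∫ ω, R.f ω (ρ T (R.data T ω)) ∂μΩ := integral_sub hmax hi1'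
  have e2 : ∫ ω, simpleRegret R ρ t ω ∂μΩ
      = ∫ ω, pathMax (R.f ω) ∂μΩ - ∫ ω, R.f ω (q (R.data T ω)) ∂μΩ := integral_sub hmax hi1
  rw [e1, e2]
  exact sub_le_sub_left hle _

/-- The expected regret of the recommendation after `t` queries, in terms of the posterior variance
at the query of round `t`. -/
lemma integral_simpleRegret_le (hR : IsRandomizedKrigingBeliever P σ ν A μΩ R)
    (hP : IsCenteredGP P k) (hk : ∀ x, k x x ≤ 1) (hσ : 0 < σ)
    (hA : ∀ t, Measurable fun q : Dataset X t × S => A t q.1 q.2) (hρ : IsMeanMaximizer k σ ρ)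
    {ζ ξ : ℕ → ℝ} (hcond : RegretCondition P k σ ν A ζ ξ) (t : ℕ) {l : ℝ} (hl : 0 < l) :
    ∫ ω, simpleRegret R ρ t ω ∂μΩ
      ≤ (l * ζ t + (∫ ω, posteriorVar k σ (R.imputedData t ω) (R.x t ω) ∂μΩ) / l) / 2 + ξ t := by
  obtain ⟨u, v, hu, hv, hD⟩ := hcond.1 t
  have hm : Measurable fun r : Dataset X t × C(X, ℝ) => pathMax r.2 - r.2 (ρ t r.1) :=
    (continuous_pathMax.measurable.comp measurable_snd).sub (measurable_path_eval.comp
      (measurable_snd.prodMk ((hρ.measurable t).comp measurable_fst)))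
  obtain ⟨hi, he⟩ := hR.integral_data_path hσ hA t hm (hR.integrable_simpleRegret hP hA hρ t)
  obtain ⟨hi', he'⟩ := hR.integral_imputedData hσ hA t
    (h := fun q => posteriorVar k σ q.1 (A t q.1 q.2))
    ((measurable_posteriorVar hP).comp (measurable_fst.prodMk (hA t)))
    (fun q => posteriorVar_nonneg hP hσ _ _)
    fun q => (posteriorVar_le_self hP hσ _ _).trans (hk _)
  simp only [← hR.query_eq] at he'
  rw [← he']
  refine he.trans_le ((integral_mono hi (((integrable_const (l * ζ t)).add
    (hi'.div_const l)).div_const 2 |>.add (integrable_const (ξ t))) fun ω => ?_).trans_eq ?_)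
  · obtain ⟨h1, h2, h3, h4, h5⟩ := hD (R.data t ω)
    exact posterior_regret_le hP hk hσ (hA t) (R.data t ω) (hρ.le_mean t _)
      (hu.comp measurable_prodMk_left) h1 h2 h3 h4 h5 hl
  · have hc : Integrable (fun _ : Ω => l * ζ t) μΩ := integrable_const _
    have hs : Integrable (fun ω => (l * ζ t
        + (∫ s, posteriorVar k σ (R.data t ω) (A t (R.data t ω) s) ∂ν) / l) / 2) μΩ :=
      (hc.add (hi'.div_const l)).div_const 2
    refine (integral_add hs (integrable_const (ξ t))).trans ?_
    rw [integral_div, integral_add hc (hi'.div_const l), integral_div]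
    simp

/-- The regret bound for every horizon. -/
theorem integral_simpleRegret_le_regretBound (hR : IsRandomizedKrigingBeliever P σ ν A μΩ R)
    (hP : IsCenteredGP P k) (hk : ∀ x, k x x ≤ 1) (hσ : 0 < σ)
    (hA : ∀ t, Measurable fun q : Dataset X t × S => A t q.1 q.2) (hρ : IsMeanMaximizer k σ ρ)
    {ζ ξ : ℕ → ℝ} (hcond : RegretCondition P k σ ν A ζ ξ) {T : ℕ} (hT : 1 ≤ T) :
    bayesSimpleRegret μΩ R ρ T ≤ regretBound P σ ζ ξ T / T := by
  have hT0 : (0 : ℝ) < T := by exact_mod_cast hT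
  have hx : ∀ t, Measurable (R.x t) := fun t => by
    rw [show R.x t = fun ω => A t (R.imputedData t ω) (R.s t ω) from funext (hR.query_eq t)]
    exact (hA t).comp ((hR.measurable_imputedData hA (Classical.arbitrary X) t).prodMk
      (hR.measurable_s t))
  have hvar : ∀ t, Integrable (fun ω => posteriorVar k σ (R.imputedData t ω) (R.x t ω)) μΩ := by
    intro t
    refine (integrable_const (1 : ℝ)).mono' ((measurable_posteriorVar hP).comp
      ((hR.measurable_imputedData hA (Classical.arbitrary X) t).prodMk
        (hx t))).aestronglyMeasurable (ae_of_all _ fun ω => ?_)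
    change ‖posteriorVar k σ (R.imputedData t ω) (R.x t ω)‖ ≤ 1
    rw [Real.norm_eq_abs, abs_of_nonneg (posteriorVar_nonneg hP hσ _ _)]
    exact (posteriorVar_le_self hP hσ _ _).trans (hk _)
  have hsum : ∑ t ∈ Finset.range T, ∫ ω, posteriorVar k σ (R.imputedData t ω) (R.x t ω) ∂μΩ
      ≤ 2 / Real.log (1 + ((σ : ℝ) ^ 2)⁻¹) * maxInfoGain P σ T := by
    rw [← integral_finsetSum _ fun t _ => hvar t]
    refine (integral_mono (integrable_finsetSum _ fun t _ => hvar t) (integrable_const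
      (2 / Real.log (1 + ((σ : ℝ) ^ 2)⁻¹) * maxInfoGain P σ T)) fun ω => ?_).trans_eq (by simp)
    -- the posterior variance depends on the data only through the queries
    have e : ∀ t, posteriorVar k σ (R.imputedData t ω) (R.x t ω)
        = posteriorVar k σ (inputsOnly (fun i => R.x i ω) t) (R.x t ω) := fun t =>
      posteriorVar_congr (fun i => rfl) _
    simp only [e]
    exact sum_posteriorVar_le hP hk hσ (fun i => R.x i ω) T
  -- needed since the square root of a negative product would be `0`
  have hζ : ∀ t, 0 ≤ ζ t := fun t => by
    obtain ⟨u, v, -, -, hD⟩ := hcond.1 t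
    exact (integral_nonneg fun q => sq_nonneg _).trans
      (hD fun _ => (Classical.arbitrary X, 0)).2.2.2.1
  rw [le_div_iff₀ hT0, regretBound, ← sub_le_iff_le_add, mul_comm (2 / _ * _)]
  refine le_sqrt_mul_of_forall_weight (Finset.sum_nonneg fun t _ => hζ t)
    (mul_nonneg (div_pos two_pos (log_one_add_inv_pos hσ)).le (maxInfoGain_nonneg P σ T))
    fun l hl => ?_
  have h1 : ∀ t ∈ Finset.range T, bayesSimpleRegret μΩ R ρ T
      ≤ (l * ζ t + (∫ ω, posteriorVar k σ (R.imputedData t ω) (R.x t ω) ∂μΩ) / l) / 2 + ξ t :=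
    fun t ht => (hR.integral_simpleRegret_anti hP hσ hA hρ (Finset.mem_range.1 ht).le).trans
      (hR.integral_simpleRegret_le hP hk hσ hA hρ hcond t hl)
  have h2 := Finset.sum_le_sum h1
  rw [Finset.sum_const, Finset.card_range, nsmul_eq_mul, Finset.sum_add_distrib,
    ← Finset.sum_div, Finset.sum_add_distrib, ← Finset.mul_sum, ← Finset.sum_div] at h2
  have h3 := div_le_div_of_nonneg_right hsum hl.le
  rw [mul_comm (T : ℝ)] at h2
  linarith

end IsRandomizedKrigingBeliever

theorem theorem3 {d : ℕ} {r : ℝ} (hr : 0 < r)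
    -- the domain
    (X : Set (Fin d → ℝ)) (hXr : X ⊆ Set.Icc 0 (fun _ => r)) (hXc : IsCompact X)
    (hXne : X.Nonempty)
    -- the Gaussian process prior and the noise level
    (k : X → X → ℝ) (hk : ∀ x, k x x ≤ 1)
    (P : Measure C(X, ℝ)) [IsProbabilityMeasure P] (hP : IsCenteredGP P k)
    (σ : ℝ≥0) (hσ : 0 < σ)
    -- the base algorithm, its seed, and the condition
    {S : Type*} [MeasurableSpace S] (ν : Measure S) [IsProbabilityMeasure ν]
    (A : ∀ t : ℕ, Dataset X t → S → X)
    (hA : ∀ t, Measurable fun q : Dataset X t × S => A t q.1 q.2)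
    (ζ ξ : ℕ → ℝ) (hcond : RegretCondition P k σ ν A ζ ξ) :
    -- the bound for every run
    (∀ {Ω : Type*} [MeasurableSpace Ω] (μΩ : Measure Ω) [IsProbabilityMeasure μΩ]
        {W : Type*} [MeasurableSpace W] (R : ParallelRun Ω X S W),
        IsRandomizedKrigingBeliever P σ ν A μΩ R →
        ∀ ρ : ∀ T : ℕ, Dataset X T → X, IsMeanMaximizer k σ ρ →
        ∀ T : ℕ, 1 ≤ T →
          Integrable (simpleRegret R ρ T) μΩ ∧
          bayesSimpleRegret μΩ R ρ T ≤ regretBound P σ ζ ξ T / T) ∧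
    -- the order of the bound
    ((∃ x, k x x ≠ 0) →
      IsSoftBigO (regretBound P σ ζ ξ) fun T => Real.sqrt (T * maxInfoGain P σ T)) := by
  have : CompactSpace X := isCompact_iff_compactSpace.1 hXc
  have : Nonempty X := hXne.to_subtype
  refine ⟨fun μΩ _ _ _ R hR ρ hρ T hT => ⟨hR.integrable_simpleRegret hP hA hρ T,
    hR.integral_simpleRegret_le_regretBound hP hk hσ hA hρ hcond hT⟩, fun hne => ?_⟩
  exact isSoftBigO_regretBound hP hk hσ hcond.2.1 hcond.2.2 hne
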